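/- **Setting.** For each dimension $p$, the law of a class-$k$ observation $X$ ($k=1,2$) is an absolutely continuous distribution on $\mathbb R^p$ with mean $\mu_{(k)}$ and covariance matrix having orthonormal eigenvectors $u_{(k),1},\dots,u_{(k),p}$ and eigenvalues $\lambda_{(k),i}=\sigma_{(k),i}^2p^{\beta_k}+\tau_{(k),i}^2$ for $i\le m_k$ and $\lambda_{(k),i}=\tau_{(k),i}^2$ for $i>m_k$, where $m_k\ge1$ is fixed, $\beta_k\in[0,1]$, $\sigma_{(k),i}^2,\tau_{(k),i}^2>0$, the $\tau_{(k),i}^2$ are uniformly bounded, and $p^{-1}\sum_{i\le p}\tau_{(k),i}^2\to\tau_k^2>0$. The training sample consists of independent observations $X_{kj}$ ($j\le n_k$, $k=1,2$), with $n_k>m_k$ fixed and $n=n_1+n_2$; a test observation $Y$ with class $\pi(Y)$ is independent of it, $\mathbb P(\pi(Y)=k)=\pi_k>0$, $\pi_1+\pi_2=1$. Put $\mu=\mu_{(1)}-\mu_{(2)}$, and assume: 1. $p^{-1/2}\|\mu\|\to\delta>0$. 2. For each $k$ and $p$, the vector of scores $\lambda_{(k),i}^{-1/2}u_{(k),i}^\top(X-\mu_{(k)})$,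 $i\le p$, is distributed as the first $p$ elements of an infinite sequence $(z_{(k),i})_{i\ge1}$ (not depending on $p$) which has uniformly bounded fourth moments and is $\rho$-mixing after some permutation. 3. $\mathrm{Angle}(u_{(k),i},\mu)\to\theta_{(k),i}\in[0,\pi/2]$ for $i\le m_k$. 4. Let $\mathcal U$ be the span of the vectors $u_{(k),i}$, $i\le m_k$, over the classes $k$ with $\beta_k=1$. For all large $p$ it has a fixed dimension $m$ and an orthonormal basis $u_1,\dots,u_m$ such that $\mathrm{Angle}(u_i,\mu)\to\theta_i\in[0,\pi/2]$ and the matrices $R_{(k)}^{(p)}=(u_i^\top u_{(k),j})_{i\le m,\,j\le m_k}$ converge to matrices $R_{(k)}$ with orthonormal columns, and $[R_{(1)}\ R_{(2)}]$ has rank $m$. **Rule.** Let $\bar X_k$ and $\bar X$ be the class and total sample means, $d=\bar X_1-\bar X_2$, and let $\hat\lambda_1\ge\dots\ge\hat\lambda_p$, $\hat u_1,\dots,\hat u_p$ be an eigendecomposition of the within-class scatter matrix $\sum_k\sum_j(X_{kj}-\bar X_k)(X_{kj}-\bar X_k)^\top$. Let $\mathcal D$ be the set of $i\le n-2$ for which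 $\cos\mathrm{Angle}(\hat u_i,\mathcal U)$ does not tend to $0$ in probability. For $\alpha\in[-\infty,\infty]$ let $v_\alpha$ be the unit vector that is a positive multiple of $$\sum_{i\in\mathcal D}\frac{\alpha p}{\hat\lambda_i+\alpha p}\,\hat u_i\hat u_i^\top d+\sum_{i=n-1}^p\hat u_i\hat u_i^\top d$$ (with the fraction read as $1$ for $\alpha=\pm\infty$). The projected ridge rule $\phi_\alpha$ assigns $Y$ to class $1$ if $v_\alpha^\top(Y-\bar X)\ge0$ and to class $2$ otherwise. **Theorem.** In addition, assume strong spikes $\beta_1=\beta_2=1$, equal tail eigenvalues $\tau_1^2=\tau_2^2=:\tau^2$, that the limiting angle $\varphi$ between $\mu$ and $\mathcal U$ is not $0$ (that is, $\cos^2\varphi=\sum_{i\le m}\cos^2\theta_i<1$), and that for $k=1,2$ the vector $(z_{(k),1},\dots,z_{(k),m_k})$ has a joint density that is positive on all of $\mathbb R^{m_k}$. Then for every $\alpha\in[-\infty,\infty]$ the limits $$\mathcal P_k(\alpha)=\lim_{p\to\infty}\mathbb P(\phi_\alpha(Y)=k\mid\pi(Y)=k),\qquad \mathcal P(\alpha)=\lim_{p\to\infty}\mathbb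 P(\phi_\alpha(Y)=\pi(Y))=\pi_1\mathcal P_1(\alpha)+\pi_2\mathcal P_2(\alpha)$$ exist, $\mathcal P(-\tau^2)=1$, and $\mathcal P(\alpha)<\mathcal P(-\tau^2)$ for all $\alpha\ne-\tau^2$. -/

import Mathlib

open MeasureTheory ProbabilityTheory Filter Topology
open scoped ENNReal BigOperators

namespace HDLSS

noncomputable section

/-- Euclidean space of dimension `p`. -/
abbrev E (p : ℕ) : Type := EuclideanSpace ℝ (Fin p)

/-! ### Rho-mixing sequences -/

/-- The maximal correlation coefficient of two sub-sigma-fields `A`, `B`: the supremum of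
`|Corr (f, g)|` over square-integrable `f`, `g` measurable for `A`, `B` respectively (constant
functions contribute `0`). -/
def maxCorr {Ω : Type*} [MeasurableSpace Ω] (P : Measure Ω) (A B : MeasurableSpace Ω) : ℝ≥0∞ :=
  ⨆ (f : Ω → ℝ) (g : Ω → ℝ) (_ : Measurable[A] f) (_ : Measurable[B] g)
    (_ : MemLp f 2 P) (_ : MemLp g 2 P),
    ENNReal.ofReal (|cov[f, g; P]| / (Real.sqrt (Var[f; P]) * Real.sqrt (Var[g; P])))

/-- The sigma-field generated by the variables `Z i` with `i ∈ s`. -/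
@[reducible] def sigmaField {Ω : Type*} (Z : ℕ → Ω → ℝ) (s : Set ℕ) : MeasurableSpace Ω :=
  ⨆ i ∈ s, MeasurableSpace.comap (Z i) inferInstance

/-- The sequence `Z 0, Z 1, …` is rho-mixing: the maximal correlation between the past up to time
`j` and the future from time `j + k` on tends to `0` as `k → ∞`, uniformly in `j`. -/
def RhoMixing {Ω : Type*} [MeasurableSpace Ω] (P : Measure Ω) (Z : ℕ → Ω → ℝ) : Prop :=
  Tendsto (fun k : ℕ => ⨆ j : ℕ,
    maxCorr P (sigmaField Z (Set.Iic j)) (sigmaField Z (Set.Ici (j + k)))) atTop (𝓝 0)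

/-! ### Geometry -/

/-- The angle between a vector and a subspace, i.e. between the vector and its orthogonal
projection (it is `π / 2` if the projection vanishes). -/
def angleToSubspace {p : ℕ} (w : E p) (V : Submodule ℝ (E p)) : ℝ :=
  InnerProductGeometry.angle w (V.starProjection w)

/-- The orthonormal basis `u` consists of eigenvectors of `S`, with eigenvalues `lam`. -/
def IsEigendecomposition {p : ℕ} (S : Matrix (Fin p) (Fin p) ℝ) (lam : Fin p → ℝ)
    (u : OrthonormalBasis (Fin p) ℝ (E p)) : Prop :=
  ∀ i, Matrix.toEuclideanLin S (u i) = lam i • u i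

/-! ### The two populations -/

/-- The covariance matrix of a distribution on Euclidean space. -/
def covMatrix {p : ℕ} (F : Measure (E p)) : Matrix (Fin p) (Fin p) ℝ :=
  Matrix.of fun a b => cov[fun x => x a, fun x => x b; F]

/-- The data of a two-class problem in all dimensions `p` at once, with fixed class sample sizes.
Index `0 : Fin 2` is the first class, `1 : Fin 2` is the second class; all other
indices start at `0` as well. This structure holds no assumption. -/
structure TwoClassModel where
  /-- class probabilities -/
  prior : Fin 2 → ℝ
  /-- training sample sizes of the classes -/
  size : Fin 2 → ℕ
  /-- the distribution of an observation of class `k` in dimension `p` -/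
  law : Fin 2 → (p : ℕ) → Measure (E p)
  /-- population eigenvectors -/
  eigvec : Fin 2 → (p : ℕ) → OrthonormalBasis (Fin p) ℝ (E p)
  /-- numbers of spikes -/
  spikes : Fin 2 → ℕ
  /-- growth exponents of the spikes -/
  beta : Fin 2 → ℝ
  /-- spike sizes `σ ^ 2` -/
  sigmaSq : (k : Fin 2) → Fin (spikes k) → ℝ
  /-- tail eigenvalues -/
  tailSq : Fin 2 → ℕ → ℝ
  /-- limiting averages of the tail eigenvalues -/
  tauSq : Fin 2 → ℝ
  /-- the law of the infinite sequence of principal component scores of class `k` -/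
  scoreLaw : Fin 2 → Measure (ℕ → ℝ)

namespace TwoClassModel

variable (M : TwoClassModel)

/-- The total sample size. -/
def total : ℕ := M.size 0 + M.size 1

/-- The population mean of class `k`. -/
def mean (k : Fin 2) (p : ℕ) : E p := ∫ x, x ∂(M.law k p)

/-- The population mean difference. -/
def meanDiff (p : ℕ) : E p := M.mean 0 p - M.mean 1 p

/-- The population eigenvalues of the spiked model. -/
def eigval (k : Fin 2) (p : ℕ) (i : ℕ) : ℝ :=
  if h : i < M.spikes k then M.sigmaSq k ⟨i, h⟩ * (p : ℝ) ^ M.beta k + M.tailSq k i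
  else M.tailSq k i

/-- The principal component scores `Λ ^ (-1/2) Uᵀ (x - μ)` of an observation `x` of class `k`. -/
def scores (k : Fin 2) (p : ℕ) (x : E p) : Fin p → ℝ :=
  fun i => inner ℝ (M.eigvec k p i) (x - M.mean k p) / Real.sqrt (M.eigval k p i)

/-- The leading eigenvectors of class `k` (padded by `0` in the irrelevant case `p ≤ i`). -/
def leadVec (k : Fin 2) (p : ℕ) (i : Fin (M.spikes k)) : E p :=
  if h : (i : ℕ) < p then M.eigvec k p ⟨i, h⟩ else 0

/-- The leading eigenspace of class `k`. -/
def leadSpace (k : Fin 2) (p : ℕ) : Submodule ℝ (E p) :=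
  Submodule.span ℝ (Set.range (M.leadVec k p))

/-- The common leading eigenspace: spanned by the leading eigenvectors of the classes whose
spikes grow at the order of `p`. -/
def commonSpace (p : ℕ) : Submodule ℝ (E p) :=
  ⨆ (k : Fin 2) (_ : M.beta k = 1), M.leadSpace k p

/-- The general setting: positive class probabilities; in each class an absolutely continuous
distribution with finite second moments, whose covariance matrix has the eigenvectors and
eigenvalues of the model; and more observations than spikes in each class (so that the scatter
matrix of the leading scores of each class is almost surely positive definite). -/
structure Setting : Prop where
  prior_pos : ∀ k, 0 < M.prior k
  prior_sum : M.prior 0 + M.prior 1 = 1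
  isProb : ∀ k p, IsProbabilityMeasure (M.law k p)
  absCont : ∀ k p, M.law k p ≪ volume
  memLp : ∀ k p, MemLp (fun x : E p => x) 2 (M.law k p)
  eigen : ∀ k p, IsEigendecomposition (covMatrix (M.law k p)) (fun i => M.eigval k p i)
    (M.eigvec k p)
  size_gt : ∀ k, M.spikes k < M.size k

/-- The scaled length of the mean difference has a positive limit. -/
def MeanSeparation : Prop :=
  ∃ δ : ℝ, 0 < δ ∧ Tendsto (fun p : ℕ => ‖M.meanDiff p‖ / Real.sqrt p) atTop (𝓝 δ)

/-- The parameters of the spiked eigenvalue model. -/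
structure SpikedEigenvalues : Prop where
  spikes_pos : ∀ k, 1 ≤ M.spikes k
  beta_mem : ∀ k, M.beta k ∈ Set.Icc (0 : ℝ) 1
  sigmaSq_pos : ∀ k i, 0 < M.sigmaSq k i
  tailSq_pos : ∀ k i, 0 < M.tailSq k i
  tailSq_bdd : ∃ C : ℝ, ∀ k i, M.tailSq k i ≤ C
  tauSq_pos : ∀ k, 0 < M.tauSq k
  tail_avg : ∀ k, Tendsto (fun p : ℕ => (∑ i ∈ Finset.range p, M.tailSq k i) / (p : ℝ))
    atTop (𝓝 (M.tauSq k))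

/-- For every `p`, the vector of principal component scores consists of the first `p` elements of
an infinite random sequence, whose elements have uniformly bounded fourth moments and which is
rho-mixing under some permutation. -/
structure MixingScores : Prop where
  isProb : ∀ k, IsProbabilityMeasure (M.scoreLaw k)
  scores_law : ∀ k p,
    (M.law k p).map (M.scores k p) = (M.scoreLaw k).map (fun z (i : Fin p) => z i)
  fourth : ∃ C : ℝ, ∀ k i, ∫⁻ z, ENNReal.ofReal (z i ^ 4) ∂(M.scoreLaw k) ≤ ENNReal.ofReal C
  mixing : ∀ k, ∃ e : Equiv.Perm ℕ, RhoMixing (M.scoreLaw k) (fun i z => z (e i))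

/-- The angles between the leading eigenvectors of each class and the mean difference converge. -/
def LeadingAngles : Prop :=
  ∀ k i, ∃ θ ∈ Set.Icc (0 : ℝ) (Real.pi / 2),
    Tendsto (fun p => InnerProductGeometry.angle (M.leadVec k p i) (M.meanDiff p)) atTop (𝓝 θ)

/-- The common leading eigenspace has a fixed dimension `m` (for large `p`) and orthonormal bases
`u` whose angles with the mean difference converge, such that the coordinate matrices of the
leading eigenvectors of the classes in these bases converge, to matrices with orthonormal columns
which are jointly of rank `m`. -/
def CommonBasis : Prop :=
  ∃ (m : ℕ) (u : (p : ℕ) → Fin m → E p) (θ : Fin m → ℝ)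
    (R : (k : Fin 2) → Matrix (Fin m) (Fin (M.spikes k)) ℝ),
    (∀ᶠ p in atTop, Orthonormal ℝ (u p) ∧
      Submodule.span ℝ (Set.range (u p)) = M.commonSpace p) ∧
    (∀ i, θ i ∈ Set.Icc (0 : ℝ) (Real.pi / 2) ∧
      Tendsto (fun p => InnerProductGeometry.angle (u p i) (M.meanDiff p)) atTop (𝓝 (θ i))) ∧
    (∀ k i j, Tendsto (fun p => inner ℝ (u p i) (M.leadVec k p j)) atTop (𝓝 (R k i j))) ∧
    (∀ k, (R k).transpose * R k = 1) ∧
    (Matrix.fromCols (R 0) (R 1)).rank = m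

/-- The leading scores of class `k` have a joint density that is positive everywhere. -/
def FullSupportScores : Prop :=
  ∀ k, ∃ f : (Fin (M.spikes k) → ℝ) → ℝ≥0∞, Measurable f ∧
    (M.scoreLaw k).map (fun z (i : Fin (M.spikes k)) => z i) = volume.withDensity f ∧
    ∀ x, 0 < f x

/-! ### Training sample and test observation -/

/-- A training sample in dimension `p`. -/
abbrev Sample (p : ℕ) : Type := (k : Fin 2) → Fin (M.size k) → E p

/-- The law of the training sample: independent observations, `size k` of them from class `k`. -/
def trainLaw (p : ℕ) : Measure (M.Sample p) :=
  Measure.pi fun k => Measure.pi fun _ : Fin (M.size k) => M.law k p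

/-- The joint law of the class and the value of a test observation. -/
def testLaw (p : ℕ) : Measure (Fin 2 × E p) :=
  ∑ k : Fin 2, ENNReal.ofReal (M.prior k) • (Measure.dirac k).prod (M.law k p)

/-- The joint law of the training sample and an independent test observation with its class. -/
def jointLaw (p : ℕ) : Measure (M.Sample p × (Fin 2 × E p)) :=
  (M.trainLaw p).prod (M.testLaw p)

variable {M} {p : ℕ}

/-- The sample mean of class `k`. -/
def classMean (x : M.Sample p) (k : Fin 2) : E p := (M.size k : ℝ)⁻¹ • ∑ j, x k j

/-- The total sample mean. -/
def totalMean (x : M.Sample p) : E p := (M.total : ℝ)⁻¹ • ∑ k, ∑ j, x k j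

/-- The sample mean difference. -/
def sampleDiff (x : M.Sample p) : E p := classMean x 0 - classMean x 1

/-- The within-class scatter matrix. -/
def withinScatter (x : M.Sample p) : Matrix (Fin p) (Fin p) ℝ :=
  ∑ k, ∑ j, Matrix.vecMulVec (x k j - classMean x k) (x k j - classMean x k)

variable (M)

/-- `lam`, `u` give, for every training sample, an eigendecomposition of its within-class scatter
matrix with eigenvalues in descending order. -/
def IsSampleEigen (lam : (p : ℕ) → M.Sample p → Fin p → ℝ)
    (u : (p : ℕ) → M.Sample p → OrthonormalBasis (Fin p) ℝ (E p)) : Prop :=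
  ∀ p x, IsEigendecomposition (withinScatter x) (lam p x) (u p x) ∧ Antitone (lam p x)

/-- The signal index set: those of the first `n - 2` sample eigenvectors which are not strongly
inconsistent with the common leading eigenspace, that is, for which the cosine of the angle to
this space does not tend to `0` in probability. -/
def signalIndex (u : (p : ℕ) → M.Sample p → OrthonormalBasis (Fin p) ℝ (E p)) : Set ℕ :=
  {i | i + 2 < M.total ∧ ∃ ε : ℝ, 0 < ε ∧
    ¬ Tendsto (fun p => M.trainLaw p
      {x | ∃ h : i < p, ε < Real.cos (angleToSubspace (u p x ⟨i, h⟩) (M.commonSpace p))})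
      atTop (𝓝 0)}

end TwoClassModel

/-! ### The projected ridge classification rule -/

/-- The weight `α p / (lam + α p)` for the ridge parameter `α ∈ [-∞, ∞]`, equal to `1` if `α` is
infinite. -/
def ridgeWeight (α : EReal) (p : ℕ) (lam : ℝ) : ℝ :=
  if α = ⊤ ∨ α = ⊥ then 1 else α.toReal * p / (lam + α.toReal * p)

namespace TwoClassModel

variable (M : TwoClassModel)
  (lam : (p : ℕ) → M.Sample p → Fin p → ℝ)
  (u : (p : ℕ) → M.Sample p → OrthonormalBasis (Fin p) ℝ (E p))

open Classical in
/-- The projected ridged linear discriminant vector before normalization: the second sum is the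
projection of the sample mean difference onto the span of the sample eigenvectors
number `n - 1, …, p`. -/
def ridgeVec (α : EReal) (p : ℕ) (x : M.Sample p) : E p :=
  (∑ i ∈ (Finset.univ : Finset (Fin p)).filter (fun i : Fin p => (i : ℕ) ∈ M.signalIndex u),
    (ridgeWeight α p (lam p x i) * inner ℝ (u p x i) (sampleDiff x)) • u p x i) +
  ∑ i ∈ (Finset.univ : Finset (Fin p)).filter (fun i : Fin p => M.total ≤ (i : ℕ) + 2),
    (inner ℝ (u p x i) (sampleDiff x) : ℝ) • u p x i

/-- The projected ridged linear discriminant vector, of unit length. -/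
def unitRidgeVec (α : EReal) (p : ℕ) (x : M.Sample p) : E p :=
  ‖M.ridgeVec lam u α p x‖⁻¹ • M.ridgeVec lam u α p x

open Classical in
/-- The projected ridge classification rule. -/
def ridgeRule (α : EReal) (p : ℕ) (x : M.Sample p) (y : E p) : Fin 2 :=
  if 0 ≤ (inner ℝ (M.unitRidgeVec lam u α p x) (y - totalMean x) : ℝ) then 0 else 1

/-- The correct classification rate of the rule for test observations of class `k`: a conditional
probability given the class. -/
def classRate (k : Fin 2) (α : EReal) (p : ℕ) : ℝ :=
  ((M.jointLaw p)[|{q | q.2.1 = k}]).real {q | M.ridgeRule lam u α p q.1 q.2.2 = k}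

/-- The correct classification rate of the rule. -/
def rate (α : EReal) (p : ℕ) : ℝ :=
  (M.jointLaw p).real {q | M.ridgeRule lam u α p q.1 q.2.2 = q.2.1}

end TwoClassModel

end

end HDLSS

namespace HDLSS

noncomputable section

local notation "⟪" x ", " y "⟫" => inner ℝ x y

/-! Divide all vectors by `√p`. A deviation from a class mean splits into a leading part, which lies
in the common leading space and has coordinates in `ℝ^m`, and a noise part. Second moment bounds and
a law of large numbers for the ρ-mixing squared scores show that noise vectors become orthogonal to
each other, to the basis and to the mean difference, while their squared lengths tend to `τ`. So all
inner products tend to those of vectors `L a`, `Ls`, `Mu` of `ℝ^m`, with excess `τ` on the diagonal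
of the training block and excess `κ = δ² sin² φ > 0` for the squared mean difference (`gramLimit`,
`exists_basisLimit`).

The nonzero spectrum of the scatter matrix is that of the Gram matrix of the centred sample, which
acts on the fixed `(n - 2)`-dimensional space of coefficients with zero class sums. Let `N` be the
scatter matrix of the centred `L a`. In the limit the scaled eigenvalues `ℓ_j` and the traces `ξ_j`
of the eigenvectors in `ℝ^m` satisfy `ℓ_j ‖ξ_j‖² = ℓ_j - τ` and `N = ∑ ℓ_j ξ_j ξ_jᵀ`, with
orthogonal `ξ_j` (`spectral_limit`). For invertible `N` exactly the first `m` of the `ξ_j` are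
nonzero, which identifies the signal set (`signalIndex_eq`).

As the ridge weight tends to `1 - ℓ_j / (ℓ_j + α)`, the weighted sum collapses: the unnormalized
statistic over `p` tends to `c_k κ + (α + τ) ⟪W, (N + α + τ)⁻¹ D⟫`, where `D` and `W` come from the
sample mean difference and the centred test observation, and `c_k` is `n_2 / n` or `-n_1 / n`
(`statistic_limit`, `statistic_tendsto`). For infinite `α` the second term is `⟪W, D⟫`. At `α = -τ`
only `c_k κ` is left, and it has the right sign (`limitLaw_correct_eq_one`). For any other `α` the
leading scores can make the limit negative for the first class, on an open set, which has positive
mass because the score density is positive (`limitLaw_correct_lt_one`).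

The leading scores have the same law for all large `p`, so no convergence in distribution is needed.
Multiplying the limit by a squared determinant gives `limitStat`, a polynomial in the scores whose
zero set is null. On compact sets of good scores the rule agrees with the sign of `limitStat` once
`p` is large and the noise deviation is small (`exists_uniform`, by compactness along an
ultrafilter), and such sets exhaust the mass (`exists_eventually_pairLaw_le`). This yields the
limits of the class rates (`pairLaw_ridgeRule_tendsto`). -/

theorem exists_tendsto_of_bounded {ι : Type*} (𝒰 : Ultrafilter ι) (f : ι → ℝ) (C : ℝ)
    (h : ∀ᶠ i in (𝒰 : Filter ι), |f i| ≤ C) : ∃ x, Tendsto f 𝒰 (𝓝 x) := by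
  obtain ⟨x, -, hx⟩ := (isCompact_Icc (a := -C) (b := C)).ultrafilter_le_nhds (𝒰.map f) (by
    rw [Ultrafilter.coe_map, le_principal_iff, mem_map]
    filter_upwards [h] with i hi
    exact abs_le.1 hi)
  exact ⟨x, hx⟩

theorem tendsto_toLp {ι A : Type*} [Fintype A] {l : Filter ι} {f : ι → A → ℝ}
    {x : EuclideanSpace ℝ A} (h : ∀ a, Tendsto (fun i => f i a) l (𝓝 (x a))) :
    Tendsto (fun i => WithLp.toLp 2 (f i)) l (𝓝 x) := by
  have h1 : Tendsto f l (𝓝 (WithLp.ofLp x)) := tendsto_pi_nhds.2 h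
  exact ((PiLp.continuous_toLp 2 (fun _ : A => ℝ)).tendsto _).comp h1

theorem sum_fin_eq_sum_castLE_add {β : Type*} [AddCommMonoid β] {r p : ℕ} (h : r ≤ p)
    (f : Fin p → β) :
    ∑ j, f j = ∑ j : Fin r, f (Fin.castLE h j) +
      ∑ j ∈ Finset.univ.filter (fun j : Fin p => r ≤ (j : ℕ)), f j := by
  rw [← Finset.sum_filter_add_sum_filter_not Finset.univ (fun j : Fin p => (j : ℕ) < r)]
  congr 1
  · symm
    apply Finset.sum_nbij (Fin.castLE h)
    · intro j _; simp
    · exact (Fin.castLE_injective h).injOn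
    · intro j hj
      simp only [Finset.coe_filter, Finset.mem_univ, true_and, Set.mem_ofPred_eq] at hj
      exact ⟨⟨j, hj⟩, by simp, by ext; simp⟩
    · intros; rfl
  · simp only [not_lt]

/-! ### Duality between scatter and Gram matrices -/

section Coefficients

variable {A H : Type*} [NormedAddCommGroup H] [InnerProductSpace ℝ H]

/-- The inner products of `v` with the vectors of a finite family. -/
def coeffs (c : A → H) (v : H) : EuclideanSpace ℝ A := WithLp.toLp 2 fun a => ⟪c a, v⟫

theorem coeffs_apply (c : A → H) (v : H) (a : A) : coeffs c v a = ⟪c a, v⟫ := rfl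

variable [Fintype A]

/-- The linear combination of a finite family of vectors. -/
def combo (c : A → H) (x : EuclideanSpace ℝ A) : H := ∑ a, x a • c a

theorem inner_coeffs (c : A → H) (x : EuclideanSpace ℝ A) (v : H) :
    ⟪x, coeffs c v⟫ = ⟪combo c x, v⟫ := by
  simp only [PiLp.inner_apply, coeffs_apply, combo, sum_inner, real_inner_smul_left]
  exact Finset.sum_congr rfl fun a _ => by simp [mul_comm]

theorem inner_coeffs_left (c : A → H) (x : EuclideanSpace ℝ A) (v : H) :
    ⟪coeffs c v, x⟫ = ⟪combo c x, v⟫ := by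
  rw [real_inner_comm, inner_coeffs]

end Coefficients

section Exact

variable {A : Type*} [Fintype A] {p : ℕ} {c : A → E p} {u : OrthonormalBasis (Fin p) ℝ (E p)}
  {lam : Fin p → ℝ} {V : Submodule ℝ (EuclideanSpace ℝ A)}

/-- `combo c` is the adjoint of `coeffs c`, so `combo c ∘ coeffs c` is the scatter operator `∑ a, c
a (c a)ᵀ` and `he` is its eigenvalue equation. The vectors `coeffs c (u j)` are then orthogonal
eigenvectors, not normalized, of the dual Gram matrix. -/
theorem inner_coeffs_eigvec (he : ∀ j, combo c (coeffs c (u j)) = lam j • u j) (j : Fin p)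
    (v : E p) : ⟪coeffs c (u j), coeffs c v⟫ = lam j * ⟪u j, v⟫ := by
  rw [inner_coeffs, he, real_inner_smul_left]

theorem eigval_eq_norm_sq (he : ∀ j, combo c (coeffs c (u j)) = lam j • u j) (j : Fin p) :
    lam j = ‖coeffs c (u j)‖ ^ 2 := by
  rw [← real_inner_self_eq_norm_sq, inner_coeffs_eigvec he]
  simp

/-- Otherwise `lam j`, and hence every earlier eigenvalue, would be positive, giving `j + 1` nonzero
orthogonal vectors inside `V`. -/
theorem coeffs_eigvec_eq_zero (he : ∀ j, combo c (coeffs c (u j)) = lam j • u j)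
    (hanti : Antitone lam) (hV : ∀ v, coeffs c v ∈ V) (j : Fin p)
    (hj : Module.finrank ℝ V ≤ j) : coeffs c (u j) = 0 := by
  by_contra hne
  have hpos : 0 < lam j := by
    rw [eigval_eq_norm_sq he]
    have := norm_pos_iff.2 hne
    positivity
  let f : Fin (j + 1) → V := fun i => ⟨coeffs c (u ⟨i, by omega⟩), hV _⟩
  have hf : LinearIndependent ℝ f := by
    apply linearIndependent_of_ne_zero_of_inner_eq_zero (𝕜 := ℝ)
    · intro i h0
      have h1 : coeffs c (u ⟨i, by omega⟩) = 0 := congrArg Subtype.val h0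
      have h2 : lam j ≤ lam ⟨i, by omega⟩ := hanti (by
        rw [Fin.le_def]; have := i.2; simp only; omega)
      rw [eigval_eq_norm_sq he ⟨i, _⟩, h1] at h2
      simp at h2; linarith
    · intro i i' hii
      change ⟪coeffs c (u _), coeffs c (u _)⟫ = 0
      rw [inner_coeffs_eigvec he, orthonormal_iff_ite.1 u.orthonormal, if_neg, mul_zero]
      intro h; apply hii; ext; simpa using congrArg Fin.val h
  have := hf.fintype_card_le_finrank
  simp at this
  omega

end Exact

/-! ### Limiting spectrum of a scatter matrix in growing dimension -/

/-- Families of scatter matrices `∑ a, c a (c a)ᵀ`, with eigendecompositions, in growing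
dimensions, whose Gram matrices converge along an ultrafilter to that of the finite-dimensional
family `L` plus `τ` times the identity, on the subspace `V` of coefficients. -/
structure ScatterLimit {ι A : Type*} [Fintype A] (𝒰 : Ultrafilter ι) (p : ι → ℕ) {m : ℕ}
    (V : Submodule ℝ (EuclideanSpace ℝ A)) (c : (i : ι) → A → E (p i))
    (L : A → E m) (τ : ℝ) (lam : (i : ι) → Fin (p i) → ℝ)
    (u : (i : ι) → OrthonormalBasis (Fin (p i)) ℝ (E (p i))) : Prop where
  pos : 0 < τ
  dim_le : ∀ i, Module.finrank ℝ V ≤ p i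
  coeffs_mem : ∀ i v, coeffs (c i) v ∈ V
  limit_mem : ∀ v, coeffs L v ∈ V
  gram : ∀ x ∈ V, ∀ y ∈ V, Tendsto (fun i => ⟪combo (c i) x, combo (c i) y⟫) 𝒰
    (𝓝 (⟪combo L x, combo L y⟫ + τ * ⟪x, y⟫))
  bounded : ∃ C, ∀ᶠ i in (𝒰 : Filter ι), ∀ a, ‖c i a‖ ≤ C
  eigen : ∀ i j, combo (c i) (coeffs (c i) (u i j)) = lam i j • u i j
  anti : ∀ i, Antitone (lam i)

namespace ScatterLimit

variable {ι A : Type*} [Fintype A] {𝒰 : Ultrafilter ι} {p : ι → ℕ} {m : ℕ}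
    {V : Submodule ℝ (EuclideanSpace ℝ A)} {c : (i : ι) → A → E (p i)}
    {L : A → E m} {τ : ℝ} {lam : (i : ι) → Fin (p i) → ℝ}
    {u : (i : ι) → OrthonormalBasis (Fin (p i)) ℝ (E (p i))}

/-- Parseval in the eigenbasis; the eigenvectors beyond the rank are orthogonal to every `c i a`.
This leaves a sum of fixed length, through which limits can be taken. -/
theorem inner_combo_eq (h : ScatterLimit 𝒰 p V c L τ lam u) (i : ι)
    (x y : EuclideanSpace ℝ A) :
    ⟪combo (c i) x, combo (c i) y⟫ = ∑ j : Fin (Module.finrank ℝ V),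
      ⟪x, coeffs (c i) (u i (Fin.castLE (h.dim_le i) j))⟫ *
      ⟪y, coeffs (c i) (u i (Fin.castLE (h.dim_le i) j))⟫ := by
  rw [← (u i).sum_inner_mul_inner, sum_fin_eq_sum_castLE_add (h.dim_le i)]
  rw [add_eq_left.2]
  · refine Finset.sum_congr rfl fun j _ => ?_
    rw [inner_coeffs, inner_coeffs, real_inner_comm (combo (c i) y)]
  · refine Finset.sum_eq_zero fun j hj => ?_
    rw [← inner_coeffs, coeffs_eigvec_eq_zero (h.eigen i) (h.anti i) (h.coeffs_mem i) j
      (Finset.mem_filter.1 hj).2]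
    simp

theorem exists_limits (h : ScatterLimit 𝒰 p V c L τ lam u) :
    ∃ (η : Fin (Module.finrank ℝ V) → EuclideanSpace ℝ A), ∀ j,
      Tendsto (fun i => coeffs (c i) (u i (Fin.castLE (h.dim_le i) j))) 𝒰 (𝓝 (η j)) := by
  obtain ⟨C, hC⟩ := h.bounded
  have key : ∀ j a, ∃ x, Tendsto (fun i => ⟪c i a, u i (Fin.castLE (h.dim_le i) j)⟫) 𝒰
      (𝓝 x) := by
    intro j a
    apply exists_tendsto_of_bounded _ _ C
    filter_upwards [hC] with i hi
    refine (abs_real_inner_le_norm _ _).trans ?_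
    rw [(u i).orthonormal.1, mul_one]
    exact hi a
  choose x hx using key
  exact ⟨fun j => WithLp.toLp 2 (x j), fun j => tendsto_toLp fun a => hx j a⟩

/-- The limits of the leading eigenvalues and eigenvectors, the latter seen through their inner
products with convergent families. -/
theorem spectral_limit (h : ScatterLimit 𝒰 p V c L τ lam u) :
    ∃ (ℓ : Fin (Module.finrank ℝ V) → ℝ) (ξ : Fin (Module.finrank ℝ V) → E m),
      (∀ j, Tendsto (fun i => lam i (Fin.castLE (h.dim_le i) j)) 𝒰 (𝓝 (ℓ j))) ∧
      (∀ j, 0 < ℓ j) ∧ Antitone ℓ ∧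
      (∀ (w : (i : ι) → E (p i)) (W : E m),
        (∀ a, Tendsto (fun i => ⟪c i a, w i⟫) 𝒰 (𝓝 ⟪L a, W⟫)) →
        ∀ j, Tendsto (fun i => ⟪u i (Fin.castLE (h.dim_le i) j), w i⟫) 𝒰 (𝓝 ⟪ξ j, W⟫)) ∧
      (∀ j j', j ≠ j' → ⟪ξ j, ξ j'⟫ = 0) ∧
      (∀ j, ℓ j * ‖ξ j‖ ^ 2 = ℓ j - τ) ∧
      (∀ y e, ∑ a, ⟪L a, y⟫ * ⟪L a, e⟫ = ∑ j, ℓ j * (⟪ξ j, y⟫ * ⟪ξ j, e⟫)) := by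
  obtain ⟨η, hη⟩ := h.exists_limits
  have hmem : ∀ j, η j ∈ V := fun j =>
    (Submodule.closed_of_finiteDimensional V).mem_of_tendsto (hη j)
      (Eventually.of_forall fun i => h.coeffs_mem i _)
  have horth : ∀ j j', j ≠ j' → ⟪η j, η j'⟫ = 0 := by
    intro j j' hjj
    refine tendsto_nhds_unique ((hη j).inner (hη j')) ?_
    refine tendsto_const_nhds.congr fun i => ?_
    rw [inner_coeffs_eigvec (h.eigen i), orthonormal_iff_ite.1 (u i).orthonormal, if_neg,
      mul_zero]
    exact fun h' => hjj (Fin.castLE_injective _ h')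
  have hlam : ∀ j, Tendsto (fun i => lam i (Fin.castLE (h.dim_le i) j)) 𝒰 (𝓝 (‖η j‖ ^ 2)) := by
    intro j
    refine ((hη j).norm.pow 2).congr fun i => ?_
    rw [← eigval_eq_norm_sq (h.eigen i)]
  -- The limits `η j` resolve the limiting Gram form. Because `τ > 0` this form is definite on `V`,
  -- so the `η j` are total in `V`; being as many as the dimension, they are all nonzero.
  have hfull : ∀ x ∈ V, ∀ y ∈ V, ∑ j, ⟪x, η j⟫ * ⟪y, η j⟫ =
      ⟪combo L x, combo L y⟫ + τ * ⟪x, y⟫ := by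
    intro x hx y hy
    refine tendsto_nhds_unique ?_ (h.gram x hx y hy)
    simp only [h.inner_combo_eq]
    exact tendsto_finsetSum _ fun j _ =>
      (tendsto_const_nhds.inner (hη j)).mul (tendsto_const_nhds.inner (hη j))
  have hzero : ∀ x ∈ V, (∀ j, ⟪x, η j⟫ = 0) → x = 0 := by
    intro x hx h0
    have h1 := hfull x hx x hx
    simp only [h0, mul_zero, Finset.sum_const_zero, real_inner_self_eq_norm_sq] at h1
    have h2 : 0 ≤ τ * ‖x‖ ^ 2 := mul_nonneg h.pos.le (sq_nonneg _)
    have h3 : τ * ‖x‖ ^ 2 = 0 := by nlinarith [sq_nonneg ‖combo L x‖]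
    have h4 := (mul_eq_zero.1 h3).resolve_left h.pos.ne'
    simpa using h4
  have hne : ∀ j, η j ≠ 0 := by
    let T : V →ₗ[ℝ] (Fin (Module.finrank ℝ V) → ℝ) :=
      LinearMap.pi fun j => ((innerₗ (EuclideanSpace ℝ A)).flip (η j)) ∘ₗ V.subtype
    have hT : Function.Injective T := by
      rw [← LinearMap.ker_eq_bot, LinearMap.ker_eq_bot']
      intro x hx
      apply Subtype.ext
      exact hzero x x.2 fun j => congrFun hx j
    have hT' : Function.Surjective T :=
      (LinearMap.injective_iff_surjective_of_finrank_eq_finrank (by simp)).1 hT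
    intro j hj
    obtain ⟨x, hx⟩ := hT' (fun _ => 1)
    have h1 : ⟪(x : EuclideanSpace ℝ A), η j⟫ = 1 := congrFun hx j
    rw [hj, inner_zero_right] at h1
    exact zero_ne_one h1
  set ℓ : Fin (Module.finrank ℝ V) → ℝ := fun j => ‖η j‖ ^ 2 with hℓ
  have hℓpos : ∀ j, 0 < ℓ j := fun j => by have := norm_pos_iff.2 (hne j); simp only [hℓ]; positivity
  have hin : ∀ j k, ⟪η j, η k⟫ = if j = k then ℓ j else 0 := by
    intro j k
    split_ifs with hjk
    · rw [← hjk, real_inner_self_eq_norm_sq]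
    · exact horth j k hjk
  have hcomplete : ∀ x ∈ V, x = ∑ j, (⟪x, η j⟫ / ℓ j) • η j := by
    intro x hx
    rw [← sub_eq_zero]
    apply hzero _ (V.sub_mem hx (V.sum_mem fun j _ => V.smul_mem _ (hmem j)))
    intro k
    rw [inner_sub_left, sum_inner]
    simp only [real_inner_smul_left, hin]
    simp [(hℓpos k).ne']
  -- An eigenvector is recovered from its coefficients as `u = lam⁻¹ • combo c (coeffs c u)`; its
  -- limit in `ℝ^m` has the same form, with `L` in place of `c`.
  refine ⟨ℓ, fun j => (ℓ j)⁻¹ • combo L (η j), hlam, hℓpos, ?_, ?_, ?_, ?_, ?_⟩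
  · intro j k hjk
    exact le_of_tendsto_of_tendsto (hlam k) (hlam j) (Eventually.of_forall fun i =>
      h.anti i (by simpa using hjk))
  · intro w W hw j
    have h1 : Tendsto (fun i => ⟪coeffs (c i) (u i (Fin.castLE (h.dim_le i) j)),
        coeffs (c i) (w i)⟫ / lam i (Fin.castLE (h.dim_le i) j)) 𝒰
        (𝓝 (⟪η j, coeffs L W⟫ / ℓ j)) :=
      ((hη j).inner (tendsto_toLp hw)).div (hlam j) (hℓpos j).ne'
    rw [inner_coeffs] at h1
    rw [real_inner_smul_left, inv_mul_eq_div]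
    refine h1.congr' ?_
    filter_upwards [(hlam j).eventually_ne (hℓpos j).ne'] with i hi
    rw [inner_coeffs_eigvec (h.eigen i), mul_div_cancel_left₀ _ hi]
  · intro j k hjk
    have h1 := hfull (η j) (hmem j) (η k) (hmem k)
    simp only [hin, if_neg hjk] at h1
    rw [real_inner_smul_left, real_inner_smul_right]
    have h2 : ⟪combo L (η j), combo L (η k)⟫ = 0 := by
      rw [mul_zero, add_zero] at h1
      rw [← h1]
      refine Finset.sum_eq_zero fun i _ => ?_
      by_cases hji : j = i
      · rw [if_neg (fun hki : k = i => hjk (hji.trans hki.symm)), mul_zero]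
      · rw [if_neg hji, zero_mul]
    rw [h2, mul_zero, mul_zero]
  -- On the diagonal the form at `η j` gives `ℓ² = ‖combo L (η j)‖² + τ ℓ`; dividing by `ℓ` yields
  -- the norm identity.
  · intro j
    have h1 := hfull (η j) (hmem j) (η j) (hmem j)
    simp only [hin] at h1
    simp only [mul_ite, mul_zero, ite_mul, zero_mul, Finset.sum_ite_eq, Finset.mem_univ, if_true,
      real_inner_self_eq_norm_sq] at h1
    rw [norm_smul, mul_pow, norm_inv, Real.norm_of_nonneg (hℓpos j).le]
    have := (hℓpos j).ne'
    field_simp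
    linarith
  · intro y e
    have h1 : ∀ z j, ⟪coeffs L z, η j⟫ = ℓ j * ⟪(ℓ j)⁻¹ • combo L (η j), z⟫ := by
      intro z j
      rw [inner_coeffs_left, real_inner_smul_left, mul_inv_cancel_left₀ (hℓpos j).ne']
    have h2 : ∑ a, ⟪L a, y⟫ * ⟪L a, e⟫ = ⟪coeffs L y, coeffs L e⟫ := by
      simp only [PiLp.inner_apply, coeffs_apply]
      exact Finset.sum_congr rfl fun a _ => by simp [mul_comm]
    rw [h2]
    conv_lhs => rw [hcomplete _ (h.limit_mem y)]
    rw [sum_inner]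
    refine Finset.sum_congr rfl fun j _ => ?_
    rw [real_inner_smul_left, h1, real_inner_comm (coeffs L e) (η j), h1]
    have := (hℓpos j).ne'
    field_simp

end ScatterLimit

/-! ### Signal eigenvectors and the limit of the discriminant statistic -/

theorem Finset.mem_iff_lt_card_of_isLowerSet {r : ℕ} (S : Finset (Fin r))
    (hS : ∀ j ∈ S, ∀ k ≤ j, k ∈ S) (j : Fin r) : j ∈ S ↔ (j : ℕ) < S.card := by
  constructor
  · intro hj
    have h1 : Finset.Iic j ⊆ S := fun k hk => hS j hj k (Finset.mem_Iic.1 hk)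
    have := Finset.card_le_card h1
    rw [Fin.card_Iic] at this
    omega
  · intro hlt
    by_contra hj
    have h1 : S ⊆ Finset.Iio j := fun k hk => by
      rw [Finset.mem_Iio]
      by_contra hkj
      exact hj (hS k hk j (not_lt.1 hkj))
    have := Finset.card_le_card h1
    rw [Fin.card_Iio] at this
    omega

theorem card_nonzero_of_orthogonal_total {r m : ℕ} (ξ : Fin r → E m)
    (horth : ∀ j j', j ≠ j' → ⟪ξ j, ξ j'⟫ = 0)
    (htot : ∀ v, (∀ j, ⟪ξ j, v⟫ = 0) → v = 0) :
    (Finset.univ.filter fun j => ξ j ≠ 0).card = m := by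
  classical
  set S := Finset.univ.filter fun j => ξ j ≠ 0 with hS
  apply le_antisymm
  · have hf : LinearIndependent ℝ fun j : S => ξ j := by
      apply linearIndependent_of_ne_zero_of_inner_eq_zero (𝕜 := ℝ)
      · exact fun j => (Finset.mem_filter.1 j.2).2
      · exact fun j k hjk => horth _ _ fun h => hjk (Subtype.ext h)
    have := hf.fintype_card_le_finrank
    simpa using this
  · let T : E m →ₗ[ℝ] (S → ℝ) := LinearMap.pi fun j => innerₗ (E m) (ξ j)
    have hT : Function.Injective T := by
      rw [← LinearMap.ker_eq_bot, LinearMap.ker_eq_bot']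
      intro x hx
      apply htot
      intro j
      by_cases hj : ξ j = 0
      · rw [hj, inner_zero_left]
      · exact congrFun hx ⟨j, by simp [hS, hj]⟩
    have := LinearMap.finrank_le_finrank_of_injective hT
    simpa using this

namespace ScatterLimit

variable {ι A : Type*} [Fintype A] {𝒰 : Ultrafilter ι} {p : ι → ℕ} {m : ℕ}
    {V : Submodule ℝ (EuclideanSpace ℝ A)} {c : (i : ι) → A → E (p i)}
    {L : A → E m} {τ : ℝ} {lam : (i : ι) → Fin (p i) → ℝ}
    {u : (i : ι) → OrthonormalBasis (Fin (p i)) ℝ (E (p i))}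

/-- By the norm identity, `ξ j ≠ 0` means `ℓ j > τ`, which cuts out an initial segment since `ℓ` is
antitone. Injectivity of the limiting scatter makes the orthogonal family `ξ` total in `ℝ^m`, so the
segment has length `m`. -/
theorem nonzero_iff {r : ℕ} {ℓ : Fin r → ℝ} {ξ : Fin r → E m} (hℓ : ∀ j, 0 < ℓ j)
    (hanti : Antitone ℓ) (horth : ∀ j j', j ≠ j' → ⟪ξ j, ξ j'⟫ = 0)
    (hnorm : ∀ j, ℓ j * ‖ξ j‖ ^ 2 = ℓ j - τ)
    (hsum : ∀ y e, ∑ a, ⟪L a, y⟫ * ⟪L a, e⟫ = ∑ j, ℓ j * (⟪ξ j, y⟫ * ⟪ξ j, e⟫))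
    (hinj : ∀ v, (∀ a, ⟪L a, v⟫ = 0) → v = 0) :
    m ≤ r ∧ ∀ j, ξ j ≠ 0 ↔ (j : ℕ) < m := by
  have hcard := card_nonzero_of_orthogonal_total ξ horth (by
    intro v hv
    apply hinj
    have h1 := hsum v v
    simp only [hv, mul_zero, Finset.sum_const_zero] at h1
    intro a
    have := (Finset.sum_eq_zero_iff_of_nonneg (fun a _ => mul_self_nonneg _)).1 h1 a
      (Finset.mem_univ a)
    simpa using this)
  constructor
  · calc m = _ := hcard.symm
      _ ≤ _ := Finset.card_filter_le _ _
      _ = r := by simp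
  · intro j
    have h1 : ∀ j, ξ j ≠ 0 ↔ τ < ℓ j := by
      intro j
      rw [← sub_pos, ← hnorm, mul_pos_iff_of_pos_left (hℓ j), ← norm_ne_zero_iff,
        sq_pos_iff]
    have h2 := Finset.mem_iff_lt_card_of_isLowerSet (Finset.univ.filter fun j => ξ j ≠ 0) (by
      intro j hj k hk
      simp only [Finset.mem_filter, Finset.mem_univ, true_and, h1] at hj ⊢
      exact hj.trans_le (hanti hk)) j
    rw [hcard] at h2
    simpa using h2

/-- The squared projections onto the space of `b` tend to `‖ξ j‖²`, tested on the coordinate vectors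
of `ℝ^m`. -/
theorem signal_limit (h : ScatterLimit 𝒰 p V c L τ lam u)
    (hinj : ∀ v, (∀ a, ⟪L a, v⟫ = 0) → v = 0) (b : (i : ι) → Fin m → E (p i))
    (hb : ∀ a r, Tendsto (fun i => ⟪c i a, b i r⟫) 𝒰 (𝓝 (L a r))) :
    m ≤ Module.finrank ℝ V ∧ ∀ j : Fin (Module.finrank ℝ V), ∃ x : ℝ,
      Tendsto (fun i => ∑ r, ⟪u i (Fin.castLE (h.dim_le i) j), b i r⟫ ^ 2) 𝒰 (𝓝 x) ∧
      (x ≠ 0 ↔ (j : ℕ) < m) := by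
  obtain ⟨ℓ, ξ, -, hpos, hanti, hw, horth, hnorm, hsum⟩ := h.spectral_limit
  obtain ⟨h1, h2⟩ := nonzero_iff hpos hanti horth hnorm hsum hinj
  refine ⟨h1, fun j => ⟨‖ξ j‖ ^ 2, ?_, ?_⟩⟩
  · rw [EuclideanSpace.norm_sq_eq]
    refine tendsto_finsetSum _ fun r _ => ?_
    have h3 := hw (fun i => b i r) (EuclideanSpace.single r 1) (fun a => by
      simpa [EuclideanSpace.inner_single_right] using hb a r) j
    have h4 : ⟪ξ j, EuclideanSpace.single r (1 : ℝ)⟫ = ξ j r := by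
      simp [EuclideanSpace.inner_single_right]
    rw [h4] at h3
    simpa using h3.pow 2
  · rw [← h2 j]
    simp

/-- Each `ξ j` is zero or an eigenvector of the limiting scatter `N` with eigenvalue `ℓ j - τ`, so
the weights `1 - a ℓ / (a (ℓ - τ) + s)` are functions of the pencil `a N + s`. Solving `(a N + s) e
= D` clears all denominators, and the weighted sum becomes `-a ⟪N e, W⟫ = s ⟪W, e⟫ - ⟪D, W⟫`. -/
theorem statistic_limit (h : ScatterLimit 𝒰 p V c L τ lam u)
    (hinj : ∀ v, (∀ a, ⟪L a, v⟫ = 0) → v = 0) (a s : ℝ)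
    (hN : ∀ v, a • combo L (coeffs L v) + s • v = 0 → v = 0) (wt : ι → ℝ → ℝ)
    (hwt : ∀ (f : ι → ℝ) (x : ℝ), Tendsto f 𝒰 (𝓝 x) → 0 < x → a * (x - τ) + s ≠ 0 →
      Tendsto (fun i => wt i (f i)) 𝒰 (𝓝 (1 - a * x / (a * (x - τ) + s))))
    (d w : (i : ι) → E (p i)) (D W e : E m) (t : ℝ)
    (hd : ∀ a, Tendsto (fun i => ⟪c i a, d i⟫) 𝒰 (𝓝 ⟪L a, D⟫))
    (hw : ∀ a, Tendsto (fun i => ⟪c i a, w i⟫) 𝒰 (𝓝 ⟪L a, W⟫))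
    (hdw : Tendsto (fun i => ⟪d i, w i⟫) 𝒰 (𝓝 t))
    (he : a • combo L (coeffs L e) + s • e = D) :
    Tendsto (fun i =>
      ∑ j ∈ Finset.univ.filter (fun j : Fin (p i) => (j : ℕ) < m),
        wt i (lam i j) * ⟪u i j, d i⟫ * ⟪u i j, w i⟫ +
      ∑ j ∈ Finset.univ.filter (fun j : Fin (p i) => Module.finrank ℝ V ≤ (j : ℕ)),
        ⟪u i j, d i⟫ * ⟪u i j, w i⟫) 𝒰 (𝓝 (t - ⟪D, W⟫ + s * ⟪W, e⟫)) := by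
  obtain ⟨ℓ, ξ, hlam, hpos, hanti, hlim, horth, hnorm, hsum⟩ := h.spectral_limit
  obtain ⟨hmr, hξ⟩ := nonzero_iff hpos hanti horth hnorm hsum hinj
  have hcc : ∀ y e, ⟪y, combo L (coeffs L e)⟫ = ∑ j, ℓ j * (⟪ξ j, y⟫ * ⟪ξ j, e⟫) := by
    intro y e
    rw [← hsum, combo, inner_sum]
    refine Finset.sum_congr rfl fun a _ => ?_
    rw [real_inner_smul_right, coeffs_apply, real_inner_comm (L a) y, mul_comm]
  have hξM : ∀ j e, ⟪ξ j, combo L (coeffs L e)⟫ = (ℓ j - τ) * ⟪ξ j, e⟫ := by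
    intro j e
    rw [hcc, Finset.sum_eq_single j]
    · rw [real_inner_self_eq_norm_sq, ← hnorm, mul_assoc]
    · intro k _ hkj
      rw [horth k j hkj]; ring
    · simp
  have hξD : ∀ j, ⟪ξ j, D⟫ = (a * (ℓ j - τ) + s) * ⟪ξ j, e⟫ := by
    intro j
    rw [← he, inner_add_right, real_inner_smul_right, real_inner_smul_right, hξM]; ring
  -- A vanishing denominator would put the nonzero vector `ξ j` into the kernel of the pencil.
  have hne : ∀ j, (j : Fin (Module.finrank ℝ V)).1 < m → a * (ℓ j - τ) + s ≠ 0 := by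
    intro j hj h0
    apply (hξ j).2 hj
    apply hN
    refine ext_inner_left ℝ fun y => ?_
    have h1 : ⟪y, combo L (coeffs L (ξ j))⟫ = ⟪ξ j, combo L (coeffs L y)⟫ := by
      rw [hcc, hcc]; exact Finset.sum_congr rfl fun k _ => by ring
    rw [inner_add_right, real_inner_smul_right, real_inner_smul_right, inner_zero_right,
      h1, hξM, real_inner_comm (ξ j) y]
    linear_combination h0 * ⟪ξ j, y⟫
  -- The eigenvectors beyond the rank are too many for a termwise limit. Parseval replaces their sum
  -- by `⟪d, w⟫` minus the sum over the first `finrank V`; the indices from `m` up to the rank get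
  -- weight `0`.
  have hrepr : ∀ i, ∑ j ∈ Finset.univ.filter (fun j : Fin (p i) => (j : ℕ) < m),
        wt i (lam i j) * ⟪u i j, d i⟫ * ⟪u i j, w i⟫ +
      ∑ j ∈ Finset.univ.filter (fun j : Fin (p i) => Module.finrank ℝ V ≤ (j : ℕ)),
        ⟪u i j, d i⟫ * ⟪u i j, w i⟫ =
      ⟪d i, w i⟫ + ∑ j : Fin (Module.finrank ℝ V),
        ((if (j : ℕ) < m then wt i (lam i (Fin.castLE (h.dim_le i) j)) else 0) - 1) *
          (⟪u i (Fin.castLE (h.dim_le i) j), d i⟫ *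
          ⟪u i (Fin.castLE (h.dim_le i) j), w i⟫) := by
    intro i
    have h1 := (u i).sum_inner_mul_inner (d i) (w i)
    simp only [fun j => real_inner_comm (u i j) (d i)] at h1
    rw [sum_fin_eq_sum_castLE_add (h.dim_le i)] at h1
    rw [Finset.sum_filter, sum_fin_eq_sum_castLE_add (h.dim_le i), ← h1]
    have h2 : ∑ j ∈ Finset.univ.filter (fun j : Fin (p i) => Module.finrank ℝ V ≤ (j : ℕ)),
        (if (j : ℕ) < m then wt i (lam i j) * ⟪u i j, d i⟫ * ⟪u i j, w i⟫ else 0) = 0 := by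
      refine Finset.sum_eq_zero fun j hj => ?_
      rw [if_neg]
      have := (Finset.mem_filter.1 hj).2
      omega
    rw [h2]
    simp only [sub_mul, one_mul, Finset.sum_sub_distrib, Fin.val_castLE, ite_mul, zero_mul]
    simp only [mul_assoc]
    ring
  simp only [hrepr]
  have hval : t - ⟪D, W⟫ + s * ⟪W, e⟫ = t + ∑ j : Fin (Module.finrank ℝ V),
      ((if (j : ℕ) < m then 1 - a * ℓ j / (a * (ℓ j - τ) + s) else 0) - 1) *
        (⟪ξ j, D⟫ * ⟪ξ j, W⟫) := by
    have h3 : ⟪D, W⟫ = a * ∑ j, ℓ j * (⟪ξ j, W⟫ * ⟪ξ j, e⟫) + s * ⟪W, e⟫ := by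
      rw [← hcc, ← he, inner_add_left, real_inner_smul_left, real_inner_smul_left,
        real_inner_comm W, real_inner_comm W]
    rw [h3, Finset.mul_sum]
    have h4 : ∀ j ∈ Finset.univ, ((if ((j : Fin (Module.finrank ℝ V)) : ℕ) < m then
        1 - a * ℓ j / (a * (ℓ j - τ) + s) else 0) - 1) *
        (⟪ξ j, D⟫ * ⟪ξ j, W⟫) = -(a * (ℓ j * (⟪ξ j, W⟫ * ⟪ξ j, e⟫))) := by
      intro j _
      by_cases hj : (j : ℕ) < m
      · rw [if_pos hj, hξD]
        have := hne j hj
        field_simp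
        ring
      -- The discarded noise directions contribute nothing in the limit, as they carry no component
      -- of `D` or `W`.
      · have h0 : ξ j = 0 := by
          by_contra h5; exact hj ((hξ j).1 h5)
        simp [h0]
    rw [Finset.sum_congr rfl h4, Finset.sum_neg_distrib]
    ring
  rw [hval]
  refine hdw.add (tendsto_finsetSum _ fun j _ => ?_)
  refine Tendsto.mul (Tendsto.sub ?_ tendsto_const_nhds) ((hlim d D hd j).mul (hlim w W hw j))
  split_ifs with hj
  · exact hwt _ _ (hlam j) (hpos j) (hne j hj)
  · exact tendsto_const_nhds

end ScatterLimit

/-! ### Centring by class and limits of inner products -/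

section Centering

variable {n : Fin 2 → ℕ} {H : Type*} [NormedAddCommGroup H] [InnerProductSpace ℝ H]

/-- The average of a two-class family over class `k`. -/
def classAvg (g : (Σ k, Fin (n k)) → H) (k : Fin 2) : H := (n k : ℝ)⁻¹ • ∑ j, g ⟨k, j⟩

/-- The deviations of a two-class family from its class averages. -/
def center (g : (Σ k, Fin (n k)) → H) (a : Σ k, Fin (n k)) : H := g a - classAvg g a.1

/-- The linear map taking class sums. -/
def classSum (n : Fin 2 → ℕ) : EuclideanSpace ℝ (Σ k, Fin (n k)) →ₗ[ℝ] (Fin 2 → ℝ) where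
  toFun x k := ∑ j, x ⟨k, j⟩
  map_add' x y := by ext k; simp [Finset.sum_add_distrib]
  map_smul' c x := by ext k; simp [Finset.mul_sum]

theorem finrank_ker_classSum (hn : ∀ k, 0 < n k) :
    Module.finrank ℝ (LinearMap.ker (classSum n)) = n 0 + n 1 - 2 := by
  have hsurj : Function.Surjective (classSum n) := by
    intro y
    refine ⟨WithLp.toLp 2 fun a => (n a.1 : ℝ)⁻¹ * y a.1, ?_⟩
    ext k
    have : (n k : ℝ) ≠ 0 := by exact_mod_cast (hn k).ne'
    simp [classSum, this]
  have h := LinearMap.finrank_range_add_finrank_ker (classSum n)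
  rw [LinearMap.range_eq_top.2 hsurj] at h
  simp [Fintype.card_sigma] at h
  omega

theorem sum_center (hn : ∀ k, 0 < n k) (g : (Σ k, Fin (n k)) → H) (k : Fin 2) :
    ∑ j, center g ⟨k, j⟩ = 0 := by
  have : (n k : ℝ) ≠ 0 := by exact_mod_cast (hn k).ne'
  change ∑ j, (g ⟨k, j⟩ - classAvg g k) = 0
  rw [Finset.sum_sub_distrib, Finset.sum_const, Finset.card_univ, Fintype.card_fin, classAvg,
    ← Nat.cast_smul_eq_nsmul ℝ, smul_smul, mul_inv_cancel₀ this, one_smul, sub_self]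

theorem coeffs_center_mem (hn : ∀ k, 0 < n k) (g : (Σ k, Fin (n k)) → H) (v : H) :
    coeffs (center g) v ∈ LinearMap.ker (classSum n) := by
  rw [LinearMap.mem_ker]
  ext k
  change ∑ j, ⟪center g ⟨k, j⟩, v⟫ = 0
  rw [← sum_inner, sum_center hn, inner_zero_left]

/-- Coefficients with zero class sums do not see a shift of a whole class, so the Gram form of the
centred family needs no separate computation on this space. -/
theorem combo_center (g : (Σ k, Fin (n k)) → H) (x : EuclideanSpace ℝ (Σ k, Fin (n k)))
    (hx : x ∈ LinearMap.ker (classSum n)) : combo (center g) x = combo g x := by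
  have h0 : ∀ k, ∑ j, x ⟨k, j⟩ = 0 := fun k => congrFun (LinearMap.mem_ker.1 hx) k
  simp only [combo, center, smul_sub, Finset.sum_sub_distrib]
  rw [sub_eq_self, Fintype.sum_sigma]
  refine Finset.sum_eq_zero fun k _ => ?_
  change ∑ j, x ⟨k, j⟩ • classAvg g k = 0
  rw [← Finset.sum_smul, h0, zero_smul]

theorem inner_classAvg (g : (Σ k, Fin (n k)) → H) (k : Fin 2) (v : H) :
    ⟪classAvg g k, v⟫ = (n k : ℝ)⁻¹ * ∑ j, ⟪g ⟨k, j⟩, v⟫ := by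
  rw [classAvg, real_inner_smul_left, sum_inner]

end Centering

section Limits

variable {ι : Type*} {l : Filter ι} {p : ι → ℕ} {m : ℕ} {n : Fin 2 → ℕ}

theorem tendsto_inner_classAvg {g : (i : ι) → (Σ k, Fin (n k)) → E (p i)}
    {w : (i : ι) → E (p i)} {L : (Σ k, Fin (n k)) → E m} {W : E m} {ρ : ℝ} (k : Fin 2)
    (hn : 0 < n k) (h : ∀ j, Tendsto (fun i => ⟪g i ⟨k, j⟩, w i⟫) l (𝓝 (⟪L ⟨k, j⟩, W⟫ + ρ))) :
    Tendsto (fun i => ⟪classAvg (g i) k, w i⟫) l (𝓝 (⟪classAvg L k, W⟫ + ρ)) := by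
  have hn' : (n k : ℝ) ≠ 0 := by exact_mod_cast hn.ne'
  have h1 := (tendsto_finsetSum Finset.univ fun j _ => h j).const_mul (n k : ℝ)⁻¹
  simp only [inner_classAvg]
  convert h1 using 2
  rw [Finset.sum_add_distrib, mul_add]
  simp [hn']

/-- The excess `ρ` depends only on the class of the observation, so it cancels on subtracting the
class average. This removes the `τ / n_k` terms that come from correlation with the averages. -/
theorem tendsto_inner_center {g : (i : ι) → (Σ k, Fin (n k)) → E (p i)}
    {w : (i : ι) → E (p i)} {L : (Σ k, Fin (n k)) → E m} {W : E m} (ρ : Fin 2 → ℝ)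
    (hn : ∀ k, 0 < n k)
    (h : ∀ a, Tendsto (fun i => ⟪g i a, w i⟫) l (𝓝 (⟪L a, W⟫ + ρ a.1))) (a) :
    Tendsto (fun i => ⟪center (g i) a, w i⟫) l (𝓝 ⟪center L a, W⟫) := by
  have h1 := tendsto_inner_classAvg (ρ := ρ a.1) a.1 (hn a.1) fun j => h ⟨a.1, j⟩
  have h2 := (h a).sub h1
  simp only [center, inner_sub_left]
  convert h2 using 2
  ring

/-- Convergence of the inner products of two-class training vectors `g`, a test vector `gs` and
a mean vector `mu`, all scaled, to those of finite-dimensional vectors, with an excess `τ` for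
the training vectors and `κ` for the mean vector. -/
structure GramLimit (l : Filter ι) (p : ι → ℕ) (g : (i : ι) → (Σ k, Fin (n k)) → E (p i))
    (gs mu : (i : ι) → E (p i)) (b : (i : ι) → Fin m → E (p i))
    (L : (Σ k, Fin (n k)) → E m) (Ls Mu : E m) (τ κ : ℝ) : Prop where
  train : ∀ a a', Tendsto (fun i => ⟪g i a, g i a'⟫) l
    (𝓝 (⟪L a, L a'⟫ + if a = a' then τ else 0))
  train_test : ∀ a, Tendsto (fun i => ⟪g i a, gs i⟫) l (𝓝 ⟪L a, Ls⟫)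
  train_mean : ∀ a, Tendsto (fun i => ⟪g i a, mu i⟫) l (𝓝 ⟪L a, Mu⟫)
  test_mean : Tendsto (fun i => ⟪gs i, mu i⟫) l (𝓝 ⟪Ls, Mu⟫)
  mean_mean : Tendsto (fun i => ⟪mu i, mu i⟫) l (𝓝 (⟪Mu, Mu⟫ + κ))
  train_basis : ∀ a r, Tendsto (fun i => ⟪g i a, b i r⟫) l (𝓝 (L a r))

namespace GramLimit

variable {g : (i : ι) → (Σ k, Fin (n k)) → E (p i)}
    {gs mu : (i : ι) → E (p i)} {b : (i : ι) → Fin m → E (p i)}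
    {L : (Σ k, Fin (n k)) → E m} {Ls Mu : E m} {τ κ : ℝ}

/-- Only the term with the observation itself meets the diagonal excess, hence `τ / n_k` and only
for the average of its own class. -/
theorem train_avg (h : GramLimit l p g gs mu b L Ls Mu τ κ) (a) (k) :
    Tendsto (fun i => ⟪g i a, classAvg (g i) k⟫) l
      (𝓝 (⟪L a, classAvg L k⟫ + if a.1 = k then (n k : ℝ)⁻¹ * τ else 0)) := by
  simp only [real_inner_comm (classAvg _ k), inner_classAvg]
  have h1 := (tendsto_finsetSum Finset.univ fun j _ => h.train ⟨k, j⟩ a).const_mul (n k : ℝ)⁻¹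
  convert h1 using 2
  rw [Finset.sum_add_distrib, mul_add]
  congr 1
  obtain ⟨k', j'⟩ := a
  by_cases hk : k' = k
  · subst hk; simp
  · have : ∀ j, (⟨k, j⟩ : Σ k, Fin (n k)) ≠ ⟨k', j'⟩ := fun j hj => hk (congrArg Sigma.fst hj).symm
    simp [hk, this]

theorem avg_avg (h : GramLimit l p g gs mu b L Ls Mu τ κ) (hn : ∀ k, 0 < n k) (k k') :
    Tendsto (fun i => ⟪classAvg (g i) k, classAvg (g i) k'⟫) l
      (𝓝 (⟪classAvg L k, classAvg L k'⟫ + if k = k' then (n k' : ℝ)⁻¹ * τ else 0)) :=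
  tendsto_inner_classAvg (w := fun i => classAvg (g i) k') k (hn k)
    fun j => h.train_avg ⟨k, j⟩ k'

theorem avg_test (h : GramLimit l p g gs mu b L Ls Mu τ κ) (hn : ∀ k, 0 < n k) (k) :
    Tendsto (fun i => ⟪classAvg (g i) k, gs i⟫) l (𝓝 ⟪classAvg L k, Ls⟫) := by
  simpa using tendsto_inner_classAvg (ρ := 0) k (hn k)
    fun j => by simpa using h.train_test ⟨k, j⟩

theorem avg_mean (h : GramLimit l p g gs mu b L Ls Mu τ κ) (hn : ∀ k, 0 < n k) (k) :
    Tendsto (fun i => ⟪classAvg (g i) k, mu i⟫) l (𝓝 ⟪classAvg L k, Mu⟫) := by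
  simpa using tendsto_inner_classAvg (ρ := 0) k (hn k)
    fun j => by simpa using h.train_mean ⟨k, j⟩

theorem combo_combo (h : GramLimit l p g gs mu b L Ls Mu τ κ)
    (x y : EuclideanSpace ℝ (Σ k, Fin (n k))) :
    Tendsto (fun i => ⟪combo (g i) x, combo (g i) y⟫) l
      (𝓝 (⟪combo L x, combo L y⟫ + τ * ⟪x, y⟫)) := by
  have h1 : ∀ {H : Type} [NormedAddCommGroup H] [InnerProductSpace ℝ H]
      (c : (Σ k, Fin (n k)) → H),
      ⟪combo c x, combo c y⟫ = ∑ a, ∑ a', x a * (y a' * ⟪c a, c a'⟫) := by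
    intro H _ _ c
    simp only [combo, sum_inner, inner_sum, real_inner_smul_left, real_inner_smul_right]
    rw [Finset.sum_comm]
    exact Finset.sum_congr rfl fun _ _ => Finset.sum_congr rfl fun _ _ => by ring
  simp only [h1]
  convert tendsto_finsetSum Finset.univ fun a _ => tendsto_finsetSum Finset.univ fun a' _ =>
    ((h.train a a').const_mul (y a')).const_mul (x a) using 2
  simp only [mul_add, Finset.sum_add_distrib, mul_ite, mul_zero, Finset.sum_ite_eq,
    Finset.mem_univ, if_true, PiLp.inner_apply]
  congr 1
  rw [Finset.mul_sum]
  exact Finset.sum_congr rfl fun a _ => by simp; ring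

theorem center_diff (h : GramLimit l p g gs mu b L Ls Mu τ κ) (hn : ∀ k, 0 < n k) (a) :
    Tendsto (fun i => ⟪center (g i) a, mu i + (classAvg (g i) 0 - classAvg (g i) 1)⟫) l
      (𝓝 ⟪center L a, Mu + (classAvg L 0 - classAvg L 1)⟫) := by
  refine tendsto_inner_center (w := fun i => mu i + (classAvg (g i) 0 - classAvg (g i) 1))
    (fun k => (if k = 0 then (n 0 : ℝ)⁻¹ * τ else 0) - if k = 1 then (n 1 : ℝ)⁻¹ * τ else 0)
    hn (fun a => ?_) a
  simp only [inner_add_right, inner_sub_right]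
  convert (h.train_mean a).add ((h.train_avg a 0).sub (h.train_avg a 1)) using 2
  ring

theorem center_test (h : GramLimit l p g gs mu b L Ls Mu τ κ) (hn : ∀ k, 0 < n k)
    (t ω₀ ω₁ : ℝ) (a) :
    Tendsto (fun i => ⟪center (g i) a,
      gs i + t • mu i - (ω₀ • classAvg (g i) 0 + ω₁ • classAvg (g i) 1)⟫) l
      (𝓝 ⟪center L a, Ls + t • Mu - (ω₀ • classAvg L 0 + ω₁ • classAvg L 1)⟫) := by
  refine tendsto_inner_center
    (w := fun i => gs i + t • mu i - (ω₀ • classAvg (g i) 0 + ω₁ • classAvg (g i) 1))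
    (fun k => -(ω₀ * (if k = 0 then (n 0 : ℝ)⁻¹ * τ else 0) +
      ω₁ * if k = 1 then (n 1 : ℝ)⁻¹ * τ else 0)) hn (fun a => ?_) a
  simp only [inner_add_right, inner_sub_right, real_inner_smul_right]
  convert ((h.train_test a).add ((h.train_mean a).const_mul t)).sub
    (((h.train_avg a 0).const_mul ω₀).add ((h.train_avg a 1).const_mul ω₁)) using 2
  ring

theorem center_basis (h : GramLimit l p g gs mu b L Ls Mu τ κ) (hn : ∀ k, 0 < n k) (a r) :
    Tendsto (fun i => ⟪center (g i) a, b i r⟫) l (𝓝 (center L a r)) := by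
  have h1 : ∀ v : E m, ⟪v, EuclideanSpace.single r (1 : ℝ)⟫ = v r := fun v => by
    simp [EuclideanSpace.inner_single_right]
  rw [← h1]
  refine tendsto_inner_center (w := fun i => b i r) (fun _ => 0) hn (fun a => ?_) a
  rw [h1]
  simpa using h.train_basis a r

theorem diff_test (h : GramLimit l p g gs mu b L Ls Mu τ κ) (hn : ∀ k, 0 < n k)
    (t ω₀ ω₁ : ℝ) (hω : ω₀ * (n 0 : ℝ)⁻¹ = ω₁ * (n 1 : ℝ)⁻¹) :
    Tendsto (fun i => ⟪mu i + (classAvg (g i) 0 - classAvg (g i) 1),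
      gs i + t • mu i - (ω₀ • classAvg (g i) 0 + ω₁ • classAvg (g i) 1)⟫) l
      (𝓝 (⟪Mu + (classAvg L 0 - classAvg L 1),
        Ls + t • Mu - (ω₀ • classAvg L 0 + ω₁ • classAvg L 1)⟫ + t * κ)) := by
  have hexp : ∀ {H : Type} [NormedAddCommGroup H] [InnerProductSpace ℝ H] (mu gs a₀ a₁ : H),
      ⟪mu + (a₀ - a₁), gs + t • mu - (ω₀ • a₀ + ω₁ • a₁)⟫ =
        ⟪gs, mu⟫ + t * ⟪mu, mu⟫ - (ω₀ * ⟪a₀, mu⟫ + ω₁ * ⟪a₁, mu⟫) +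
        ((⟪a₀, gs⟫ + t * ⟪a₀, mu⟫ - (ω₀ * ⟪a₀, a₀⟫ + ω₁ * ⟪a₀, a₁⟫)) -
        (⟪a₁, gs⟫ + t * ⟪a₁, mu⟫ - (ω₀ * ⟪a₁, a₀⟫ + ω₁ * ⟪a₁, a₁⟫))) := by
    intro H _ _ mu gs a₀ a₁
    simp only [inner_add_left, inner_sub_left, inner_add_right, inner_sub_right,
      real_inner_smul_right]
    rw [real_inner_comm gs mu, real_inner_comm a₀ mu, real_inner_comm a₁ mu]
    ring
  simp only [hexp]
  convert ((h.test_mean.add (h.mean_mean.const_mul t)).sub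
    (((h.avg_mean hn 0).const_mul ω₀).add ((h.avg_mean hn 1).const_mul ω₁))).add
    ((((h.avg_test hn 0).add ((h.avg_mean hn 0).const_mul t)).sub
      (((h.avg_avg hn 0 0).const_mul ω₀).add ((h.avg_avg hn 0 1).const_mul ω₁))).sub
    (((h.avg_test hn 1).add ((h.avg_mean hn 1).const_mul t)).sub
      (((h.avg_avg hn 1 0).const_mul ω₀).add ((h.avg_avg hn 1 1).const_mul ω₁)))) using 2
  simp only [if_true, one_ne_zero, zero_ne_one, if_false]
  -- The excesses of the two squared class averages enter with opposite signs; for the weights `n_k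
  -- / n` of the total mean they cancel even if the class sizes differ.
  linear_combination τ * hω

theorem bounded (h : GramLimit l p g gs mu b L Ls Mu τ κ) (hn : ∀ k, 0 < n k) :
    ∃ C, ∀ᶠ i in l, ∀ a, ‖center (g i) a‖ ≤ C := by
  have h1 : ∀ a, ∃ C, ∀ᶠ i in l, ‖center (g i) a‖ ≤ C := by
    intro a
    obtain ⟨x, hx⟩ : ∃ x, Tendsto (fun i => ⟪center (g i) a, center (g i) a⟫) l (𝓝 x) := by
      refine ⟨_, (((h.train a a).sub (h.train_avg a a.1)).sub ((h.train_avg a a.1).sub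
        (h.avg_avg hn a.1 a.1))).congr fun i => ?_⟩
      simp only [center, inner_sub_left, inner_sub_right]
      rw [real_inner_comm (g i a) (classAvg (g i) a.1)]
    refine ⟨Real.sqrt (x + 1), ?_⟩
    filter_upwards [hx.eventually_le_const (lt_add_one _)] with i hi
    rw [real_inner_self_eq_norm_sq] at hi
    exact Real.le_sqrt_of_sq_le hi
  choose C hC using h1
  refine ⟨∑ a, |C a|, ?_⟩
  filter_upwards [eventually_all.2 hC] with i hi a
  exact (hi a).trans ((le_abs_self _).trans
    (Finset.single_le_sum (f := fun a => |C a|) (fun _ _ => abs_nonneg _) (Finset.mem_univ a)))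

theorem scatterLimit {𝒰 : Ultrafilter ι} (h : GramLimit 𝒰 p g gs mu b L Ls Mu τ κ)
    (hn : ∀ k, 0 < n k) (hτ : 0 < τ) (hp : ∀ i, n 0 + n 1 - 2 ≤ p i)
    {lam : (i : ι) → Fin (p i) → ℝ} {u : (i : ι) → OrthonormalBasis (Fin (p i)) ℝ (E (p i))}
    (heig : ∀ i j, combo (center (g i)) (coeffs (center (g i)) (u i j)) = lam i j • u i j)
    (hanti : ∀ i, Antitone (lam i)) :
    ScatterLimit 𝒰 p (LinearMap.ker (classSum n)) (fun i => center (g i)) (center L) τ lam u where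
  pos := hτ
  dim_le i := by rw [finrank_ker_classSum hn]; exact hp i
  coeffs_mem i v := coeffs_center_mem hn _ v
  limit_mem v := coeffs_center_mem hn _ v
  gram x hx y hy := by
    simp only [combo_center _ _ hx, combo_center _ _ hy]
    exact h.combo_combo x y
  bounded := h.bounded hn
  eigen := heig
  anti := hanti

end GramLimit

end Limits

/-! ### Second moments of the noise -/

theorem variance_inner_eq {p : ℕ} (F : Measure (E p)) [IsProbabilityMeasure F]
    (hF : MemLp (fun x : E p => x) 2 F) (v : E p) :
    Var[fun x => ⟪v, x⟫; F] = ⟪v, Matrix.toEuclideanLin (covMatrix F) v⟫ := by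
  have hcoord : ∀ a, MemLp (fun x : E p => x a) 2 F := fun a =>
    (EuclideanSpace.proj (𝕜 := ℝ) a).comp_memLp' hF
  have h1 : (fun x : E p => ⟪v, x⟫) = fun x => ∑ a, v a * x a := by
    ext x; simp [PiLp.inner_apply, mul_comm]
  rw [← covariance_self (by fun_prop), h1,
    covariance_fun_sum_fun_sum (fun a => (hcoord a).const_mul _) fun a => (hcoord a).const_mul _]
  simp only [covariance_const_mul_left, covariance_const_mul_right, PiLp.inner_apply,
    Matrix.toLpLin_apply, Matrix.mulVec, dotProduct, covMatrix, Matrix.of_apply]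
  refine Finset.sum_congr rfl fun a _ => ?_
  simp only [RCLike.inner_apply, conj_trivial, Finset.sum_mul]
  exact Finset.sum_congr rfl fun b _ => by ring

theorem inner_toEuclideanLin_of_eigen {p : ℕ} {S : Matrix (Fin p) (Fin p) ℝ} {lam : Fin p → ℝ}
    {u : OrthonormalBasis (Fin p) ℝ (E p)} (h : IsEigendecomposition S lam u) (v : E p) :
    ⟪v, Matrix.toEuclideanLin S v⟫ = ∑ i, lam i * ⟪u i, v⟫ ^ 2 := by
  conv_lhs => rw [← u.sum_repr' v]
  rw [map_sum, u.sum_repr' v, inner_sum]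
  refine Finset.sum_congr rfl fun i _ => ?_
  rw [map_smul, h i, real_inner_smul_right, real_inner_smul_right, real_inner_comm]
  ring

namespace TwoClassModel

variable {M : TwoClassModel}

theorem measurable_scores (k : Fin 2) (p : ℕ) : Measurable (M.scores k p) := by
  unfold scores
  fun_prop

theorem eigval_pos (h2 : M.SpikedEigenvalues) (k : Fin 2) (p i : ℕ) : 0 < M.eigval k p i := by
  unfold eigval
  split_ifs with h
  · have h1 := mul_nonneg (h2.sigmaSq_pos k ⟨i, h⟩).le
      (Real.rpow_nonneg (Nat.cast_nonneg p) (M.beta k))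
    linarith [h2.tailSq_pos k i]
  · exact h2.tailSq_pos k i

theorem eigval_tail (k : Fin 2) (p : ℕ) {i : ℕ} (hi : M.spikes k ≤ i) :
    M.eigval k p i = M.tailSq k i := by
  rw [eigval, dif_neg (not_lt.2 hi)]

theorem integral_inner_sub_mean_sq (hM : M.Setting) (k : Fin 2) (p : ℕ) (v : E p) :
    Integrable (fun x => ⟪v, x - M.mean k p⟫ ^ 2) (M.law k p) ∧
    ∫ x, ⟪v, x - M.mean k p⟫ ^ 2 ∂(M.law k p) =
      ∑ i : Fin p, M.eigval k p i * ⟪M.eigvec k p i, v⟫ ^ 2 := by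
  have := hM.isProb k p
  have hF := hM.memLp k p
  have hin : MemLp (fun x : E p => ⟪v, x⟫) 2 (M.law k p) :=
    (innerSL ℝ v).comp_memLp' hF
  have hmean : ∫ x, ⟪v, x⟫ ∂(M.law k p) = ⟪v, M.mean k p⟫ :=
    integral_inner (hF.integrable one_le_two) v
  have hmem : MemLp (fun x : E p => ⟪v, x - M.mean k p⟫) 2 (M.law k p) := by
    simp only [inner_sub_right]
    exact hin.sub (memLp_const _)
  refine ⟨hmem.integrable_sq, ?_⟩
  rw [← inner_toEuclideanLin_of_eigen (hM.eigen k p), ← variance_inner_eq _ hF,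
    variance_eq_integral (by fun_prop), hmean]
  simp only [inner_sub_right]

variable (M) in
/-- The component of a vector orthogonal to the leading eigenvectors of class `k`. -/
def tailProj (k : Fin 2) (p : ℕ) (v : E p) : E p :=
  ∑ i ∈ Finset.univ.filter (fun i : Fin p => M.spikes k ≤ (i : ℕ)),
    ⟪M.eigvec k p i, v⟫ • M.eigvec k p i

variable (M) in
/-- The component of the deviation of an observation from its mean that is orthogonal to the
leading eigenvectors of its class. -/
def noise (k : Fin 2) (p : ℕ) (x : E p) : E p := M.tailProj k p (x - M.mean k p)

theorem measurable_noise (k : Fin 2) (p : ℕ) : Measurable (M.noise k p) := by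
  unfold noise tailProj
  fun_prop

theorem inner_tailProj (k : Fin 2) (p : ℕ) (v w : E p) :
    ⟪M.tailProj k p v, w⟫ = ⟪M.tailProj k p w, v⟫ := by
  simp only [tailProj, sum_inner, real_inner_smul_left]
  exact Finset.sum_congr rfl fun i _ => mul_comm _ _

theorem inner_eigvec_tailProj (k : Fin 2) (p : ℕ) (v : E p) (i : Fin p) :
    ⟪M.eigvec k p i, M.tailProj k p v⟫ =
      if M.spikes k ≤ (i : ℕ) then ⟪M.eigvec k p i, v⟫ else 0 := by
  simp only [tailProj, inner_sum, real_inner_smul_right,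
    orthonormal_iff_ite.1 (M.eigvec k p).orthonormal, mul_ite, mul_one, mul_zero,
    Finset.sum_ite_eq, Finset.mem_filter, Finset.mem_univ, true_and]

/-- Moving the self-adjoint tail projection onto `w` turns the integral into a variance, a sum of
`λ_i ⟪u_i, w⟫²` over tail indices only; there the eigenvalues are bounded by `C`. -/
theorem lintegral_inner_noise_sq_le (hM : M.Setting) {C : ℝ} (hC0 : 0 ≤ C)
    (hC : ∀ k i, M.tailSq k i ≤ C) (k : Fin 2) (p : ℕ) (w : E p) :
    ∫⁻ x, ENNReal.ofReal (⟪M.noise k p x, w⟫ ^ 2) ∂(M.law k p) ≤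
      ENNReal.ofReal (C * ‖w‖ ^ 2) := by
  obtain ⟨h1, h2⟩ := integral_inner_sub_mean_sq hM k p (M.tailProj k p w)
  simp only [noise, inner_tailProj k p _ w]
  rw [← ofReal_integral_eq_lintegral_ofReal h1 (Eventually.of_forall fun x => sq_nonneg _), h2]
  apply ENNReal.ofReal_le_ofReal
  rw [← (M.eigvec k p).sum_sq_inner_right w, Finset.mul_sum]
  refine Finset.sum_le_sum fun i _ => ?_
  rw [inner_eigvec_tailProj]
  split_ifs with hi
  · rw [eigval_tail k p hi]
    exact mul_le_mul_of_nonneg_right (hC k i) (sq_nonneg _)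
  · simp only [ne_eq, OfNat.ofNat_ne_zero, not_false_eq_true, zero_pow, mul_zero]
    positivity

theorem lintegral_norm_noise_sq_le (hM : M.Setting) {C : ℝ} (hC0 : 0 ≤ C)
    (hC : ∀ k i, M.tailSq k i ≤ C) (k : Fin 2) (p : ℕ) :
    ∫⁻ x, ENNReal.ofReal (‖M.noise k p x‖ ^ 2) ∂(M.law k p) ≤ ENNReal.ofReal (C * p) := by
  have h1 : ∀ x, ENNReal.ofReal (‖M.noise k p x‖ ^ 2) =
      ∑ i, ENNReal.ofReal (⟪M.noise k p x, M.eigvec k p i⟫ ^ 2) := by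
    intro x
    rw [← ENNReal.ofReal_sum_of_nonneg fun i _ => sq_nonneg _,
      (M.eigvec k p).sum_sq_inner_left]
  simp only [h1]
  have hmeas := M.measurable_noise k p
  rw [lintegral_finsetSum _ fun i _ => by fun_prop]
  calc _ ≤ ∑ i : Fin p, ENNReal.ofReal (C * ‖M.eigvec k p i‖ ^ 2) :=
        Finset.sum_le_sum fun i _ => lintegral_inner_noise_sq_le hM hC0 hC k p _
    _ = ENNReal.ofReal (C * p) := by
        simp only [(M.eigvec k p).orthonormal.1, one_pow, mul_one, Finset.sum_const,
          Finset.card_univ, Fintype.card_fin, nsmul_eq_mul]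
        rw [mul_comm, ENNReal.ofReal_mul hC0, ENNReal.ofReal_natCast]

/-- Freeze one vector and use the directional bound, then integrate its squared length. The result
is of order `p`, so after division by `p` the inner product is negligible. -/
theorem lintegral_inner_noise_noise_sq_le (hM : M.Setting) {C : ℝ} (hC0 : 0 ≤ C)
    (hC : ∀ k i, M.tailSq k i ≤ C) (k k' : Fin 2) (p : ℕ) :
    ∫⁻ q, ENNReal.ofReal (⟪M.noise k p q.1, M.noise k' p q.2⟫ ^ 2)
      ∂((M.law k p).prod (M.law k' p)) ≤ ENNReal.ofReal (C * (C * p)) := by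
  have := hM.isProb k p
  have := hM.isProb k' p
  have hmeas := M.measurable_noise k p
  have hmeas' := M.measurable_noise k' p
  have hin : Measurable fun q : E p × E p =>
      ENNReal.ofReal (⟪M.noise k p q.1, M.noise k' p q.2⟫ ^ 2) :=
    (((hmeas.comp measurable_fst).inner (hmeas'.comp measurable_snd)).pow_const 2).ennreal_ofReal
  have hnorm : Measurable fun y => ENNReal.ofReal (‖M.noise k' p y‖ ^ 2) :=
    (hmeas'.norm.pow_const 2).ennreal_ofReal
  rw [lintegral_prod_symm' _ hin]
  have hstep : ∀ y, ∫⁻ x, ENNReal.ofReal (⟪M.noise k p x, M.noise k' p y⟫ ^ 2) ∂(M.law k p) ≤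
      ENNReal.ofReal C * ENNReal.ofReal (‖M.noise k' p y‖ ^ 2) := fun y => by
    rw [← ENNReal.ofReal_mul hC0]
    exact lintegral_inner_noise_sq_le hM hC0 hC k p (M.noise k' p y)
  calc _ ≤ ∫⁻ y, ENNReal.ofReal C * ENNReal.ofReal (‖M.noise k' p y‖ ^ 2) ∂(M.law k' p) := by
        exact lintegral_mono hstep
    _ = ENNReal.ofReal C * ∫⁻ y, ENNReal.ofReal (‖M.noise k' p y‖ ^ 2) ∂(M.law k' p) :=
        lintegral_const_mul _ hnorm
    _ ≤ ENNReal.ofReal C * ENNReal.ofReal (C * p) := by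
        gcongr; exact lintegral_norm_noise_sq_le hM hC0 hC k' p
    _ = _ := (ENNReal.ofReal_mul hC0).symm

/-! ### The law of large numbers for the squared scores -/

/-- The variance along an eigenvector is its eigenvalue. Dimension `i + 1` is the smallest in which
score `i` is realized, and the sequence law does not depend on the dimension. -/
theorem integral_score_sq (hM : M.Setting) (h2 : M.SpikedEigenvalues) (h3 : M.MixingScores)
    (k : Fin 2) (i : ℕ) : ∫ z, z i ^ 2 ∂(M.scoreLaw k) = 1 := by
  have h1 := (integral_inner_sub_mean_sq hM k (i + 1) (M.eigvec k (i + 1) (Fin.last i))).2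
  have hlaw := h3.scores_law k (i + 1)
  have hm1 : Measurable (M.scores k (i + 1)) := measurable_scores k (i + 1)
  have hint1 := integral_map (μ := M.law k (i + 1)) hm1.aemeasurable
    (f := fun s : Fin (i + 1) → ℝ => s (Fin.last i) ^ 2)
    (by apply Measurable.aestronglyMeasurable; fun_prop)
  have hm2 : Measurable fun (z : ℕ → ℝ) (j : Fin (i + 1)) => z j := by fun_prop
  have hint2 := integral_map (μ := M.scoreLaw k) hm2.aemeasurable
    (f := fun s : Fin (i + 1) → ℝ => s (Fin.last i) ^ 2)
    (by apply Measurable.aestronglyMeasurable; fun_prop)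
  rw [hlaw, hint2] at hint1
  simp only [Fin.val_last] at hint1
  rw [hint1]
  have hpos := eigval_pos h2 k (i + 1) i
  simp only [scores, div_pow, Fin.val_last, Real.sq_sqrt hpos.le]
  rw [integral_div, h1, div_eq_one_iff_eq hpos.ne', Finset.sum_eq_single (Fin.last i)]
  · simp
  · intro j _ hj
    rw [orthonormal_iff_ite.1 (M.eigvec k (i + 1)).orthonormal, if_neg hj]; simp
  · simp

theorem memLp_score_sq (h3 : M.MixingScores) :
    ∃ C : ℝ, 0 ≤ C ∧ ∀ k i, MemLp (fun z : ℕ → ℝ => z i ^ 2) 2 (M.scoreLaw k) ∧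
      Var[fun z : ℕ → ℝ => z i ^ 2; M.scoreLaw k] ≤ C := by
  obtain ⟨C, hC⟩ := h3.fourth
  refine ⟨|C|, abs_nonneg C, fun k i => ?_⟩
  have := h3.isProb k
  have hint : Integrable (fun z : ℕ → ℝ => (z i ^ 2) ^ 2) (M.scoreLaw k) := by
    refine ⟨by apply Measurable.aestronglyMeasurable; fun_prop, ?_⟩
    rw [hasFiniteIntegral_iff_ofReal (Eventually.of_forall fun z => by positivity)]
    simp only [← pow_mul]
    exact (hC k i).trans_lt ENNReal.ofReal_lt_top
  have hmem : MemLp (fun z : ℕ → ℝ => z i ^ 2) 2 (M.scoreLaw k) :=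
    (memLp_two_iff_integrable_sq (by apply Measurable.aestronglyMeasurable; fun_prop)).2 hint
  refine ⟨hmem, (variance_le_expectation_sq hmem.aestronglyMeasurable).trans ?_⟩
  have h1 := hC k i
  have h4 : ∀ z : ℕ → ℝ, z i ^ 4 = (z i ^ 2) ^ 2 := fun z => by ring
  simp only [h4] at h1
  rw [← ofReal_integral_eq_lintegral_ofReal hint (Eventually.of_forall fun z => by positivity)]
    at h1
  have h5 := ENNReal.ofReal_le_ofReal_iff'.1 h1
  rcases h5 with h5 | h5
  · exact h5.trans (le_abs_self C)
  · exact h5.trans (abs_nonneg C)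

end TwoClassModel

/-- Nonnegativity of the variances of `X + Y` and `X - Y`. -/
theorem abs_covariance_le_of_variance_le {Ω : Type*} [MeasurableSpace Ω] {P : Measure Ω}
    [IsProbabilityMeasure P] {X Y : Ω → ℝ} {C : ℝ} (hX : MemLp X 2 P) (hY : MemLp Y 2 P)
    (hXC : Var[X; P] ≤ C) (hYC : Var[Y; P] ≤ C) : |cov[X, Y; P]| ≤ C := by
  have h1 := variance_add hX hY
  have h2 := variance_sub hX hY
  have h3 := variance_nonneg (X + Y) P
  have h4 := variance_nonneg (X - Y) P
  rw [abs_le]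
  constructor <;> linarith

theorem covariance_eq_zero_of_variance_eq_zero {Ω : Type*} [MeasurableSpace Ω] {P : Measure Ω}
    [IsProbabilityMeasure P] {X Y : Ω → ℝ} (hX : MemLp X 2 P)
    (h0 : Var[X; P] = 0) : cov[X, Y; P] = 0 := by
  rw [covariance]
  refine integral_eq_zero_of_ae ?_
  filter_upwards [ae_eq_integral_of_variance_eq_zero hX h0] with ω hω
  simp [hω]

/-- The correlation quotient is `0` by convention when a variance vanishes, and then gives no
information; in that case the covariance itself is `0`. -/
theorem abs_covariance_le_of_maxCorr_le {Ω : Type*} {A B : MeasurableSpace Ω} [MeasurableSpace Ω]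
    {P : Measure Ω} [IsProbabilityMeasure P] {X Y : Ω → ℝ} {C ε : ℝ}
    (hε : 0 ≤ ε) (hX : MemLp X 2 P) (hY : MemLp Y 2 P)
    (hXA : Measurable[A] X) (hYB : Measurable[B] Y)
    (hXC : Var[X; P] ≤ C) (hYC : Var[Y; P] ≤ C) (h : maxCorr P A B ≤ ENNReal.ofReal ε) :
    |cov[X, Y; P]| ≤ ε * C := by
  have hC : 0 ≤ C := (variance_nonneg X P).trans hXC
  rcases eq_or_ne (Var[X; P]) 0 with h0 | h0
  · rw [covariance_eq_zero_of_variance_eq_zero hX h0, abs_zero]; positivity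
  rcases eq_or_ne (Var[Y; P]) 0 with h0' | h0'
  · rw [covariance_comm, covariance_eq_zero_of_variance_eq_zero hY h0', abs_zero]; positivity
  have hle : ENNReal.ofReal (|cov[X, Y; P]| / (Real.sqrt (Var[X; P]) * Real.sqrt (Var[Y; P])))
      ≤ ENNReal.ofReal ε := by
    refine le_trans ?_ h
    unfold maxCorr
    exact le_iSup_of_le X (le_iSup_of_le Y (le_iSup_of_le hXA (le_iSup_of_le hYB
      (le_iSup_of_le hX (le_iSup_of_le hY le_rfl)))))
  rw [ENNReal.ofReal_le_ofReal_iff hε] at hle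
  have hXp : 0 < Real.sqrt (Var[X; P]) :=
    Real.sqrt_pos.2 (lt_of_le_of_ne (variance_nonneg X P) h0.symm)
  have hYp : 0 < Real.sqrt (Var[Y; P]) :=
    Real.sqrt_pos.2 (lt_of_le_of_ne (variance_nonneg Y P) h0'.symm)
  rw [div_le_iff₀ (by positivity)] at hle
  refine hle.trans (mul_le_mul_of_nonneg_left ?_ hε)
  calc Real.sqrt (Var[X; P]) * Real.sqrt (Var[Y; P]) ≤ Real.sqrt C * Real.sqrt C := by gcongr
    _ = C := Real.mul_self_sqrt hC

namespace TwoClassModel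

variable {M : TwoClassModel}

theorem exists_far_covariance_le (h3 : M.MixingScores) (k : Fin 2) :
    ∃ (e : Equiv.Perm ℕ) (C : ℝ), 0 ≤ C ∧
      (∀ i, MemLp (fun z : ℕ → ℝ => z i ^ 2) 2 (M.scoreLaw k)) ∧
      (∀ i j, |cov[fun z => z i ^ 2, fun z => z j ^ 2; M.scoreLaw k]| ≤ C) ∧
      ∀ ε, 0 < ε → ∃ K : ℕ, ∀ i j, (e i + K ≤ e j ∨ e j + K ≤ e i) →
        |cov[fun z => z i ^ 2, fun z => z j ^ 2; M.scoreLaw k]| ≤ ε * C := by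
  have := h3.isProb k
  obtain ⟨C, hC0, hC⟩ := memLp_score_sq h3
  obtain ⟨e, he⟩ := h3.mixing k
  -- Mixing is in terms of the position of a score in the permuted sequence, and score `i` sits at
  -- position `e.symm i`.
  refine ⟨e.symm, C, hC0, fun i => (hC k i).1, fun i j =>
    abs_covariance_le_of_variance_le (hC k i).1 (hC k j).1 (hC k i).2 (hC k j).2, ?_⟩
  intro ε hε
  obtain ⟨K, hK⟩ := ENNReal.tendsto_atTop_zero.1 he (ENNReal.ofReal ε) (ENNReal.ofReal_pos.2 hε)
  have hmeas : ∀ (s : ℕ) (S : Set ℕ), s ∈ S →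
      Measurable[sigmaField (fun i (z : ℕ → ℝ) => z (e i)) S] fun z : ℕ → ℝ => z (e s) ^ 2 := by
    intro s S hs
    have h1 : Measurable[sigmaField (fun i (z : ℕ → ℝ) => z (e i)) S]
        fun z : ℕ → ℝ => z (e s) :=
      (comap_measurable (fun z : ℕ → ℝ => z (e s))).mono
        (le_iSup₂_of_le (f := fun i (_ : i ∈ S) =>
          MeasurableSpace.comap (fun z : ℕ → ℝ => z (e i)) inferInstance) s hs le_rfl) le_rfl
    exact h1.pow_const 2
  have key : ∀ s t, s + K ≤ t →
      |cov[fun z => z (e s) ^ 2, fun z => z (e t) ^ 2; M.scoreLaw k]| ≤ ε * C := by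
    intro s t hst
    refine abs_covariance_le_of_maxCorr_le hε.le (hC k (e s)).1 (hC k (e t)).1
      (hmeas s (Set.Iic s) (Set.mem_Iic.2 le_rfl)) (hmeas t (Set.Ici (s + (t - s))) (by
        simp only [Set.mem_Ici]; omega)) (hC k _).2 (hC k _).2 ?_
    exact (le_iSup (fun j => maxCorr (M.scoreLaw k) (sigmaField (fun i z => z (e i)) (Set.Iic j))
      (sigmaField (fun i z => z (e i)) (Set.Ici (j + (t - s))))) s).trans (hK _ (by omega))
  refine ⟨K, fun i j hij => ?_⟩
  rcases hij with hij | hij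
  · simpa using key _ _ hij
  · rw [covariance_comm]
    simpa using key _ _ hij

end TwoClassModel

/-- A permutation is injective, so it maps the indices in question into a window of at most `2 K`
integers. -/
theorem card_filter_near_le (e : Equiv.Perm ℕ) (T : Finset ℕ) (i K : ℕ) :
    (T.filter fun j => ¬(e i + K ≤ e j ∨ e j + K ≤ e i)).card ≤ 2 * K := by
  have h1 : (T.filter fun j => ¬(e i + K ≤ e j ∨ e j + K ≤ e i)).card ≤
      (Finset.Ico (e i + 1 - K) (e i + K)).card := by
    refine Finset.card_le_card_of_injOn e (fun j hj => ?_) e.injective.injOn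
    have := (Finset.mem_filter.1 hj).2
    rw [Finset.mem_coe, Finset.mem_Ico]
    omega
  rw [Nat.card_Ico] at h1
  omega

namespace TwoClassModel

variable {M : TwoClassModel}

variable (M) in
/-- The average of the squared scores of class `k`, weighted by the tail eigenvalues. -/
def tailMean (k : Fin 2) (p : ℕ) (z : ℕ → ℝ) : ℝ :=
  (p : ℝ)⁻¹ * ∑ i ∈ (Finset.range p).filter (fun i => M.spikes k ≤ i), M.tailSq k i * z i ^ 2

theorem memLp_tailMean (h3 : M.MixingScores) (k : Fin 2) (p : ℕ) :
    MemLp (M.tailMean k p) 2 (M.scoreLaw k) := by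
  obtain ⟨C, -, hC⟩ := memLp_score_sq h3
  exact (memLp_finsetSum _ fun i _ => (hC k i).1.const_mul _).const_mul _

theorem integral_tailMean_tendsto (hM : M.Setting) (h2 : M.SpikedEigenvalues)
    (h3 : M.MixingScores) (k : Fin 2) :
    Tendsto (fun p => ∫ z, M.tailMean k p z ∂(M.scoreLaw k)) atTop (𝓝 (M.tauSq k)) := by
  have := h3.isProb k
  obtain ⟨C, -, hC⟩ := memLp_score_sq h3
  have h1 : ∀ p, ∫ z, M.tailMean k p z ∂(M.scoreLaw k) =
      (p : ℝ)⁻¹ * ∑ i ∈ (Finset.range p).filter (fun i => M.spikes k ≤ i), M.tailSq k i := by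
    intro p
    simp only [tailMean]
    rw [integral_const_mul, integral_finsetSum _ fun i _ =>
      ((hC k i).1.integrable one_le_two).const_mul _]
    simp only [integral_const_mul, integral_score_sq hM h2 h3, mul_one]
  simp only [h1]
  have h4 : Tendsto (fun p : ℕ => (p : ℝ)⁻¹ * ∑ i ∈ Finset.range (M.spikes k), M.tailSq k i)
      atTop (𝓝 0) := by
    simpa using (tendsto_inv_atTop_nhds_zero_nat (𝕜 := ℝ)).mul_const
      (∑ i ∈ Finset.range (M.spikes k), M.tailSq k i)
  have h5 := (h2.tail_avg k).sub h4
  rw [sub_zero] at h5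
  refine h5.congr' ?_
  filter_upwards [eventually_ge_atTop (M.spikes k)] with p hp
  rw [div_eq_inv_mul, ← mul_sub]
  congr 1
  rw [← Finset.sum_filter_add_sum_filter_not (Finset.range p) (fun i => M.spikes k ≤ i),
    add_sub_assoc, add_eq_left, sub_eq_zero]
  refine Finset.sum_congr ?_ fun _ _ => rfl
  ext i
  simp only [Finset.mem_filter, Finset.mem_range]
  omega

/-- In each row of the covariance matrix at most `2 K` entries are near the diagonal in permuted
order and are bounded by `C`; the at most `p` others are at most `ε C`. The factor `D ^ 2` bounds
the products of tail eigenvalues. -/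
theorem variance_tailMean_le (h2 : M.SpikedEigenvalues) (h3 : M.MixingScores) (k : Fin 2) :
    ∃ B : ℝ, 0 ≤ B ∧ ∀ ε, 0 < ε → ∃ K : ℕ, ∀ p : ℕ, 0 < p →
      Var[M.tailMean k p; M.scoreLaw k] ≤ B * (2 * K * (p : ℝ)⁻¹ + ε) := by
  have := h3.isProb k
  obtain ⟨D, hD⟩ := h2.tailSq_bdd
  have hD0 : 0 < D := (h2.tailSq_pos k 0).trans_le (hD k 0)
  obtain ⟨e, C, hC0, hmem, hnear, hfar⟩ := exists_far_covariance_le h3 k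
  refine ⟨D ^ 2 * C, by positivity, fun ε hε => ?_⟩
  obtain ⟨K, hK⟩ := hfar ε hε
  refine ⟨K, fun p hp => ?_⟩
  have hp' : (0 : ℝ) < p := by exact_mod_cast hp
  set T := (Finset.range p).filter (fun i => M.spikes k ≤ i) with hT
  have hTcard : (T.card : ℝ) ≤ p := by
    exact_mod_cast (Finset.card_filter_le _ _).trans (by simp)
  have hrow : ∀ i, ∑ j ∈ T, |cov[fun z => z i ^ 2, fun z => z j ^ 2; M.scoreLaw k]| ≤
      2 * K * C + p * (ε * C) := by
    intro i
    rw [← Finset.sum_filter_add_sum_filter_not T fun j => ¬(e i + K ≤ e j ∨ e j + K ≤ e i)]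
    refine add_le_add ?_ ?_
    · refine (Finset.sum_le_card_nsmul _ _ C fun j _ => hnear i j).trans ?_
      rw [nsmul_eq_mul]
      refine mul_le_mul_of_nonneg_right ?_ hC0
      exact_mod_cast card_filter_near_le e T i K
    · refine (Finset.sum_le_card_nsmul _ _ (ε * C) fun j hj =>
        hK i j (not_not.1 (Finset.mem_filter.1 hj).2)).trans ?_
      rw [nsmul_eq_mul]
      refine mul_le_mul_of_nonneg_right ?_ (by positivity)
      refine le_trans ?_ hTcard
      exact_mod_cast Finset.card_filter_le _ _
  have hvar : Var[M.tailMean k p; M.scoreLaw k] = (p : ℝ)⁻¹ ^ 2 * ∑ i ∈ T, ∑ j ∈ T,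
      M.tailSq k i * (M.tailSq k j *
        cov[fun z => z i ^ 2, fun z => z j ^ 2; M.scoreLaw k]) := by
    unfold tailMean
    rw [variance_const_mul, variance_fun_sum' fun i _ => (hmem i).const_mul _]
    simp only [covariance_const_mul_left, covariance_const_mul_right]
    congr 1
    exact Finset.sum_congr rfl fun i _ => Finset.sum_congr rfl fun j _ => by ring
  rw [hvar]
  have hbound : ∑ i ∈ T, ∑ j ∈ T, M.tailSq k i * (M.tailSq k j *
        cov[fun z => z i ^ 2, fun z => z j ^ 2; M.scoreLaw k]) ≤
      p * (D ^ 2 * (2 * K * C + p * (ε * C))) := by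
    calc _ ≤ ∑ i ∈ T, ∑ j ∈ T, D ^ 2 *
          |cov[fun z => z i ^ 2, fun z => z j ^ 2; M.scoreLaw k]| := by
          refine Finset.sum_le_sum fun i _ => Finset.sum_le_sum fun j _ => ?_
          rw [← mul_assoc]
          have h1 := (h2.tailSq_pos k i).le
          have h2' := (h2.tailSq_pos k j).le
          calc _ ≤ (M.tailSq k i * M.tailSq k j) *
                |cov[fun z => z i ^ 2, fun z => z j ^ 2; M.scoreLaw k]| :=
                mul_le_mul_of_nonneg_left (le_abs_self _) (mul_nonneg h1 h2')
            _ ≤ _ := by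
                refine mul_le_mul_of_nonneg_right ?_ (abs_nonneg _)
                rw [sq]
                exact mul_le_mul (hD k i) (hD k j) h2' hD0.le
      _ ≤ ∑ i ∈ T, D ^ 2 * (2 * K * C + p * (ε * C)) := by
          refine Finset.sum_le_sum fun i _ => ?_
          rw [← Finset.mul_sum]
          exact mul_le_mul_of_nonneg_left (hrow i) (sq_nonneg _)
      _ = T.card * (D ^ 2 * (2 * K * C + p * (ε * C))) := by rw [Finset.sum_const, nsmul_eq_mul]
      _ ≤ _ := mul_le_mul_of_nonneg_right hTcard (by positivity)
  refine (mul_le_mul_of_nonneg_left hbound (sq_nonneg _)).trans (le_of_eq ?_)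
  field_simp

theorem variance_tailMean_tendsto (h2 : M.SpikedEigenvalues) (h3 : M.MixingScores)
    (k : Fin 2) : Tendsto (fun p => Var[M.tailMean k p; M.scoreLaw k]) atTop (𝓝 0) := by
  obtain ⟨B, hB, h⟩ := variance_tailMean_le h2 h3 k
  refine tendsto_order.2 ⟨fun a ha => Eventually.of_forall fun p =>
    ha.trans_le (variance_nonneg _ _), fun δ hδ => ?_⟩
  obtain ⟨K, hK⟩ := h (δ / (2 * (B + 1))) (by positivity)
  have h1 : Tendsto (fun p : ℕ => B * (2 * K * (p : ℝ)⁻¹ + δ / (2 * (B + 1)))) atTop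
      (𝓝 (B * (2 * K * 0 + δ / (2 * (B + 1))))) :=
    (((tendsto_inv_atTop_nhds_zero_nat (𝕜 := ℝ)).const_mul _).add_const _).const_mul _
  have h4 : B * (2 * K * 0 + δ / (2 * (B + 1))) < δ := by
    rw [mul_zero, zero_add, ← mul_div_assoc, div_lt_iff₀ (by positivity)]
    nlinarith
  filter_upwards [h1.eventually_lt_const h4, eventually_gt_atTop 0] with p hp hp0
  exact (hK p hp0).trans_lt hp

theorem tailMean_lln (hM : M.Setting) (h2 : M.SpikedEigenvalues) (h3 : M.MixingScores)
    (k : Fin 2) {η : ℝ} (hη : 0 < η) :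
    Tendsto (fun p => M.scoreLaw k {z | η ≤ |M.tailMean k p z - M.tauSq k|}) atTop (𝓝 0) := by
  have := h3.isProb k
  have h1 : Tendsto (fun p => ENNReal.ofReal (Var[M.tailMean k p; M.scoreLaw k] / (η / 2) ^ 2))
      atTop (𝓝 0) := by
    rw [← ENNReal.ofReal_zero]
    refine (ENNReal.continuous_ofReal.tendsto 0).comp ?_
    simpa using (variance_tailMean_tendsto h2 h3 k).div_const ((η / 2) ^ 2)
  refine tendsto_of_tendsto_of_tendsto_of_le_of_le' tendsto_const_nhds h1
    (Eventually.of_forall fun _ => zero_le) ?_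
  have h4 := (integral_tailMean_tendsto hM h2 h3 k)
  filter_upwards [Metric.tendsto_nhds.1 h4 (η / 2) (by positivity)] with p hp
  refine le_trans (measure_mono fun z hz => ?_)
    (meas_ge_le_variance_div_sq (memLp_tailMean h3 k p) (half_pos hη))
  rw [Real.dist_eq] at hp
  simp only [Set.mem_ofPred_eq] at hz ⊢
  have := abs_sub_le (M.tailMean k p z) (∫ z, M.tailMean k p z ∂(M.scoreLaw k)) (M.tauSq k)
  linarith

theorem norm_noise_sq (h2 : M.SpikedEigenvalues) (k : Fin 2) (p : ℕ) (x : E p) :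
    ‖M.noise k p x‖ ^ 2 = ∑ i ∈ Finset.univ.filter (fun i : Fin p => M.spikes k ≤ (i : ℕ)),
      M.tailSq k i * M.scores k p x i ^ 2 := by
  rw [← (M.eigvec k p).sum_sq_inner_right, Finset.sum_filter]
  refine Finset.sum_congr rfl fun i _ => ?_
  rw [noise, inner_eigvec_tailProj]
  split_ifs with hi
  · rw [scores, div_pow, Real.sq_sqrt (eigval_pos h2 k p i).le, eigval_tail k p hi,
      mul_div_cancel₀ _ (h2.tailSq_pos k i).ne']
  · simp

/-- The squared length of the noise is a function of the scores alone, so the event can be moved to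
the law of the infinite sequence, where the weighted averages of squared scores concentrate. -/
theorem noise_lln (hM : M.Setting) (h2 : M.SpikedEigenvalues) (h3 : M.MixingScores)
    (k : Fin 2) {η : ℝ} (hη : 0 < η) :
    Tendsto (fun p => M.law k p {x | η ≤ |⟪M.noise k p x, M.noise k p x⟫ / p - M.tauSq k|})
      atTop (𝓝 0) := by
  refine (tailMean_lln hM h2 h3 k hη).congr fun p => ?_
  let S : Set (Fin p → ℝ) := {s | η ≤ |(p : ℝ)⁻¹ *
    ∑ i ∈ Finset.univ.filter (fun i : Fin p => M.spikes k ≤ (i : ℕ)),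
      M.tailSq k i * s i ^ 2 - M.tauSq k|}
  have hS : MeasurableSet S := measurableSet_le measurable_const (by fun_prop)
  have h1 : M.law k p {x | η ≤ |⟪M.noise k p x, M.noise k p x⟫ / p - M.tauSq k|} =
      (M.law k p).map (M.scores k p) S := by
    rw [Measure.map_apply (measurable_scores k p) hS]
    congr 1
    ext x
    simp only [S, Set.mem_ofPred_eq, Set.mem_preimage, real_inner_self_eq_norm_sq,
      norm_noise_sq h2, div_eq_inv_mul]
  rw [h1, h3.scores_law, Measure.map_apply (by fun_prop) hS]
  congr 1
  ext z
  simp only [S, Set.mem_ofPred_eq, Set.mem_preimage, tailMean, Finset.sum_filter,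
    Finset.sum_range]

/-- Chebyshev's inequality for a quantity whose second moment is at most `C p`. -/
theorem tendsto_measure_of_lintegral_sq_le {Ω : ℕ → Type*} [∀ p, MeasurableSpace (Ω p)]
    (P : (p : ℕ) → Measure (Ω p)) (f : (p : ℕ) → Ω p → ℝ) (hf : ∀ p, Measurable (f p)) (C : ℝ)
    (hC : ∀ᶠ p : ℕ in atTop, ∫⁻ x, ENNReal.ofReal (f p x ^ 2) ∂(P p) ≤ ENNReal.ofReal (C * p))
    {η : ℝ} (hη : 0 < η) :
    Tendsto (fun p : ℕ => P p {x | η ≤ |f p x / p|}) atTop (𝓝 0) := by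
  have h1 : Tendsto (fun p : ℕ => ENNReal.ofReal (C / η ^ 2 * (p : ℝ)⁻¹)) atTop (𝓝 0) := by
    rw [← ENNReal.ofReal_zero]
    refine (ENNReal.continuous_ofReal.tendsto 0).comp ?_
    simpa using (tendsto_inv_atTop_nhds_zero_nat (𝕜 := ℝ)).const_mul (C / η ^ 2)
  refine tendsto_of_tendsto_of_tendsto_of_le_of_le' tendsto_const_nhds h1
    (Eventually.of_forall fun _ => zero_le) ?_
  filter_upwards [hC, eventually_gt_atTop 0] with p hp hp0
  have hp' : (0 : ℝ) < p := by exact_mod_cast hp0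
  have h2 : P p {x | η ≤ |f p x / p|} ≤
      P p {x | ENNReal.ofReal ((η * p) ^ 2) ≤ ENNReal.ofReal (f p x ^ 2)} := by
    refine measure_mono fun x hx => ?_
    simp only [Set.mem_ofPred_eq] at hx ⊢
    refine ENNReal.ofReal_le_ofReal ?_
    rw [abs_div, abs_of_pos hp', le_div_iff₀ hp'] at hx
    rw [← sq_abs (f p x)]
    gcongr
  refine h2.trans ((meas_ge_le_lintegral_div (((hf p).pow_const 2).ennreal_ofReal).aemeasurable
    (by positivity) ENNReal.ofReal_ne_top).trans ?_)
  refine (ENNReal.div_le_div_right hp _).trans ?_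
  rw [← ENNReal.ofReal_div_of_pos (by positivity)]
  refine ENNReal.ofReal_le_ofReal (le_of_eq ?_)
  field_simp

end TwoClassModel

/-! ### Noise of the whole sample -/

theorem tendsto_measure_sum_abs {S : Type*} [Fintype S] {Ω : ℕ → Type*}
    [∀ p, MeasurableSpace (Ω p)] (P : (p : ℕ) → Measure (Ω p)) (f : S → (p : ℕ) → Ω p → ℝ)
    (h : ∀ s η, 0 < η → Tendsto (fun p => P p {x | η ≤ |f s p x|}) atTop (𝓝 0))
    {η : ℝ} (hη : 0 < η) :
    Tendsto (fun p => P p {x | η ≤ ∑ s, |f s p x|}) atTop (𝓝 0) := by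
  set c : ℝ := η / (Fintype.card S + 1) with hc
  have hcpos : 0 < c := by positivity
  have h1 : Tendsto (fun p => ∑ s, P p {x | c ≤ |f s p x|}) atTop (𝓝 0) := by
    simpa using tendsto_finsetSum Finset.univ fun s _ => h s c hcpos
  refine tendsto_of_tendsto_of_tendsto_of_le_of_le tendsto_const_nhds h1
    (fun _ => zero_le) fun p => ?_
  refine le_trans (measure_mono fun x hx => ?_) (measure_iUnion_fintype_le _ _)
  simp only [Set.mem_iUnion, Set.mem_ofPred_eq] at hx ⊢
  by_contra hcon
  push Not at hcon
  have h2 : ∑ s, |f s p x| ≤ ∑ _s : S, c := Finset.sum_le_sum fun s _ => (hcon s).le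
  rw [Finset.sum_const, Finset.card_univ, nsmul_eq_mul] at h2
  have h3 : c * (Fintype.card S + 1) = η := by rw [hc]; field_simp
  nlinarith

theorem measurePreserving_eval_pair {ι : Type*} [Fintype ι] {X : ι → Type*}
    [∀ i, MeasurableSpace (X i)] (μ : (i : ι) → Measure (X i)) [∀ i, IsProbabilityMeasure (μ i)]
    {i j : ι} (hij : i ≠ j) :
    MeasurePreserving (fun x : (i : ι) → X i => (x i, x j)) (Measure.pi μ)
      ((μ i).prod (μ j)) := by
  refine ⟨by fun_prop, ?_⟩
  have h1 := (iIndepFun_pi (μ := μ) (X := fun i => (id : X i → X i))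
    fun i => aemeasurable_id).indepFun hij
  have h2 := (indepFun_iff_map_prod_eq_prod_map_map (measurable_pi_apply i).aemeasurable
    (measurable_pi_apply j).aemeasurable).1 h1
  exact h2.trans (by
    rw [(measurePreserving_eval μ i).map_eq, (measurePreserving_eval μ j).map_eq])

namespace TwoClassModel

variable (M : TwoClassModel)

/-- The index set of the training observations. -/
abbrev TrainIdx : Type := Σ k : Fin 2, Fin (M.size k)

/-- The class of an observation; `none` is the test observation, of class `k₀`. -/
def idxClass (k₀ : Fin 2) : Option M.TrainIdx → Fin 2
  | none => k₀
  | some a => a.1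

variable {M} in
/-- The observations of a training sample and a test observation. -/
def obs {p : ℕ} (q : M.Sample p × E p) : Option M.TrainIdx → E p
  | none => q.2
  | some a => q.1 a.1 a.2

/-- The joint law of the training sample and an independent observation of class `k₀`. -/
def pairLaw (k₀ : Fin 2) (p : ℕ) : Measure (M.Sample p × E p) :=
  (M.trainLaw p).prod (M.law k₀ p)

variable {M}

theorem isProbabilityMeasure_trainLaw (hM : M.Setting) (p : ℕ) :
    IsProbabilityMeasure (M.trainLaw p) := by
  have := hM.isProb
  unfold trainLaw
  infer_instance

theorem isProbabilityMeasure_pairLaw (hM : M.Setting) (k₀ : Fin 2) (p : ℕ) :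
    IsProbabilityMeasure (M.pairLaw k₀ p) := by
  have := hM.isProb k₀ p
  have := isProbabilityMeasure_trainLaw hM p
  unfold pairLaw
  infer_instance

theorem measurePreserving_train (hM : M.Setting) (p : ℕ) (a : M.TrainIdx) :
    MeasurePreserving (fun x : M.Sample p => x a.1 a.2) (M.trainLaw p) (M.law a.1 p) := by
  have := hM.isProb
  exact (measurePreserving_eval (fun _ : Fin (M.size a.1) => M.law a.1 p) a.2).comp
    (measurePreserving_eval (fun k => Measure.pi fun _ : Fin (M.size k) => M.law k p) a.1)

theorem measurePreserving_train_pair (hM : M.Setting) (p : ℕ) {a a' : M.TrainIdx}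
    (h : a ≠ a') :
    MeasurePreserving (fun x : M.Sample p => (x a.1 a.2, x a'.1 a'.2)) (M.trainLaw p)
      ((M.law a.1 p).prod (M.law a'.1 p)) := by
  have := hM.isProb
  obtain ⟨k, j⟩ := a
  obtain ⟨k', j'⟩ := a'
  by_cases hk : k = k'
  · subst hk
    have hj : j ≠ j' := fun hj => h (by rw [hj])
    exact (measurePreserving_eval_pair (fun _ : Fin (M.size k) => M.law k p) hj).comp
      (measurePreserving_eval (fun k => Measure.pi fun _ : Fin (M.size k) => M.law k p) k)
  · exact ((measurePreserving_eval (fun _ : Fin (M.size k) => M.law k p) j).prod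
      (measurePreserving_eval (fun _ : Fin (M.size k') => M.law k' p) j')).comp
      (measurePreserving_eval_pair
        (fun k => Measure.pi fun _ : Fin (M.size k) => M.law k p) hk)

theorem measurePreserving_obs (hM : M.Setting) (k₀ : Fin 2) (p : ℕ) (b : Option M.TrainIdx) :
    MeasurePreserving (fun q : M.Sample p × E p => obs q b) (M.pairLaw k₀ p)
      (M.law (M.idxClass k₀ b) p) := by
  have := hM.isProb k₀ p
  have := isProbabilityMeasure_trainLaw hM p
  cases b with
  | none => exact measurePreserving_snd
  | some a => exact (measurePreserving_train hM p a).comp measurePreserving_fst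

theorem measurePreserving_obs_pair (hM : M.Setting) (k₀ : Fin 2) (p : ℕ)
    {b b' : Option M.TrainIdx} (h : b ≠ b') :
    MeasurePreserving (fun q : M.Sample p × E p => (obs q b, obs q b')) (M.pairLaw k₀ p)
      ((M.law (M.idxClass k₀ b) p).prod (M.law (M.idxClass k₀ b') p)) := by
  have := hM.isProb
  have := isProbabilityMeasure_trainLaw hM p
  cases b with
  | none =>
    cases b' with
    | none => exact absurd rfl h
    | some a =>
      exact Measure.measurePreserving_swap.comp
        ((measurePreserving_train hM p a).prod (MeasurePreserving.id (M.law k₀ p)))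
  | some a =>
    cases b' with
    | none => exact (measurePreserving_train hM p a).prod (MeasurePreserving.id (M.law k₀ p))
    | some a' =>
      exact (measurePreserving_train_pair hM p fun h' => h (by rw [h'])).comp
        measurePreserving_fst

variable (M) in
/-- The noise of the observations of a training sample and a test observation. -/
def obsNoise (k₀ : Fin 2) (p : ℕ) (q : M.Sample p × E p) (b : Option M.TrainIdx) : E p :=
  M.noise (M.idxClass k₀ b) p (obs q b)

theorem measurable_obsNoise (k₀ : Fin 2) (p : ℕ) (b : Option M.TrainIdx) :
    Measurable fun q : M.Sample p × E p => M.obsNoise k₀ p q b := by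
  refine (measurable_noise _ p).comp ?_
  cases b with
  | none => exact measurable_snd
  | some a => exact (measurable_pi_apply a.2).comp ((measurable_pi_apply a.1).comp measurable_fst)

variable (M) in
/-- The deviations of the scaled inner products of the noise vectors with each other, with a
family of unit vectors and with the mean difference from their limits. -/
def devTerm (k₀ : Fin 2) (τ : ℝ) {m : ℕ} (ub : (p : ℕ) → Fin m → E p) :
    (Option M.TrainIdx × Option M.TrainIdx) ⊕ (Option M.TrainIdx × Fin m) ⊕ Option M.TrainIdx →
      (p : ℕ) → M.Sample p × E p → ℝ
  | .inl (b, b'), p, q =>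
    ⟪M.obsNoise k₀ p q b, M.obsNoise k₀ p q b'⟫ / p - open Classical in if b = b' then τ else 0
  | .inr (.inl (b, r)), p, q => ⟪M.obsNoise k₀ p q b, Real.sqrt p • ub p r⟫ / p
  | .inr (.inr b), p, q => ⟪M.obsNoise k₀ p q b, M.meanDiff p⟫ / p

variable (M) in
/-- The total deviation. -/
def dev (k₀ : Fin 2) (τ : ℝ) {m : ℕ} (ub : (p : ℕ) → Fin m → E p) (p : ℕ)
    (q : M.Sample p × E p) : ℝ :=
  ∑ s, |M.devTerm k₀ τ ub s p q|

theorem inner_obsNoise_tendsto (hM : M.Setting) (h2 : M.SpikedEigenvalues) (k₀ : Fin 2)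
    (w : (p : ℕ) → E p) (C : ℝ) (hw : ∀ᶠ p : ℕ in atTop, ‖w p‖ ^ 2 ≤ C * p)
    (b : Option M.TrainIdx) {η : ℝ} (hη : 0 < η) :
    Tendsto (fun p : ℕ => M.pairLaw k₀ p {q | η ≤ |⟪M.obsNoise k₀ p q b, w p⟫ / p|})
      atTop (𝓝 0) := by
  obtain ⟨D, hD⟩ := h2.tailSq_bdd
  have hD0 : 0 ≤ D := (h2.tailSq_pos 0 0).le.trans (hD 0 0)
  refine tendsto_measure_of_lintegral_sq_le (M.pairLaw k₀)
    (fun p q => ⟪M.obsNoise k₀ p q b, w p⟫)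
    (fun p => (measurable_obsNoise k₀ p b).inner_const) (D * C) ?_ hη
  filter_upwards [hw] with p hp
  have hmeas := measurable_noise (M := M) (M.idxClass k₀ b) p
  have h4 := (measurePreserving_obs hM k₀ p b).lintegral_comp
    (f := fun x => ENNReal.ofReal (⟪M.noise (M.idxClass k₀ b) p x, w p⟫ ^ 2))
    ((hmeas.inner_const).pow_const 2).ennreal_ofReal
  refine (le_of_eq h4).trans ((lintegral_inner_noise_sq_le hM hD0 hD _ p _).trans ?_)
  refine ENNReal.ofReal_le_ofReal ?_
  rw [mul_assoc]
  exact mul_le_mul_of_nonneg_left hp hD0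

/-- The diagonal terms follow from the law of large numbers. Distinct observations are independent,
so the second moment bound for a product law applies; the basis and mean terms are inner products
with fixed vectors of squared length `O(p)`. -/
theorem devTerm_tendsto (hM : M.Setting) (h1 : M.MeanSeparation) (h2 : M.SpikedEigenvalues)
    (h3 : M.MixingScores) (k₀ : Fin 2) {τ : ℝ} (hτ : ∀ k, M.tauSq k = τ) {m : ℕ}
    (ub : (p : ℕ) → Fin m → E p) (hub : ∀ᶠ p in atTop, Orthonormal ℝ (ub p)) (s) {η : ℝ}
    (hη : 0 < η) :
    Tendsto (fun p => M.pairLaw k₀ p {q | η ≤ |M.devTerm k₀ τ ub s p q|}) atTop (𝓝 0) := by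
  classical
  obtain ⟨D, hD⟩ := h2.tailSq_bdd
  have hD0 : 0 ≤ D := (h2.tailSq_pos 0 0).le.trans (hD 0 0)
  rcases s with ⟨b, b'⟩ | ⟨b, r⟩ | b
  · by_cases hb : b = b'
    · subst hb
      refine (noise_lln hM h2 h3 (M.idxClass k₀ b) hη).congr fun p => ?_
      have hmeas := measurable_noise (M := M) (M.idxClass k₀ b) p
      rw [← (measurePreserving_obs hM k₀ p b).measure_preimage]
      · simp only [devTerm, if_true, hτ]
        rfl
      · refine (measurableSet_le measurable_const ?_).nullMeasurableSet
        exact (((hmeas.inner (𝕜 := ℝ) hmeas).div_const _).sub_const _).norm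
    · simp only [devTerm, if_neg hb, sub_zero]
      refine tendsto_measure_of_lintegral_sq_le (M.pairLaw k₀)
        (fun p q => ⟪M.obsNoise k₀ p q b, M.obsNoise k₀ p q b'⟫)
        (fun p => (measurable_obsNoise k₀ p b).inner (measurable_obsNoise k₀ p b')) (D * D)
        (Eventually.of_forall fun p => ?_) hη
      have hmeas := measurable_noise (M := M) (M.idxClass k₀ b) p
      have hmeas' := measurable_noise (M := M) (M.idxClass k₀ b') p
      have h4 := (measurePreserving_obs_pair hM k₀ p hb).lintegral_comp
        (f := fun x => ENNReal.ofReal (⟪M.noise (M.idxClass k₀ b) p x.1,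
          M.noise (M.idxClass k₀ b') p x.2⟫ ^ 2))
        (((hmeas.comp measurable_fst).inner
          (hmeas'.comp measurable_snd)).pow_const 2).ennreal_ofReal
      refine (le_of_eq h4).trans
        ((lintegral_inner_noise_noise_sq_le hM hD0 hD _ _ p).trans (le_of_eq ?_))
      rw [mul_assoc]
  · refine inner_obsNoise_tendsto hM h2 k₀ (fun p => Real.sqrt p • ub p r) 1 ?_ b hη
    filter_upwards [hub] with p hp
    rw [norm_smul, hp.1, mul_one, Real.norm_of_nonneg (Real.sqrt_nonneg _),
      Real.sq_sqrt (Nat.cast_nonneg p), one_mul]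
  · obtain ⟨δ, -, hδ⟩ := h1
    refine inner_obsNoise_tendsto hM h2 k₀ (fun p => M.meanDiff p) (δ ^ 2 + 1) ?_ b hη
    filter_upwards [(hδ.pow 2).eventually_le_const (lt_add_one _), eventually_gt_atTop 0]
      with p hp hp0
    have hp' : (0 : ℝ) < p := by exact_mod_cast hp0
    rwa [div_pow, Real.sq_sqrt hp'.le, div_le_iff₀ hp'] at hp

theorem dev_tendsto (hM : M.Setting) (h1 : M.MeanSeparation) (h2 : M.SpikedEigenvalues)
    (h3 : M.MixingScores) (k₀ : Fin 2) {τ : ℝ} (hτ : ∀ k, M.tauSq k = τ) {m : ℕ}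
    (ub : (p : ℕ) → Fin m → E p) (hub : ∀ᶠ p in atTop, Orthonormal ℝ (ub p)) {η : ℝ}
    (hη : 0 < η) :
    Tendsto (fun p => M.pairLaw k₀ p {q | η ≤ M.dev k₀ τ ub p q}) atTop (𝓝 0) :=
  tendsto_measure_sum_abs (M.pairLaw k₀) (M.devTerm k₀ τ ub)
    (fun s _ hη => devTerm_tendsto hM h1 h2 h3 k₀ hτ ub hub s hη) hη

end TwoClassModel

/-! ### Null zero sets of analytic functions -/

/-- A measure that vanishes on the zero sets of all nonzero real analytic functions. -/
def AnalyticNull {V : Type*} [NormedAddCommGroup V] [NormedSpace ℝ V] [MeasurableSpace V]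
    (μ : Measure V) : Prop :=
  ∀ F : V → ℝ, (∀ x, AnalyticAt ℝ F x) → (∃ x, F x ≠ 0) → μ {x | F x = 0} = 0

namespace AnalyticNull

theorem mono {V : Type*} [NormedAddCommGroup V] [NormedSpace ℝ V] [MeasurableSpace V]
    {μ ν : Measure V} (h : AnalyticNull ν) (hμν : μ ≪ ν) : AnalyticNull μ :=
  fun F hF hne => hμν (h F hF hne)

/-- The zeros of a nonzero analytic function on the line are isolated, so they form a null set. -/
theorem volume_real : AnalyticNull (volume : Measure ℝ) := by
  intro F hF ⟨x, hx⟩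
  have h1 : AnalyticOnNhd ℝ F Set.univ := fun x _ => hF x
  have h2 := h1.preimage_zero_mem_codiscrete hx
  have h3 := ae_restrict_le_codiscreteWithin (μ := (volume : Measure ℝ)) MeasurableSet.univ h2
  rw [Measure.restrict_univ, mem_ae_iff] at h3
  refine measure_mono_null (fun y hy => ?_) h3
  simpa using hy

/-- If `F (x₀, y₀) ≠ 0`, then for almost every `x` the slice `F (x, ·)` is nonzero at `y₀`, hence
vanishes only on a null set; Fubini concludes. -/
theorem prod {V W : Type*} [NormedAddCommGroup V] [NormedSpace ℝ V] [MeasurableSpace V]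
    [BorelSpace V] [SecondCountableTopology V]
    [NormedAddCommGroup W] [NormedSpace ℝ W] [MeasurableSpace W] [BorelSpace W]
    [SecondCountableTopology W] {μ : Measure V} {ν : Measure W} [SFinite ν]
    (hμ : AnalyticNull μ) (hν : AnalyticNull ν) : AnalyticNull (μ.prod ν) := by
  rintro F hF ⟨⟨x₀, y₀⟩, hne⟩
  have hcont : Continuous F := continuous_iff_continuousAt.2 fun q => (hF q).continuousAt
  have hmeas : MeasurableSet {q | F q = 0} := hcont.measurable (measurableSet_singleton 0)
  rw [Measure.measure_prod_null hmeas]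
  have h1 : μ {x | F (x, y₀) = 0} = 0 :=
    hμ (fun x => F (x, y₀)) (fun x => AnalyticAt.fun_comp (g := F) (f := fun x => (x, y₀)) (hF (x, y₀)) (by fun_prop)) ⟨x₀, hne⟩
  filter_upwards [compl_mem_ae_iff.2 h1] with x hx
  exact hν (fun y => F (x, y)) (fun y => (hF (x, y)).fun_comp (by fun_prop)) ⟨y₀, hx⟩

theorem pi {n : ℕ} {V : Fin n → Type*} [∀ i, NormedAddCommGroup (V i)]
    [∀ i, NormedSpace ℝ (V i)] [∀ i, MeasurableSpace (V i)] [∀ i, BorelSpace (V i)]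
    [∀ i, SecondCountableTopology (V i)] {μ : (i : Fin n) → Measure (V i)}
    [∀ i, SigmaFinite (μ i)] (h : ∀ i, AnalyticNull (μ i)) : AnalyticNull (Measure.pi μ) := by
  induction n with
  | zero =>
    rintro F - ⟨x, hx⟩
    have h0 : {y | F y = 0} = ∅ := by
      ext y
      simpa [Subsingleton.elim y x] using hx
    rw [h0, measure_empty]
  | succ n ih =>
    rintro F hF ⟨x₀, hx₀⟩
    have h1 : AnalyticNull ((μ 0).prod (Measure.pi fun j => μ ((0 : Fin (n + 1)).succAbove j))) :=
      (h 0).prod (ih fun j => h _)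
    have h2 := (measurePreserving_piFinSuccAbove μ 0).symm
    have hcont : Continuous F := continuous_iff_continuousAt.2 fun q => (hF q).continuousAt
    have hmeas : MeasurableSet {q | F q = 0} := hcont.measurable (measurableSet_singleton 0)
    rw [← h2.measure_preimage hmeas.nullMeasurableSet]
    refine h1 (fun q => F ((MeasurableEquiv.piFinSuccAbove V 0).symm q)) (fun q => ?_)
      ⟨MeasurableEquiv.piFinSuccAbove V 0 x₀, by
        rwa [MeasurableEquiv.symm_apply_apply]⟩
    refine (hF _).fun_comp (AnalyticAt.pi fun i => ?_)
    refine Fin.cases ?_ (fun j => ?_) i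
    · exact analyticAt_fst
    · exact analyticAt_pi_iff.1 analyticAt_snd j

end AnalyticNull

theorem analyticAt_det {V : Type*} [NormedAddCommGroup V] [NormedSpace ℝ V] {m : ℕ}
    {A : V → Matrix (Fin m) (Fin m) ℝ} {x : V} (hA : ∀ i j, AnalyticAt ℝ (fun x => A x i j) x) :
    AnalyticAt ℝ (fun x => (A x).det) x := by
  simp only [Matrix.det_apply, zsmul_eq_mul, Units.smul_def]
  exact Finset.analyticAt_fun_sum _ fun σ _ =>
    analyticAt_const.fun_mul (Finset.analyticAt_fun_prod _ fun i _ => hA _ _)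

theorem analyticAt_adjugate {V : Type*} [NormedAddCommGroup V] [NormedSpace ℝ V] {m : ℕ}
    {A : V → Matrix (Fin m) (Fin m) ℝ} {x : V} (hA : ∀ i j, AnalyticAt ℝ (fun x => A x i j) x)
    (i j : Fin m) : AnalyticAt ℝ (fun x => (A x).adjugate i j) x := by
  simp only [Matrix.adjugate_apply]
  refine analyticAt_det fun k l => ?_
  simp only [Matrix.updateRow_apply]
  split_ifs
  · exact analyticAt_const
  · exact hA k l

/-! ### The limiting discriminant statistic as a function of the leading scores -/

namespace TwoClassModel

variable (M : TwoClassModel)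

/-- The leading scores of a training sample. -/
abbrev LimitSample : Type := (k : Fin 2) → Fin (M.size k) → Fin (M.spikes k) → ℝ

/-- The law of the leading scores of an observation of class `k`. -/
def leadLaw (k : Fin 2) : Measure (Fin (M.spikes k) → ℝ) :=
  (M.scoreLaw k).map fun z (i : Fin (M.spikes k)) => z i

/-- The law of the leading scores of a training sample. -/
def limitTrainLaw : Measure M.LimitSample :=
  Measure.pi fun k => Measure.pi fun _ : Fin (M.size k) => M.leadLaw k

/-- The law of the leading scores of a training sample and an independent observation of class
`k₀`. -/
def limitLaw (k₀ : Fin 2) : Measure (M.LimitSample × (Fin (M.spikes k₀) → ℝ)) :=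
  M.limitTrainLaw.prod (M.leadLaw k₀)

variable {m : ℕ} (R : (k : Fin 2) → Matrix (Fin m) (Fin (M.spikes k)) ℝ)

/-- The limit of the scaled leading part of an observation with leading scores `z`, in the
coordinates of the common leading eigenspace. -/
def limitLead (k : Fin 2) (z : Fin (M.spikes k) → ℝ) : E m :=
  WithLp.toLp 2 fun r => ∑ i, R k r i * (Real.sqrt (M.sigmaSq k i) * z i)

/-- The limits of the scaled leading parts of a training sample. -/
def limitTrain (x : M.LimitSample) (a : M.TrainIdx) : E m := M.limitLead R a.1 (x a.1 a.2)

/-- The scatter matrix of the leading parts of a training sample. -/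
def limitScatter (x : M.LimitSample) : Matrix (Fin m) (Fin m) ℝ :=
  Matrix.of fun r r' => ∑ a, center (M.limitTrain R x) a r * center (M.limitTrain R x) a r'

/-- The linear pencil of the scatter matrix and the identity. -/
def limitPencil (a s : ℝ) (x : M.LimitSample) : Matrix (Fin m) (Fin m) ℝ :=
  a • M.limitScatter R x + s • 1

/-- The limit of the sample mean difference in the common leading eigenspace. -/
def limitDiff (Mu : E m) (x : M.LimitSample) : E m :=
  Mu + (classAvg (M.limitTrain R x) 0 - classAvg (M.limitTrain R x) 1)

/-- The coefficient of the mean difference in the deviation of an observation of class `k₀` from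
the total mean. -/
def meanCoeff (k₀ : Fin 2) : ℝ :=
  if k₀ = 0 then (M.size 1 : ℝ) / M.total else -((M.size 0 : ℝ) / M.total)

/-- The limit of the deviation of a test observation from the total sample mean in the common
leading eigenspace. -/
def limitTest (Mu : E m) (k₀ : Fin 2) (q : M.LimitSample × (Fin (M.spikes k₀) → ℝ)) : E m :=
  M.limitLead R k₀ q.2 + M.meanCoeff k₀ • Mu -
    (((M.size 0 : ℝ) / M.total) • classAvg (M.limitTrain R q.1) 0 +
      ((M.size 1 : ℝ) / M.total) • classAvg (M.limitTrain R q.1) 1)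

/-- The limit of the discriminant statistic times the squared determinant of the pencil. -/
def limitStat (Mu : E m) (κ a s : ℝ) (k₀ : Fin 2)
    (q : M.LimitSample × (Fin (M.spikes k₀) → ℝ)) : ℝ :=
  (M.limitPencil R a s q.1).det * ((M.limitPencil R a s q.1).det * (M.meanCoeff k₀ * κ) +
    s * ⟪M.limitTest R Mu k₀ q,
      Matrix.toEuclideanLin (M.limitPencil R a s q.1).adjugate (M.limitDiff R Mu q.1)⟫)

variable {M R}

theorem toEuclideanLin_limitPencil (a s : ℝ) (x : M.LimitSample) (v : E m) :
    Matrix.toEuclideanLin (M.limitPencil R a s x) v =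
      a • combo (center (M.limitTrain R x)) (coeffs (center (M.limitTrain R x)) v) + s • v := by
  have h1 : Matrix.toEuclideanLin (M.limitScatter R x) v =
      combo (center (M.limitTrain R x)) (coeffs (center (M.limitTrain R x)) v) := by
    ext r
    simp only [Matrix.toLpLin_apply, Matrix.mulVec, dotProduct, limitScatter, Matrix.of_apply,
      combo, coeffs_apply, WithLp.ofLp_sum, Finset.sum_apply, WithLp.ofLp_smul, Pi.smul_apply,
      smul_eq_mul, Finset.sum_mul, PiLp.inner_apply, RCLike.inner_apply, conj_trivial]
    rw [Finset.sum_comm]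
    refine Finset.sum_congr rfl fun b _ => Finset.sum_congr rfl fun r' _ => by ring
  rw [limitPencil, map_add, map_smul, map_smul, LinearMap.add_apply, LinearMap.smul_apply,
    LinearMap.smul_apply, h1]
  simp

theorem limitPencil_injective {a s : ℝ} {x : M.LimitSample}
    (h : (M.limitPencil R a s x).det ≠ 0) (v : E m)
    (hv : a • combo (center (M.limitTrain R x)) (coeffs (center (M.limitTrain R x)) v) +
      s • v = 0) : v = 0 := by
  rw [← toEuclideanLin_limitPencil] at hv
  have h1 := Matrix.eq_zero_of_mulVec_eq_zero h (v := WithLp.ofLp v) (by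
    have := congrArg WithLp.ofLp hv
    simpa [Matrix.toLpLin_apply] using this)
  exact (WithLp.ofLp_injective 2) h1

/-- Cramer's rule. The adjugate replaces the inverse in `limitStat` to make it analytic on the whole
space; where the determinant is nonzero, the sign is still that of the limiting statistic. -/
theorem exists_pencil_solution {Mu : E m} {κ a s : ℝ} {k₀ : Fin 2}
    {q : M.LimitSample × (Fin (M.spikes k₀) → ℝ)} (h : (M.limitPencil R a s q.1).det ≠ 0) :
    ∃ e : E m, a • combo (center (M.limitTrain R q.1)) (coeffs (center (M.limitTrain R q.1)) e) +
        s • e = M.limitDiff R Mu q.1 ∧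
      M.limitStat R Mu κ a s k₀ q = (M.limitPencil R a s q.1).det ^ 2 *
        (M.meanCoeff k₀ * κ + s * ⟪M.limitTest R Mu k₀ q, e⟫) := by
  set D := (M.limitPencil R a s q.1).det with hD
  refine ⟨D⁻¹ • Matrix.toEuclideanLin (M.limitPencil R a s q.1).adjugate
    (M.limitDiff R Mu q.1), ?_, ?_⟩
  · rw [← toEuclideanLin_limitPencil, map_smul]
    have h1 : Matrix.toEuclideanLin (M.limitPencil R a s q.1)
        (Matrix.toEuclideanLin (M.limitPencil R a s q.1).adjugate (M.limitDiff R Mu q.1)) =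
        D • M.limitDiff R Mu q.1 := by
      apply WithLp.ofLp_injective 2
      simp only [Matrix.toLpLin_apply, Matrix.mulVec_mulVec, Matrix.mul_adjugate,
        Matrix.smul_mulVec, Matrix.one_mulVec, WithLp.ofLp_smul, hD]
    rw [h1, smul_smul, inv_mul_cancel₀ h, one_smul]
  · rw [limitStat, real_inner_smul_right, ← hD]
    field_simp

theorem analyticAt_limitTrain_apply (a : M.TrainIdx) (r : Fin m) (x : M.LimitSample) :
    AnalyticAt ℝ (fun x : M.LimitSample => M.limitTrain R x a r) x := by
  have h0 : AnalyticAt ℝ (fun x : M.LimitSample => x a.1) x :=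
    (analyticAt_pi_iff (f := fun k (x : M.LimitSample) => x k)).1 analyticAt_id a.1
  have h1 : AnalyticAt ℝ (fun x : M.LimitSample => x a.1 a.2) x :=
    (analyticAt_pi_iff (f := fun j (x : M.LimitSample) => x a.1 j)).1 h0 a.2
  simp only [limitTrain, limitLead]
  exact Finset.analyticAt_fun_sum _ fun i _ =>
    analyticAt_const.fun_mul (analyticAt_const.fun_mul (analyticAt_pi_iff.1 h1 i))

theorem analyticAt_classAvg_apply (k : Fin 2) (r : Fin m) (x : M.LimitSample) :
    AnalyticAt ℝ (fun x : M.LimitSample => classAvg (M.limitTrain R x) k r) x := by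
  simp only [classAvg, PiLp.smul_apply, smul_eq_mul, WithLp.ofLp_sum, Finset.sum_apply]
  exact analyticAt_const.fun_mul (Finset.analyticAt_fun_sum _ fun j _ =>
    analyticAt_limitTrain_apply _ _ _)

theorem analyticAt_limitPencil_apply (a s : ℝ) (r r' : Fin m) (x : M.LimitSample) :
    AnalyticAt ℝ (fun x : M.LimitSample => M.limitPencil R a s x r r') x := by
  simp only [limitPencil, limitScatter, Matrix.add_apply, Matrix.smul_apply, Matrix.of_apply,
    smul_eq_mul, center, PiLp.sub_apply]
  refine (analyticAt_const.fun_mul (Finset.analyticAt_fun_sum _ fun b _ => ?_)).fun_add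
    analyticAt_const
  exact ((analyticAt_limitTrain_apply _ _ _).fun_sub (analyticAt_classAvg_apply _ _ _)).fun_mul
    ((analyticAt_limitTrain_apply _ _ _).fun_sub (analyticAt_classAvg_apply _ _ _))

theorem analyticAt_det_limitPencil (a s : ℝ) (x : M.LimitSample) :
    AnalyticAt ℝ (fun x : M.LimitSample => (M.limitPencil R a s x).det) x :=
  analyticAt_det fun _ _ => analyticAt_limitPencil_apply _ _ _ _ _

theorem analyticAt_limitStat (Mu : E m) (κ a s : ℝ) (k₀ : Fin 2)
    (q : M.LimitSample × (Fin (M.spikes k₀) → ℝ)) :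
    AnalyticAt ℝ (M.limitStat R Mu κ a s k₀) q := by
  have hfst : ∀ {f : M.LimitSample → ℝ}, (∀ x, AnalyticAt ℝ f x) →
      AnalyticAt ℝ (fun q : M.LimitSample × (Fin (M.spikes k₀) → ℝ) => f q.1) q :=
    fun {f} hf => (hf q.1).fun_comp analyticAt_fst
  have hdet := hfst (analyticAt_det_limitPencil (R := R) a s)
  have hadj : ∀ r r', AnalyticAt ℝ (fun q : M.LimitSample × (Fin (M.spikes k₀) → ℝ) =>
      (M.limitPencil R a s q.1).adjugate r r') q := fun r r' =>
    hfst (f := fun x => (M.limitPencil R a s x).adjugate r r') fun x =>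
      analyticAt_adjugate (fun _ _ => analyticAt_limitPencil_apply _ _ _ _ _) r r'
  have havg : ∀ k r, AnalyticAt ℝ (fun q : M.LimitSample × (Fin (M.spikes k₀) → ℝ) =>
      classAvg (M.limitTrain R q.1) k r) q := fun k r =>
    hfst (analyticAt_classAvg_apply (R := R) k r)
  have hlead : ∀ r, AnalyticAt ℝ (fun q : M.LimitSample × (Fin (M.spikes k₀) → ℝ) =>
      M.limitLead R k₀ q.2 r) q := fun r => by
    simp only [limitLead]
    exact Finset.analyticAt_fun_sum _ fun i _ =>
      analyticAt_const.fun_mul (analyticAt_const.fun_mul (analyticAt_pi_iff.1 analyticAt_snd i))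
  unfold limitStat
  refine hdet.fun_mul ((hdet.fun_mul analyticAt_const).fun_add (analyticAt_const.fun_mul ?_))
  simp only [PiLp.inner_apply, RCLike.inner_apply, conj_trivial, Matrix.toLpLin_apply,
    Matrix.mulVec, dotProduct, limitTest, limitDiff, PiLp.add_apply, PiLp.sub_apply,
    PiLp.smul_apply, smul_eq_mul]
  refine Finset.analyticAt_fun_sum _ fun r _ => AnalyticAt.fun_mul
    (Finset.analyticAt_fun_sum _ fun r' _ => (hadj r r').fun_mul ?_) ?_
  · exact analyticAt_const.fun_add ((havg 0 r').fun_sub (havg 1 r'))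
  · exact ((hlead r).fun_add analyticAt_const).fun_sub
      ((analyticAt_const.fun_mul (havg 0 r)).fun_add (analyticAt_const.fun_mul (havg 1 r)))

/-! ### Nondegeneracy -/

theorem inner_limitLead (k : Fin 2) (z : Fin (M.spikes k) → ℝ) (v : E m) :
    ⟪M.limitLead R k z, v⟫ = ∑ i, Real.sqrt (M.sigmaSq k i) * z i * ∑ r, R k r i * v r := by
  simp only [PiLp.inner_apply, limitLead, RCLike.inner_apply, conj_trivial, Finset.mul_sum]
  rw [Finset.sum_comm]
  exact Finset.sum_congr rfl fun r _ => Finset.sum_congr rfl fun i _ => by ring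

theorem limitLead_zero (k : Fin 2) : M.limitLead R k 0 = 0 := by
  ext r; simp [limitLead]

theorem exists_det_limitScatter_ne_zero (hM : M.Setting) (h2 : M.SpikedEigenvalues)
    (hrank : (Matrix.fromCols (R 0) (R 1)).rank = m) {a : ℝ} (ha : a ≠ 0) :
    ∃ x : M.LimitSample, (M.limitPencil R a 0 x).det ≠ 0 := by
  -- The first observations of each class have the unit score vectors and the others have score `0`.
  -- At least one such other exists because `spikes k < size k`; comparison with it shows that a
  -- kernel vector is orthogonal to every column of both `R k`.
  let x : M.LimitSample := fun k j => if h : (j : ℕ) < M.spikes k then Pi.single ⟨j, h⟩ 1 else 0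
  refine ⟨x, fun hdet => ?_⟩
  obtain ⟨w, hw0, hw⟩ := Matrix.exists_mulVec_eq_zero_iff.2 hdet
  apply hw0
  set v : E m := WithLp.toLp 2 w with hv
  have h1 : Matrix.toEuclideanLin (M.limitPencil R a 0 x) v = 0 := by
    apply WithLp.ofLp_injective 2
    simpa [Matrix.toLpLin_apply] using hw
  rw [toEuclideanLin_limitPencil, zero_smul, add_zero, smul_eq_zero] at h1
  have h1 := h1.resolve_left ha
  have h3 : coeffs (center (M.limitTrain R x)) v = 0 := by
    rw [← inner_self_eq_zero (𝕜 := ℝ), inner_coeffs, h1, inner_zero_left]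
  have h4 : ∀ k j, ⟪M.limitTrain R x ⟨k, j⟩, v⟫ = ⟪classAvg (M.limitTrain R x) k, v⟫ := by
    intro k j
    have h5 : ⟪center (M.limitTrain R x) ⟨k, j⟩, v⟫ = 0 := congrFun (congrArg WithLp.ofLp h3) ⟨k, j⟩
    rwa [center, inner_sub_left, sub_eq_zero] at h5
  have h5 : ∀ k (i : Fin (M.spikes k)), ∑ r, R k r i * v r = 0 := by
    intro k i
    have h6 := h4 k ⟨i, i.2.trans (hM.size_gt k)⟩
    rw [← h4 k ⟨M.spikes k, hM.size_gt k⟩] at h6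
    simp only [limitTrain, x, lt_irrefl, dif_neg, not_false_eq_true, limitLead_zero,
      inner_zero_left, dif_pos i.2, inner_limitLead] at h6
    rw [Finset.sum_eq_single i] at h6
    · have := Real.sqrt_pos.2 (h2.sigmaSq_pos k i)
      simpa [this.ne'] using h6
    · intro i' _ hi'
      simp [hi']
    · simp
  have hinj : Function.Injective (Matrix.fromCols (R 0) (R 1)).vecMul := by
    rw [Matrix.vecMul_injective_iff, linearIndependent_iff_card_eq_finrank_span,
      Set.finrank, ← Matrix.rank_eq_finrank_span_row, hrank, Fintype.card_fin]
  have h7 : Matrix.vecMul w (Matrix.fromCols (R 0) (R 1)) = 0 := by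
    rw [Matrix.vecMul_fromCols]
    ext i
    rcases i with i | i
    · simpa [Matrix.vecMul, dotProduct, mul_comm (w _)] using h5 0 i
    · simpa [Matrix.vecMul, dotProduct, mul_comm (w _)] using h5 1 i
  exact hinj (h7.trans (Matrix.zero_vecMul _).symm)

end TwoClassModel

namespace TwoClassModel

variable {M : TwoClassModel} {m : ℕ} {R : (k : Fin 2) → Matrix (Fin m) (Fin (M.spikes k)) ℝ}

theorem size_pos (hM : M.Setting) (k : Fin 2) : 0 < M.size k :=
  (Nat.zero_le _).trans_lt (hM.size_gt k)

/-- Giving all training observations of a class the same scores makes the scatter vanish, so the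
pencil is `s • 1`. The statistic is then affine in the leading score of the test observation, with
nonzero slope, and takes every value. -/
theorem exists_limitStat_eq (hM : M.Setting) (h2 : M.SpikedEigenvalues)
    (hR : ∀ k, (R k).transpose * R k = 1) (Mu : E m) (κ a s : ℝ) (hs : s ≠ 0) (k₀ : Fin 2)
    (r : ℝ) : ∃ q, M.limitStat R Mu κ a s k₀ q = s ^ m * (s ^ m * r) := by
  let i₀ : Fin (M.spikes k₀) := ⟨0, h2.spikes_pos k₀⟩
  set σ := Real.sqrt (M.sigmaSq k₀ i₀) with hσ
  have hσ0 : σ ≠ 0 := (Real.sqrt_pos.2 (h2.sigmaSq_pos k₀ i₀)).ne'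
  have hlead : ∀ (c : ℝ) (v : E m), ⟪M.limitLead R k₀ (Pi.single i₀ c), v⟫ =
      σ * c * ∑ r, R k₀ r i₀ * v r := by
    intro c v
    rw [inner_limitLead, Finset.sum_eq_single i₀]
    · simp [hσ]
    · intro i _ hi; simp [hi]
    · simp
  have hcol : ∀ c : ℝ, ∑ r, R k₀ r i₀ * M.limitLead R k₀ (Pi.single i₀ c) r = σ * c := by
    intro c
    have h3 : ∀ r, M.limitLead R k₀ (Pi.single i₀ c) r = R k₀ r i₀ * (σ * c) := by
      intro r
      simp only [limitLead]
      rw [Finset.sum_eq_single i₀]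
      · simp [hσ]
      · intro i _ hi; simp [hi]
      · simp
    have h4 : ∑ r, R k₀ r i₀ * R k₀ r i₀ = 1 := by
      have := congrFun (congrFun (hR k₀) i₀) i₀
      simpa [Matrix.mul_apply] using this
    simp only [h3, ← mul_assoc, ← Finset.sum_mul, h4, one_mul]
  set ε : ℝ := if k₀ = 0 then 1 else -1 with hε
  have hε2 : ε * ε = 1 := by rw [hε]; split_ifs <;> norm_num
  set g := ∑ r, R k₀ r i₀ * Mu r with hg
  -- Chosen so that the limiting sample mean difference has inner product `1` with the first column
  -- of `R k₀`, whatever `Mu` is; this keeps the slope from vanishing.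
  let ξ : Fin (M.spikes k₀) → ℝ := Pi.single i₀ (ε * (1 - g) / σ)
  set ℓ := M.limitLead R k₀ ξ with hℓ
  let x : M.LimitSample := fun k _ => if h : k = k₀ then h ▸ ξ else 0
  have htrain : ∀ b, M.limitTrain R x b = if b.1 = k₀ then ℓ else 0 := by
    intro b
    simp only [limitTrain, x]
    split_ifs with h
    · obtain ⟨k, j⟩ := b
      subst h
      rfl
    · exact limitLead_zero _
  have havg : ∀ k, classAvg (M.limitTrain R x) k = if k = k₀ then ℓ else 0 := by
    intro k
    have : (M.size k : ℝ) ≠ 0 := by exact_mod_cast (size_pos hM k).ne'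
    simp only [classAvg, htrain]
    change _ • ∑ _j : Fin (M.size k), (if k = k₀ then ℓ else 0) = _
    rw [Finset.sum_const, Finset.card_univ, Fintype.card_fin, ← Nat.cast_smul_eq_nsmul ℝ, smul_smul, inv_mul_cancel₀ this, one_smul]
  have hpencil : M.limitPencil R a s x = s • 1 := by
    have : M.limitScatter R x = 0 := by
      ext r r'
      simp [limitScatter, center, htrain, havg]
    rw [limitPencil, this, smul_zero, zero_add]
  have hdet : (M.limitPencil R a s x).det = s ^ m := by
    rw [hpencil, Matrix.det_smul, Matrix.det_one, mul_one, Fintype.card_fin]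
  have hdiff : M.limitDiff R Mu x = Mu + ε • ℓ := by
    rw [limitDiff, havg, havg, hε]
    fin_cases k₀ <;> simp
  have hcd : ∑ r, R k₀ r i₀ * (M.limitDiff R Mu x) r = 1 := by
    rw [hdiff]
    simp only [PiLp.add_apply, PiLp.smul_apply, smul_eq_mul, mul_add, Finset.sum_add_distrib,
      ← hg]
    have h5 : ∑ r, R k₀ r i₀ * (ε * ℓ r) = ε * ∑ r, R k₀ r i₀ * ℓ r := by
      rw [Finset.mul_sum]; exact Finset.sum_congr rfl fun _ _ => by ring
    rw [h5, hℓ, hcol]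
    field_simp
    linear_combination (1 - g) * hε2
  obtain ⟨y, hy⟩ : ∃ y, M.meanCoeff k₀ * κ +
      ⟪M.limitTest R Mu k₀ (x, y), M.limitDiff R Mu x⟫ = r := by
    set w := M.meanCoeff k₀ • Mu - (((M.size 0 : ℝ) / M.total) • classAvg (M.limitTrain R x) 0 +
      ((M.size 1 : ℝ) / M.total) • classAvg (M.limitTrain R x) 1) with hw
    refine ⟨Pi.single i₀ ((r - M.meanCoeff k₀ * κ - ⟪w, M.limitDiff R Mu x⟫) / σ), ?_⟩
    have h6 : ∀ y, M.limitTest R Mu k₀ (x, y) = M.limitLead R k₀ y + w := by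
      intro y
      rw [limitTest, hw, add_sub_assoc]
    rw [h6, inner_add_left, hlead, hcd]
    field_simp
    ring
  have hne : (M.limitPencil R a s x).det ≠ 0 := by
    rw [hdet]; exact pow_ne_zero _ hs
  obtain ⟨e, he, hstat⟩ := exists_pencil_solution (Mu := Mu) (κ := κ) (k₀ := k₀) (q := (x, y)) hne
  refine ⟨(x, y), ?_⟩
  have hse : s • e = M.limitDiff R Mu x := by
    rw [← he, ← toEuclideanLin_limitPencil, hpencil]
    simp
  rw [hstat, ← real_inner_smul_right, hse, hy, hdet]
  ring

/-- For `s = 0` the statistic is `κ` times a nonzero constant and the squared determinant, so an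
invertible scatter suffices. For `s ≠ 0` any prescribed value is attained. -/
theorem exists_limitStat_ne_zero (hM : M.Setting) (h2 : M.SpikedEigenvalues)
    (hR : ∀ k, (R k).transpose * R k = 1) (hrank : (Matrix.fromCols (R 0) (R 1)).rank = m)
    (Mu : E m) {κ a s : ℝ} (hκ : κ ≠ 0) (has : a ≠ 0 ∨ s ≠ 0) (k₀ : Fin 2) :
    ∃ q, M.limitStat R Mu κ a s k₀ q ≠ 0 := by
  by_cases hs : s = 0
  · subst hs
    obtain ⟨x, hx⟩ := exists_det_limitScatter_ne_zero hM h2 hrank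
      (has.resolve_right (fun h => h rfl))
    refine ⟨(x, 0), ?_⟩
    rw [limitStat, zero_mul, add_zero]
    refine mul_ne_zero hx (mul_ne_zero hx (mul_ne_zero ?_ hκ))
    have h0 : (0 : ℝ) < M.size 0 := by exact_mod_cast size_pos hM 0
    have h1 : (0 : ℝ) < M.size 1 := by exact_mod_cast size_pos hM 1
    have ht : (0 : ℝ) < M.total := by
      rw [total]; push_cast; positivity
    rw [meanCoeff]
    split_ifs
    · positivity
    · exact neg_ne_zero.2 (by positivity)
  · obtain ⟨q, hq⟩ := exists_limitStat_eq hM h2 hR Mu κ a s hs k₀ 1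
    exact ⟨q, by rw [hq]; have := pow_ne_zero m hs; positivity⟩

/-! ### The law of the leading scores -/

theorem isProbabilityMeasure_leadLaw (h3 : M.MixingScores) (k : Fin 2) :
    IsProbabilityMeasure (M.leadLaw k) := by
  have := h3.isProb k
  have hm : Measurable fun (z : ℕ → ℝ) (i : Fin (M.spikes k)) => z i := by fun_prop
  exact Measure.isProbabilityMeasure_map hm.aemeasurable

theorem isProbabilityMeasure_limitTrainLaw (h3 : M.MixingScores) :
    IsProbabilityMeasure M.limitTrainLaw := by
  have := isProbabilityMeasure_leadLaw h3
  unfold limitTrainLaw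
  infer_instance

theorem isProbabilityMeasure_limitLaw (h3 : M.MixingScores) (k₀ : Fin 2) :
    IsProbabilityMeasure (M.limitLaw k₀) := by
  have := isProbabilityMeasure_leadLaw h3
  have := isProbabilityMeasure_limitTrainLaw h3
  unfold limitLaw
  infer_instance

theorem analyticNull_leadLaw (hf : M.FullSupportScores) (k : Fin 2) :
    AnalyticNull (M.leadLaw k) := by
  obtain ⟨f, -, h1, -⟩ := hf k
  rw [leadLaw, h1]
  exact (AnalyticNull.pi fun _ => AnalyticNull.volume_real).mono
    (withDensity_absolutelyContinuous _ _)

theorem analyticNull_limitTrainLaw (h3 : M.MixingScores) (hf : M.FullSupportScores) :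
    AnalyticNull M.limitTrainLaw := by
  have := isProbabilityMeasure_leadLaw h3
  exact AnalyticNull.pi fun k => AnalyticNull.pi fun _ => analyticNull_leadLaw hf k

theorem analyticNull_limitLaw (h3 : M.MixingScores) (hf : M.FullSupportScores) (k₀ : Fin 2) :
    AnalyticNull (M.limitLaw k₀) := by
  have := isProbabilityMeasure_leadLaw h3
  exact (analyticNull_limitTrainLaw h3 hf).prod (analyticNull_leadLaw hf k₀)

theorem isOpenPosMeasure_leadLaw (hf : M.FullSupportScores) (k : Fin 2) :
    (M.leadLaw k).IsOpenPosMeasure := by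
  obtain ⟨f, hm, h1, hpos⟩ := hf k
  rw [leadLaw, h1]
  exact (withDensity_absolutelyContinuous' hm.aemeasurable
    (Eventually.of_forall fun x => (hpos x).ne')).isOpenPosMeasure

theorem isOpenPosMeasure_limitLaw (h3 : M.MixingScores) (hf : M.FullSupportScores)
    (k₀ : Fin 2) : (M.limitLaw k₀).IsOpenPosMeasure := by
  have := isProbabilityMeasure_leadLaw h3
  have := isOpenPosMeasure_leadLaw hf
  unfold limitLaw limitTrainLaw
  infer_instance

end TwoClassModel

/-! ### From observations to limiting inner products -/

theorem Orthonormal.sum_inner_smul_of_mem_span {H : Type*} [NormedAddCommGroup H]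
    [InnerProductSpace ℝ H] {m : ℕ} {e : Fin m → H} (he : Orthonormal ℝ e) {v : H}
    (hv : v ∈ Submodule.span ℝ (Set.range e)) : ∑ r, ⟪e r, v⟫ • e r = v := by
  induction hv using Submodule.span_induction with
  | mem x hx =>
    obtain ⟨s, rfl⟩ := hx
    simp [orthonormal_iff_ite.1 he]
  | zero => simp
  | add x y _ _ hx hy =>
    simp only [inner_add_right, add_smul, Finset.sum_add_distrib, hx, hy]
  | smul c x _ hx =>
    simp only [real_inner_smul_right, mul_smul, ← Finset.smul_sum, hx]

theorem Orthonormal.inner_of_mem_span {H : Type*} [NormedAddCommGroup H]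
    [InnerProductSpace ℝ H] {m : ℕ} {e : Fin m → H} (he : Orthonormal ℝ e) {v : H}
    (hv : v ∈ Submodule.span ℝ (Set.range e)) (w : H) :
    ⟪v, w⟫ = ∑ r, ⟪e r, v⟫ * ⟪e r, w⟫ := by
  conv_lhs => rw [← Orthonormal.sum_inner_smul_of_mem_span he hv]
  simp only [sum_inner, real_inner_smul_left]

namespace TwoClassModel

variable {M : TwoClassModel}

variable (M) in
/-- The leading scores of an observation of class `k`. -/
def leadScores (k : Fin 2) (p : ℕ) (x : E p) (i : Fin (M.spikes k)) : ℝ :=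
  if h : (i : ℕ) < p then M.scores k p x ⟨i, h⟩ else 0

/-- The leading scores of a training sample. -/
def sampleScores {p : ℕ} (x : M.Sample p) : M.LimitSample := fun k j => M.leadScores k p (x k j)

variable (M) in
/-- The leading scores of a training sample and an observation of class `k₀`. -/
def pairScores (k₀ : Fin 2) (p : ℕ) (q : M.Sample p × E p) :
    M.LimitSample × (Fin (M.spikes k₀) → ℝ) :=
  (sampleScores q.1, M.leadScores k₀ p q.2)

variable (M) in
/-- The leading part of an observation of class `k` with leading scores `z`. -/
def leadPart (k : Fin 2) (p : ℕ) (z : Fin (M.spikes k) → ℝ) : E p :=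
  ∑ i : Fin (M.spikes k), (Real.sqrt (M.eigval k p i) * z i) • M.leadVec k p i

theorem leadPart_add_noise (h2 : M.SpikedEigenvalues) (k : Fin 2) {p : ℕ}
    (hp : M.spikes k ≤ p) (x : E p) :
    M.leadPart k p (M.leadScores k p x) + M.noise k p x = x - M.mean k p := by
  conv_rhs => rw [← (M.eigvec k p).sum_repr' (x - M.mean k p), sum_fin_eq_sum_castLE_add hp]
  refine congrArg₂ _ (Finset.sum_congr rfl fun i _ => ?_) rfl
  have hi : (i : ℕ) < p := i.2.trans_le hp
  have hpos := Real.sqrt_pos.2 (eigval_pos h2 k p i)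
  rw [leadScores, dif_pos hi, leadVec, dif_pos hi, scores, mul_div_cancel₀ _ hpos.ne']
  rfl

/-- Both classes enter the common space because both have exponent `1`. -/
theorem leadPart_mem (hβ : ∀ k, M.beta k = 1) (k : Fin 2) (p : ℕ)
    (z : Fin (M.spikes k) → ℝ) : M.leadPart k p z ∈ M.commonSpace p := by
  have h1 : M.leadSpace k p ≤ M.commonSpace p :=
    le_iSup₂_of_le (f := fun (k : Fin 2) (_ : M.beta k = 1) => M.leadSpace k p) k (hβ k) le_rfl
  exact h1 (Submodule.sum_mem _ fun i _ => Submodule.smul_mem _ _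
    (Submodule.subset_span (Set.mem_range_self i)))

variable (M) in
/-- The mean difference, scaled. -/
def scaledDiff (p : ℕ) : E p := (Real.sqrt p)⁻¹ • M.meanDiff p

variable (M) in
/-- Convergence of the coordinates of the leading eigenvectors and of the scaled mean difference
with respect to orthonormal bases of the common leading eigenspaces. -/
structure BasisLimit {m : ℕ} (ub : (p : ℕ) → Fin m → E p)
    (R : (k : Fin 2) → Matrix (Fin m) (Fin (M.spikes k)) ℝ) (Mu : E m) (κ : ℝ) : Prop where
  orth : ∀ᶠ p in atTop, Orthonormal ℝ (ub p)
  span : ∀ᶠ p in atTop, Submodule.span ℝ (Set.range (ub p)) = M.commonSpace p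
  lead : ∀ k i j, Tendsto (fun p => ⟪ub p i, M.leadVec k p j⟫) atTop (𝓝 (R k i j))
  mean : ∀ r, Tendsto (fun p => ⟪ub p r, M.scaledDiff p⟫) atTop (𝓝 (Mu r))
  norm : Tendsto (fun p => ⟪M.scaledDiff p, M.scaledDiff p⟫) atTop (𝓝 (⟪Mu, Mu⟫ + κ))

/-- The scaled deviation of a training observation from its mean. -/
def scaledTrain {p : ℕ} (x : M.Sample p) (a : M.TrainIdx) : E p :=
  (Real.sqrt p)⁻¹ • (x a.1 a.2 - M.mean a.1 p)

theorem sqrt_eigval_tendsto (hβ : ∀ k, M.beta k = 1) (k : Fin 2)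
    (i : Fin (M.spikes k)) :
    Tendsto (fun p : ℕ => (Real.sqrt p)⁻¹ * Real.sqrt (M.eigval k p i)) atTop
      (𝓝 (Real.sqrt (M.sigmaSq k i))) := by
  have h1 : Tendsto (fun p : ℕ => Real.sqrt (M.sigmaSq k i + M.tailSq k i * (p : ℝ)⁻¹)) atTop
      (𝓝 (Real.sqrt (M.sigmaSq k i + M.tailSq k i * 0))) :=
    (Real.continuous_sqrt.tendsto _).comp (tendsto_const_nhds.add
      ((tendsto_inv_atTop_nhds_zero_nat (𝕜 := ℝ)).const_mul _))
  rw [mul_zero, add_zero] at h1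
  refine h1.congr' ?_
  filter_upwards [eventually_gt_atTop 0] with p hp
  have hp' : (0 : ℝ) < p := by exact_mod_cast hp
  rw [← Real.sqrt_inv, ← Real.sqrt_mul (by positivity), eigval, dif_pos i.2, hβ, Real.rpow_one]
  congr 1
  simp only [Fin.eta]
  field_simp

theorem inner_smul_sqrt_inv (p : ℕ) (v w : E p) :
    ⟪(Real.sqrt p)⁻¹ • v, (Real.sqrt p)⁻¹ • w⟫ = ⟪v, w⟫ / p := by
  rw [real_inner_smul_left, real_inner_smul_right, ← mul_assoc, ← mul_inv,
    Real.mul_self_sqrt (Nat.cast_nonneg p), inv_mul_eq_div]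

section Limits

variable {ι : Type*} {l : Filter ι} {p : ι → ℕ} {m : ℕ} {ub : (p : ℕ) → Fin m → E p}
  {R : (k : Fin 2) → Matrix (Fin m) (Fin (M.spikes k)) ℝ} {Mu : E m} {κ τ : ℝ} {k₀ : Fin 2}
  {q : (i : ι) → M.Sample (p i) × E (p i)} {z : M.LimitSample × (Fin (M.spikes k₀) → ℝ)}

theorem devTerm_tendsto_zero
    (hdev : Tendsto (fun i => M.dev k₀ τ ub (p i) (q i)) l (𝓝 0)) (s) :
    Tendsto (fun i => M.devTerm k₀ τ ub s (p i) (q i)) l (𝓝 0) :=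
  squeeze_zero_norm (fun i => by
    rw [Real.norm_eq_abs]
    exact Finset.single_le_sum (f := fun s => |M.devTerm k₀ τ ub s (p i) (q i)|)
      (fun _ _ => abs_nonneg _) (Finset.mem_univ s)) hdev

theorem inner_basis_leadPart_tendsto (hb : M.BasisLimit ub R Mu κ)
    (hβ : ∀ k, M.beta k = 1) (hp : Tendsto p l atTop) (k : Fin 2)
    {w : ι → Fin (M.spikes k) → ℝ} {w₀ : Fin (M.spikes k) → ℝ} (hw : Tendsto w l (𝓝 w₀))
    (r : Fin m) :
    Tendsto (fun i => ⟪ub (p i) r, (Real.sqrt (p i))⁻¹ • M.leadPart k (p i) (w i)⟫) l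
      (𝓝 (M.limitLead R k w₀ r)) := by
  simp only [leadPart, limitLead, Finset.smul_sum, inner_sum, real_inner_smul_right]
  refine tendsto_finsetSum _ fun j _ => ?_
  have h1 := ((sqrt_eigval_tendsto hβ k j).comp hp).mul (tendsto_pi_nhds.1 hw j)
  refine (((hb.lead k r j).comp hp).mul h1).congr fun i => ?_
  simp only [Function.comp]
  ring

/-- A deterministic statement: once the total deviation tends to `0` and the leading scores
converge, every limit is forced. Leading parts lie in the span of the basis, so their inner products
reduce to `m` coordinates. -/
theorem gramLimit (h2 : M.SpikedEigenvalues) (hβ : ∀ k, M.beta k = 1)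
    (hb : M.BasisLimit ub R Mu κ) (hp : Tendsto p l atTop)
    (hdev : Tendsto (fun i => M.dev k₀ τ ub (p i) (q i)) l (𝓝 0))
    (hz : Tendsto (fun i => M.pairScores k₀ (p i) (q i)) l (𝓝 z)) :
    GramLimit l p (fun i => scaledTrain (q i).1)
      (fun i => (Real.sqrt (p i))⁻¹ • ((q i).2 - M.mean k₀ (p i)))
      (fun i => M.scaledDiff (p i)) (fun i => ub (p i)) (M.limitTrain R z.1)
      (M.limitLead R k₀ z.2) Mu τ κ := by
  classical
  let w : ι → (b : Option M.TrainIdx) → Fin (M.spikes (M.idxClass k₀ b)) → ℝ := fun i b =>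
    M.leadScores (M.idxClass k₀ b) (p i) (obs (q i) b)
  let F : (i : ι) → Option M.TrainIdx → E (p i) := fun i b =>
    (Real.sqrt (p i))⁻¹ • M.leadPart (M.idxClass k₀ b) (p i) (w i b)
  let N : (i : ι) → Option M.TrainIdx → E (p i) := fun i b =>
    (Real.sqrt (p i))⁻¹ • M.obsNoise k₀ (p i) (q i) b
  let y : (i : ι) → Option M.TrainIdx → E (p i) := fun i b =>
    (Real.sqrt (p i))⁻¹ • (obs (q i) b - M.mean (M.idxClass k₀ b) (p i))
  let Lf : Option M.TrainIdx → E m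
    | none => M.limitLead R k₀ z.2
    | some a => M.limitTrain R z.1 a
  have hz1 := (continuous_fst.tendsto z).comp hz
  have hz2 := (continuous_snd.tendsto z).comp hz
  have hF : ∀ b r, Tendsto (fun i => ⟪ub (p i) r, F i b⟫) l (𝓝 (Lf b r)) := by
    intro b r
    cases b with
    | none => exact inner_basis_leadPart_tendsto hb hβ hp k₀ hz2 r
    | some a =>
      exact inner_basis_leadPart_tendsto hb hβ hp a.1
        (tendsto_pi_nhds.1 (tendsto_pi_nhds.1 hz1 a.1) a.2) r
  have hy : ∀ᶠ i in l, ∀ b, y i b = F i b + N i b := by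
    filter_upwards [hp.eventually_ge_atTop (M.spikes 0 + M.spikes 1)] with i hi b
    have hk : M.spikes (M.idxClass k₀ b) ≤ p i := by
      have : ∀ k, M.spikes k ≤ p i := Fin.forall_fin_two.2 ⟨by omega, by omega⟩
      exact this _
    simp only [y, F, N, w, ← smul_add]
    rw [obsNoise, leadPart_add_noise h2 _ hk]
  have hFv : ∀ᶠ i in l, ∀ b (v : E (p i)), ⟪F i b, v⟫ = ∑ r, ⟪ub (p i) r, F i b⟫ * ⟪ub (p i) r, v⟫ := by
    filter_upwards [hp.eventually hb.orth, hp.eventually hb.span] with i hi hs b v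
    refine Orthonormal.inner_of_mem_span hi ?_ v
    rw [hs]
    exact Submodule.smul_mem _ _ (leadPart_mem hβ _ _ _)
  have hNN : ∀ b b', Tendsto (fun i => ⟪N i b, N i b'⟫) l (𝓝 (if b = b' then τ else 0)) := by
    intro b b'
    have h3 := (devTerm_tendsto_zero hdev (.inl (b, b'))).add_const (if b = b' then τ else 0)
    rw [zero_add] at h3
    refine h3.congr fun i => ?_
    simp only [devTerm, N, inner_smul_sqrt_inv, sub_add_cancel]
  -- The noise is exactly orthogonal only to the leading eigenvectors of its own class; with respect
  -- to the common space this holds just in the limit.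
  have hNu : ∀ b r, Tendsto (fun i => ⟪ub (p i) r, N i b⟫) l (𝓝 0) := by
    intro b r
    refine (devTerm_tendsto_zero hdev (.inr (.inl (b, r)))).congr fun i => ?_
    simp only [devTerm, N]
    rw [real_inner_smul_right, real_inner_smul_right, real_inner_comm, mul_div_right_comm,
      Real.sqrt_div_self', one_div]
  have hNm : ∀ b, Tendsto (fun i => ⟪N i b, M.scaledDiff (p i)⟫) l (𝓝 0) := by
    intro b
    refine (devTerm_tendsto_zero hdev (.inr (.inr b))).congr fun i => ?_
    simp only [devTerm, N, scaledDiff, inner_smul_sqrt_inv]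
  have hsum : ∀ v v' : E m, ∑ r, v r * v' r = ⟪v, v'⟫ := fun v v' => by
    simp only [PiLp.inner_apply, RCLike.inner_apply, conj_trivial, mul_comm]
  have hFF : ∀ b b', Tendsto (fun i => ⟪F i b, F i b'⟫) l (𝓝 ⟪Lf b, Lf b'⟫) := by
    intro b b'
    rw [← hsum]
    refine (tendsto_finsetSum Finset.univ fun r _ => (hF b r).mul (hF b' r)).congr' ?_
    filter_upwards [hFv] with i hi
    rw [hi]
  have hFN : ∀ b b', Tendsto (fun i => ⟪F i b, N i b'⟫) l (𝓝 0) := by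
    intro b b'
    have h3 := tendsto_finsetSum Finset.univ fun r _ => (hF b r).mul (hNu b' r)
    simp only [mul_zero, Finset.sum_const_zero] at h3
    refine h3.congr' ?_
    filter_upwards [hFv] with i hi
    rw [hi]
  have hFm : ∀ b, Tendsto (fun i => ⟪F i b, M.scaledDiff (p i)⟫) l (𝓝 ⟪Lf b, Mu⟫) := by
    intro b
    rw [← hsum]
    refine (tendsto_finsetSum Finset.univ fun r _ =>
      (hF b r).mul ((hb.mean r).comp hp)).congr' ?_
    filter_upwards [hFv] with i hi
    rw [hi]
    rfl
  have hyy : ∀ b b', Tendsto (fun i => ⟪y i b, y i b'⟫) l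
      (𝓝 (⟪Lf b, Lf b'⟫ + if b = b' then τ else 0)) := by
    intro b b'
    have h3 := ((hFF b b').add (hNN b b')).add ((hFN b b').add (hFN b' b))
    rw [add_zero, add_zero] at h3
    refine h3.congr' ?_
    filter_upwards [hy] with i hi
    rw [hi, hi, inner_add_left, inner_add_right, inner_add_right, real_inner_comm (F i b') (N i b)]
    ring
  have hym : ∀ b, Tendsto (fun i => ⟪y i b, M.scaledDiff (p i)⟫) l (𝓝 ⟪Lf b, Mu⟫) := by
    intro b
    have h3 := (hFm b).add (hNm b)
    rw [add_zero] at h3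
    refine h3.congr' ?_
    filter_upwards [hy] with i hi
    rw [hi, inner_add_left]
  have hyu : ∀ b r, Tendsto (fun i => ⟪y i b, ub (p i) r⟫) l (𝓝 (Lf b r)) := by
    intro b r
    have h3 := (hF b r).add (hNu b r)
    rw [add_zero] at h3
    refine h3.congr' ?_
    filter_upwards [hy] with i hi
    rw [hi, inner_add_left, real_inner_comm (F i b), real_inner_comm (N i b)]
  exact
    { train := fun a a' => by
        have h := hyy (some a) (some a')
        simp only [Option.some.injEq] at h
        exact h
      train_test := fun a => by
        have h := hyy (some a) none
        simp only [reduceCtorEq, if_false, add_zero] at h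
        exact h
      train_mean := fun a => hym (some a)
      test_mean := hym none
      mean_mean := hb.norm.comp hp
      train_basis := fun a r => hyu (some a) r }

end Limits

end TwoClassModel

/-! ### The sample quantities in scaled form; angles of sample eigenvectors -/

theorem toEuclideanLin_vecMulVec {p : ℕ} (v w : E p) :
    Matrix.toEuclideanLin (Matrix.vecMulVec (v : Fin p → ℝ) v) w = ⟪v, w⟫ • v := by
  ext r
  simp only [Matrix.toLpLin_apply, Matrix.vecMulVec_mulVec, PiLp.inner_apply, RCLike.inner_apply,
    conj_trivial, PiLp.smul_apply, smul_eq_mul, dotProduct, Pi.smul_apply,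
    MulOpposite.smul_eq_mul_unop, MulOpposite.unop_op]
  rw [mul_comm]
  simp only [mul_comm]

theorem cos_angleToSubspace {p : ℕ} (w : E p) (V : Submodule ℝ (E p)) :
    Real.cos (angleToSubspace w V) = ‖V.starProjection w‖ / ‖w‖ := by
  have h1 : ⟪w, V.starProjection w⟫ = ‖V.starProjection w‖ ^ 2 := by
    rw [← real_inner_self_eq_norm_sq, Submodule.inner_starProjection_left_eq_right,
      Submodule.starProjection_eq_self_iff.2 (Submodule.starProjection_apply_mem V w)]
  rw [angleToSubspace, InnerProductGeometry.cos_angle, h1, sq, mul_comm ‖w‖]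
  by_cases h : ‖V.starProjection w‖ = 0
  · simp [h]
  · rw [mul_div_mul_left _ _ h]

theorem norm_starProjection_sq {p m : ℕ} {e : Fin m → E p} (he : Orthonormal ℝ e) (w : E p) :
    ‖(Submodule.span ℝ (Set.range e)).starProjection w‖ ^ 2 = ∑ r, ⟪e r, w⟫ ^ 2 := by
  have hmem := Submodule.starProjection_apply_mem (Submodule.span ℝ (Set.range e)) w
  rw [← real_inner_self_eq_norm_sq, Orthonormal.inner_of_mem_span he hmem]
  refine Finset.sum_congr rfl fun r _ => ?_
  rw [← Submodule.inner_starProjection_left_eq_right,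
    Submodule.starProjection_eq_self_iff.2 (Submodule.subset_span (Set.mem_range_self r)), sq]

namespace TwoClassModel

variable {M : TwoClassModel} {p : ℕ}

theorem total_pos (hM : M.Setting) : 0 < M.total := by
  have := size_pos hM 0
  rw [total]; omega

theorem classAvg_scaledTrain (hM : M.Setting) (x : M.Sample p) (k : Fin 2) :
    classAvg (scaledTrain x) k = (Real.sqrt p)⁻¹ • (classMean x k - M.mean k p) := by
  have : (M.size k : ℝ) ≠ 0 := by exact_mod_cast (size_pos hM k).ne'
  simp only [classAvg, scaledTrain, classMean]
  rw [← Finset.smul_sum, smul_comm, Finset.sum_sub_distrib, smul_sub, Finset.sum_const,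
    Finset.card_univ, Fintype.card_fin, ← Nat.cast_smul_eq_nsmul ℝ, smul_smul,
    inv_mul_cancel₀ this, one_smul]

theorem center_scaledTrain (hM : M.Setting) (x : M.Sample p) (a : M.TrainIdx) :
    center (scaledTrain x) a = (Real.sqrt p)⁻¹ • (x a.1 a.2 - classMean x a.1) := by
  rw [center, classAvg_scaledTrain hM, scaledTrain, ← smul_sub, sub_sub_sub_cancel_right]

theorem combo_center_scaledTrain (hM : M.Setting) (x : M.Sample p) (v : E p) :
    combo (center (scaledTrain x)) (coeffs (center (scaledTrain x)) v) =
      (p : ℝ)⁻¹ • Matrix.toEuclideanLin (withinScatter x) v := by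
  simp only [combo, coeffs_apply, center_scaledTrain hM, withinScatter, map_sum,
    LinearMap.sum_apply, Finset.smul_sum]
  rw [Fintype.sum_sigma]
  refine Finset.sum_congr rfl fun k _ => Finset.sum_congr rfl fun j _ => ?_
  change _ = (p : ℝ)⁻¹ • Matrix.toEuclideanLin (Matrix.vecMulVec
    (x k j - classMean x k : E p).ofLp (x k j - classMean x k : E p).ofLp) v
  rw [toEuclideanLin_vecMulVec, real_inner_smul_left, smul_smul, smul_smul,
    mul_right_comm, ← mul_inv, Real.mul_self_sqrt (Nat.cast_nonneg p)]

theorem smul_sampleDiff (hM : M.Setting) (x : M.Sample p) :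
    (Real.sqrt p)⁻¹ • sampleDiff x =
      M.scaledDiff p + (classAvg (scaledTrain x) 0 - classAvg (scaledTrain x) 1) := by
  rw [classAvg_scaledTrain hM, classAvg_scaledTrain hM, scaledDiff, ← smul_sub, ← smul_add,
    sampleDiff, meanDiff]
  congr 1
  abel

/-- The total mean is the average of the class means with weights `n_k / n`, so its expectation
differs from `μ_(k₀)` by a multiple of the mean difference; hence `meanCoeff`. -/
theorem smul_sub_totalMean (hM : M.Setting) (k₀ : Fin 2) (x : M.Sample p) (y : E p) :
    (Real.sqrt p)⁻¹ • (y - totalMean x) =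
      (Real.sqrt p)⁻¹ • (y - M.mean k₀ p) + M.meanCoeff k₀ • M.scaledDiff p -
        (((M.size 0 : ℝ) / M.total) • classAvg (scaledTrain x) 0 +
          ((M.size 1 : ℝ) / M.total) • classAvg (scaledTrain x) 1) := by
  have h0 : (M.size 0 : ℝ) ≠ 0 := by exact_mod_cast (size_pos hM 0).ne'
  have h1 : (M.size 1 : ℝ) ≠ 0 := by exact_mod_cast (size_pos hM 1).ne'
  have ht : (M.total : ℝ) = M.size 0 + M.size 1 := by rw [total]; push_cast; rfl
  have hpos : (0 : ℝ) < M.size 0 + M.size 1 := by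
    rw [← ht]; exact_mod_cast total_pos hM
  have htm : totalMean x = ((M.size 0 : ℝ) / M.total) • classMean x 0 +
      ((M.size 1 : ℝ) / M.total) • classMean x 1 := by
    rw [totalMean, Fin.sum_univ_two, classMean, classMean, smul_smul, smul_smul, smul_add,
      div_mul_eq_mul_div, div_mul_eq_mul_div, mul_inv_cancel₀ h0, mul_inv_cancel₀ h1, one_div]
  rw [htm, classAvg_scaledTrain hM, classAvg_scaledTrain hM, scaledDiff, meanDiff, ht]
  rw [smul_comm (M.meanCoeff k₀), smul_comm (_ / _), smul_comm (_ / _) (Real.sqrt p)⁻¹ (_ : E p),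
    ← smul_add, ← smul_add, ← smul_sub]
  congr 1
  have hk : k₀ = 0 ∨ k₀ = 1 := by omega
  rcases hk with rfl | rfl
  · rw [meanCoeff, if_pos rfl, ht]
    match_scalars <;> field_simp <;> ring
  · rw [meanCoeff, if_neg one_ne_zero, ht]
    match_scalars <;> field_simp <;> ring

section Limits

variable {ι : Type*} {𝒰 : Ultrafilter ι} {p : ι → ℕ} {m : ℕ} {ub : (p : ℕ) → Fin m → E p}
  {R : (k : Fin 2) → Matrix (Fin m) (Fin (M.spikes k)) ℝ} {Mu : E m} {κ τ : ℝ} {k₀ : Fin 2}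
  {q : (i : ι) → M.Sample (p i) × E (p i)} {z : M.LimitSample × (Fin (M.spikes k₀) → ℝ)}
  {lam : (p : ℕ) → M.Sample p → Fin p → ℝ}
  {u : (p : ℕ) → M.Sample p → OrthonormalBasis (Fin p) ℝ (E p)}

theorem scatterLimit_scaledTrain (hM : M.Setting)
    (h : GramLimit 𝒰 p (fun i => scaledTrain (q i).1)
      (fun i => (Real.sqrt (p i))⁻¹ • ((q i).2 - M.mean k₀ (p i)))
      (fun i => M.scaledDiff (p i)) (fun i => ub (p i)) (M.limitTrain R z.1)
      (M.limitLead R k₀ z.2) Mu τ κ) (hτ : 0 < τ) (hr : ∀ i, M.total ≤ p i)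
    (hu : M.IsSampleEigen lam u) :
    ScatterLimit 𝒰 p (LinearMap.ker (classSum M.size)) (fun i => center (scaledTrain (q i).1))
      (center (M.limitTrain R z.1)) τ (fun i j => (p i : ℝ)⁻¹ * lam (p i) (q i).1 j)
      (fun i => u (p i) (q i).1) := by
  refine h.scatterLimit (size_pos hM) hτ (fun i => (Nat.sub_le _ _).trans (hr i)) (fun i j => ?_)
    fun i => (hu _ _).2.const_mul (by positivity)
  rw [combo_center_scaledTrain hM, (hu _ _).1, smul_smul]

theorem eq_zero_of_inner_center_eq_zero (hdet : (M.limitPencil R 1 0 z.1).det ≠ 0) (v : E m)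
    (hv : ∀ a, ⟪center (M.limitTrain R z.1) a, v⟫ = 0) : v = 0 := by
  refine limitPencil_injective hdet v ?_
  simp [combo, coeffs_apply, hv]

/-- The squared cosine is the sum of the squared coordinates in the orthonormal basis of the common
space, and tends to `‖ξ j‖²`. -/
theorem cos_limit (hM : M.Setting) (h2 : M.SpikedEigenvalues) (hβ : ∀ k, M.beta k = 1)
    (hb : M.BasisLimit ub R Mu κ) (hp : Tendsto p 𝒰 atTop)
    (hdev : Tendsto (fun i => M.dev k₀ τ ub (p i) (q i)) 𝒰 (𝓝 0))
    (hz : Tendsto (fun i => M.pairScores k₀ (p i) (q i)) 𝒰 (𝓝 z)) (hτ : 0 < τ)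
    (hr : ∀ i, M.total ≤ p i) (hu : M.IsSampleEigen lam u)
    (hdet : (M.limitPencil R 1 0 z.1).det ≠ 0) {j : ℕ} (hj : j + 2 < M.total) :
    ∃ x : ℝ, Tendsto (fun i => Real.cos (angleToSubspace
      (u (p i) (q i).1 ⟨j, by have := hr i; omega⟩) (M.commonSpace (p i)))) 𝒰 (𝓝 x) ∧
      0 ≤ x ∧ (x ≠ 0 ↔ j < m) := by
  have h := gramLimit h2 hβ hb hp hdev hz
  have hrank := finrank_ker_classSum (size_pos hM)
  obtain ⟨-, h3⟩ := (scatterLimit_scaledTrain hM h hτ hr hu).signal_limit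
    (eq_zero_of_inner_center_eq_zero hdet) (fun i => ub (p i))
    (fun a r => h.center_basis (size_pos hM) a r)
  obtain ⟨x, hx, hxm⟩ := h3 ⟨j, by rw [hrank]; rw [total] at hj; omega⟩
  refine ⟨Real.sqrt x, ((Real.continuous_sqrt.tendsto x).comp hx).congr' ?_,
    Real.sqrt_nonneg _, ?_⟩
  · filter_upwards [hp.eventually hb.orth, hp.eventually hb.span] with i hi hs
    rw [cos_angleToSubspace, ← hs, OrthonormalBasis.norm_eq_one, div_one,
      ← Real.sqrt_sq (norm_nonneg _), norm_starProjection_sq hi]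
    simp only [Function.comp, Fin.castLE_mk, real_inner_comm]
  · have hx0 : 0 ≤ x := ge_of_tendsto hx (Eventually.of_forall fun i =>
      Finset.sum_nonneg fun _ _ => sq_nonneg _)
    rw [← hxm, ne_eq, ne_eq, Real.sqrt_eq_zero hx0]

end Limits

end TwoClassModel

/-! ### The ridge rule along a convergent sequence of samples -/

/-- The coefficient of the limiting scatter matrix in the pencil of the ridge parameter `α`. -/
def pencilCoeff (α : EReal) : ℝ := if α = ⊤ ∨ α = ⊥ then 0 else 1

/-- The shift in the pencil of the ridge parameter `α`. -/
def pencilShift (τ : ℝ) (α : EReal) : ℝ := if α = ⊤ ∨ α = ⊥ then 1 else α.toReal + τ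

theorem pencilShift_eq_zero_iff {τ : ℝ} {α : EReal} :
    pencilShift τ α = 0 ↔ α = ((-τ : ℝ) : EReal) := by
  induction α with
  | bot =>
    simp only [pencilShift, or_true, if_true, one_ne_zero, false_iff]
    exact EReal.bot_ne_coe _
  | top =>
    simp only [pencilShift, true_or, if_true, one_ne_zero, false_iff]
    exact EReal.top_ne_coe _
  | coe x =>
    simp only [pencilShift, EReal.coe_ne_top, EReal.coe_ne_bot, or_self, if_false,
      EReal.toReal_coe, EReal.coe_eq_coe_iff]
    exact add_eq_zero_iff_eq_neg

theorem pencilCoeff_ne_zero_or (τ : ℝ) (α : EReal) :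
    pencilCoeff α ≠ 0 ∨ pencilShift τ α ≠ 0 := by
  by_cases h : α = ⊤ ∨ α = ⊥ <;> simp [pencilCoeff, pencilShift, h]

/-- For finite `α` the pencil coefficients are `1` and `α + τ`, so the denominator is `x + α` and
the limit is `α / (x + α)`; for infinite `α` they are `0` and `1` and the limit is `1`. -/
theorem tendsto_ridgeWeight {ι : Type*} {l : Filter ι} {p : ι → ℕ} (hp : Tendsto p l atTop)
    (α : EReal) (τ : ℝ) {f : ι → ℝ} {x : ℝ} (hf : Tendsto f l (𝓝 x))
    (hx : pencilCoeff α * (x - τ) + pencilShift τ α ≠ 0) :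
    Tendsto (fun i => ridgeWeight α (p i) (p i * f i)) l
      (𝓝 (1 - pencilCoeff α * x / (pencilCoeff α * (x - τ) + pencilShift τ α))) := by
  by_cases h : α = ⊤ ∨ α = ⊥
  · simp only [ridgeWeight, pencilCoeff, pencilShift, h, if_true]
    simp only [zero_mul, zero_div, sub_zero]
    exact tendsto_const_nhds
  · simp only [ridgeWeight, pencilCoeff, pencilShift, h, if_false] at hx ⊢
    have hx' : x + α.toReal ≠ 0 := by
      intro h0; apply hx; linarith
    have h1 : 1 - 1 * x / (1 * (x - τ) + (α.toReal + τ)) = α.toReal / (x + α.toReal) := by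
      rw [show 1 * (x - τ) + (α.toReal + τ) = x + α.toReal by ring]
      field_simp
      ring
    rw [h1]
    refine (tendsto_const_nhds.div (hf.add_const α.toReal) hx').congr' ?_
    filter_upwards [hp.eventually_gt_atTop 0] with i hi
    have hi' : (p i : ℝ) ≠ 0 := by exact_mod_cast hi.ne'
    rw [Pi.div_apply, mul_comm (p i : ℝ), ← add_mul, mul_div_mul_right _ _ hi']

namespace TwoClassModel

variable {M : TwoClassModel}

section Limits

variable {ι : Type*} {𝒰 : Ultrafilter ι} {p : ι → ℕ} {m : ℕ} {ub : (p : ℕ) → Fin m → E p}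
  {R : (k : Fin 2) → Matrix (Fin m) (Fin (M.spikes k)) ℝ} {Mu : E m} {κ τ : ℝ} {k₀ : Fin 2}
  {q : (i : ι) → M.Sample (p i) × E (p i)} {z : M.LimitSample × (Fin (M.spikes k₀) → ℝ)}
  {lam : (p : ℕ) → M.Sample p → Fin p → ℝ}
  {u : (p : ℕ) → M.Sample p → OrthonormalBasis (Fin p) ℝ (E p)}

open Classical in
theorem inner_ridgeVec (α : EReal) (p : ℕ) (x : M.Sample p) (w : E p) :
    ⟪M.ridgeVec lam u α p x, w⟫ =
      ∑ j ∈ Finset.univ.filter (fun j : Fin p => (j : ℕ) ∈ M.signalIndex u),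
        ridgeWeight α p (lam p x j) * ⟪u p x j, sampleDiff x⟫ * ⟪u p x j, w⟫ +
      ∑ j ∈ Finset.univ.filter (fun j : Fin p => M.total ≤ (j : ℕ) + 2),
        ⟪u p x j, sampleDiff x⟫ * ⟪u p x j, w⟫ := by
  simp only [ridgeVec, inner_add_left, sum_inner, real_inner_smul_left]

theorem statistic_tendsto (hM : M.Setting) (h2 : M.SpikedEigenvalues) (hβ : ∀ k, M.beta k = 1)
    (hb : M.BasisLimit ub R Mu κ) (hp : Tendsto p 𝒰 atTop)
    (hdev : Tendsto (fun i => M.dev k₀ τ ub (p i) (q i)) 𝒰 (𝓝 0))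
    (hz : Tendsto (fun i => M.pairScores k₀ (p i) (q i)) 𝒰 (𝓝 z)) (hτ : 0 < τ)
    (hr : ∀ i, M.total ≤ p i) (hu : M.IsSampleEigen lam u)
    (hdet : (M.limitPencil R 1 0 z.1).det ≠ 0) (hsig : M.signalIndex u = {j | j < m})
    (α : EReal) (hdet' : (M.limitPencil R (pencilCoeff α) (pencilShift τ α) z.1).det ≠ 0) :
    ∃ y, Tendsto (fun i => ⟪M.ridgeVec lam u α (p i) (q i).1, (q i).2 - totalMean (q i).1⟫ / p i)
        𝒰 (𝓝 y) ∧
      M.limitStat R Mu κ (pencilCoeff α) (pencilShift τ α) k₀ z =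
        (M.limitPencil R (pencilCoeff α) (pencilShift τ α) z.1).det ^ 2 * y := by
  have hn := size_pos hM
  have h := gramLimit h2 hβ hb hp hdev hz
  obtain ⟨e, he, hstat⟩ := exists_pencil_solution (Mu := Mu) (κ := κ) (k₀ := k₀) hdet'
  refine ⟨_, ?_, hstat⟩
  have h0 : (M.size 0 : ℝ) ≠ 0 := by exact_mod_cast (hn 0).ne'
  have h1 : (M.size 1 : ℝ) ≠ 0 := by exact_mod_cast (hn 1).ne'
  have hω : (M.size 0 : ℝ) / M.total * (M.size 0 : ℝ)⁻¹ =
      (M.size 1 : ℝ) / M.total * (M.size 1 : ℝ)⁻¹ := by field_simp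
  have key := (scatterLimit_scaledTrain hM h hτ hr hu).statistic_limit
    (eq_zero_of_inner_center_eq_zero hdet) (pencilCoeff α) (pencilShift τ α)
    (fun v hv => limitPencil_injective hdet' v hv)
    (fun i x => ridgeWeight α (p i) (p i * x))
    (fun f x hf _ hx => tendsto_ridgeWeight hp α τ hf hx)
    (fun i => (Real.sqrt (p i))⁻¹ • sampleDiff (q i).1)
    (fun i => (Real.sqrt (p i))⁻¹ • ((q i).2 - totalMean (q i).1))
    (M.limitDiff R Mu z.1) (M.limitTest R Mu k₀ z) e _
    (fun a => by
      simp only [smul_sampleDiff hM]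
      exact h.center_diff hn a)
    (fun a => by
      simp only [smul_sub_totalMean hM k₀]
      exact h.center_test hn _ _ _ a)
    (by
      simp only [smul_sampleDiff hM, smul_sub_totalMean hM k₀]
      exact h.diff_test hn _ _ _ hω) he
  -- The limit of the full inner product is `⟪D, W⟫` plus the contribution `meanCoeff * κ` of the
  -- part of the mean difference outside the common space; the general formula subtracts `⟪D, W⟫`
  -- again.
  have hlim : ∀ x y c : ℝ, x + c - x + y = c + y := fun x y c => by ring
  have hcomm : ⟪M.limitDiff R Mu z.1, M.limitTest R Mu k₀ z⟫ =
    ⟪Mu + (classAvg (M.limitTrain R z.1) 0 - classAvg (M.limitTrain R z.1) 1),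
      M.limitLead R k₀ z.2 + M.meanCoeff k₀ • Mu -
        (((M.size 0 : ℝ) / M.total) • classAvg (M.limitTrain R z.1) 0 +
          ((M.size 1 : ℝ) / M.total) • classAvg (M.limitTrain R z.1) 1)⟫ := rfl
  rw [hcomm, hlim] at key
  refine key.congr' ?_
  filter_upwards [hp.eventually_gt_atTop 0] with i hi
  have hi' : (p i : ℝ) ≠ 0 := by exact_mod_cast hi.ne'
  have hrank := finrank_ker_classSum hn
  have htot : M.total = M.size 0 + M.size 1 := rfl
  have hpos := total_pos hM
  have hin : ∀ (v a b : E (p i)), ⟪v, (Real.sqrt (p i))⁻¹ • a⟫ * ⟪v, (Real.sqrt (p i))⁻¹ • b⟫ =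
      ⟪v, a⟫ * ⟪v, b⟫ / p i := by
    intro v a b
    rw [real_inner_smul_right, real_inner_smul_right, mul_mul_mul_comm, ← mul_inv,
      Real.mul_self_sqrt (Nat.cast_nonneg _), inv_mul_eq_div]
  rw [inner_ridgeVec, add_div, Finset.sum_div, Finset.sum_div]
  refine congrArg₂ _ (Finset.sum_congr ?_ fun j _ => ?_) (Finset.sum_congr ?_ fun j _ => ?_)
  · ext j
    simp [hsig]
  · rw [mul_assoc, hin, mul_inv_cancel_left₀ hi', ← mul_div_assoc, ← mul_assoc]
  -- In zero-based indexing the unweighted eigenvectors start at `n - 2`, the dimension of the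
  -- coefficient space; positive class sizes make the truncated subtraction harmless.
  · ext j
    have : 1 ≤ M.size 0 := hn 0
    have : 1 ≤ M.size 1 := hn 1
    simp only [Finset.mem_filter, Finset.mem_univ, true_and, hrank]
    omega
  · exact hin _ _ _

/-- A nonzero limit fixes the sign of the statistic, and `limitStat` at the actual scores has the
same sign by continuity. Normalization is harmless: a negative inner product already forces the
vector to be nonzero. -/
theorem ridgeRule_eventually (hM : M.Setting) (h2 : M.SpikedEigenvalues)
    (hβ : ∀ k, M.beta k = 1)
    (hb : M.BasisLimit ub R Mu κ) (hp : Tendsto p 𝒰 atTop)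
    (hdev : Tendsto (fun i => M.dev k₀ τ ub (p i) (q i)) 𝒰 (𝓝 0))
    (hz : Tendsto (fun i => M.pairScores k₀ (p i) (q i)) 𝒰 (𝓝 z)) (hτ : 0 < τ)
    (hr : ∀ i, M.total ≤ p i) (hu : M.IsSampleEigen lam u)
    (hdet : (M.limitPencil R 1 0 z.1).det ≠ 0) (hsig : M.signalIndex u = {j | j < m})
    (α : EReal)
    (hstat : M.limitStat R Mu κ (pencilCoeff α) (pencilShift τ α) k₀ z ≠ 0) :
    ∀ᶠ i in (𝒰 : Filter ι), (M.ridgeRule lam u α (p i) (q i).1 (q i).2 = 0 ↔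
      0 < M.limitStat R Mu κ (pencilCoeff α) (pencilShift τ α) k₀
        (M.pairScores k₀ (p i) (q i))) := by
  have hdet' : (M.limitPencil R (pencilCoeff α) (pencilShift τ α) z.1).det ≠ 0 := by
    intro h0
    rw [limitStat, h0, zero_mul] at hstat
    exact hstat rfl
  obtain ⟨y, hy, hyz⟩ := statistic_tendsto hM h2 hβ hb hp hdev hz hτ hr hu hdet hsig α hdet'
  have hs := ((analyticAt_limitStat (R := R) Mu κ (pencilCoeff α) (pencilShift τ α) k₀
    z).continuousAt.tendsto).comp hz
  have hrule : ∀ i, M.ridgeRule lam u α (p i) (q i).1 (q i).2 = 0 ↔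
      0 ≤ ‖M.ridgeVec lam u α (p i) (q i).1‖⁻¹ *
        ⟪M.ridgeVec lam u α (p i) (q i).1, (q i).2 - totalMean (q i).1⟫ := by
    intro i
    rw [ridgeRule, unitRidgeVec, real_inner_smul_left]
    split_ifs with h <;> simp [h]
  have hD := pow_pos (abs_pos.2 hdet') 2
  rw [sq_abs] at hD
  rcases hstat.lt_or_gt with hneg | hpos
  · have hy0 : y < 0 := by
      by_contra hc
      exact absurd hneg (not_lt.2 (hyz ▸ mul_nonneg hD.le (not_lt.1 hc)))
    filter_upwards [hy.eventually_lt_const hy0, hs.eventually_lt_const hneg] with i hi hi'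
    refine iff_of_false ?_ (not_lt.2 hi'.le)
    rw [hrule, not_le]
    have h3 : ⟪M.ridgeVec lam u α (p i) (q i).1, (q i).2 - totalMean (q i).1⟫ < 0 := by
      by_contra hc
      exact absurd hi (not_lt.2 (div_nonneg (not_lt.1 hc) (Nat.cast_nonneg _)))
    have h4 : M.ridgeVec lam u α (p i) (q i).1 ≠ 0 := by
      intro h0
      rw [h0, inner_zero_left] at h3
      exact lt_irrefl _ h3
    exact mul_neg_of_pos_of_neg (inv_pos.2 (norm_pos_iff.2 h4)) h3
  · have hy0 : 0 < y := by
      by_contra hc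
      exact absurd hpos (not_lt.2 (hyz ▸ mul_nonpos_of_nonneg_of_nonpos hD.le (not_lt.1 hc)))
    filter_upwards [hy.eventually_const_lt hy0, hs.eventually_const_lt hpos] with i hi hi'
    refine iff_of_true ?_ hi'
    rw [hrule]
    have h3 : 0 ≤ ⟪M.ridgeVec lam u α (p i) (q i).1, (q i).2 - totalMean (q i).1⟫ := by
      by_contra hc
      exact absurd hi (not_lt.2 (div_nonpos_of_nonpos_of_nonneg (not_le.1 hc).le
        (Nat.cast_nonneg _)))
    exact mul_nonneg (inv_nonneg.2 (norm_nonneg _)) h3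

end Limits

/-! ### From convergent sequences to probabilities -/

section Transfer

variable {m : ℕ} {ub : (p : ℕ) → Fin m → E p} {k₀ : Fin 2} {τ : ℝ}

theorem leadScores_comp (k : Fin 2) {p : ℕ} (hp : M.spikes k ≤ p) :
    M.leadScores k p = (fun y (i : Fin (M.spikes k)) => y (Fin.castLE hp i)) ∘ M.scores k p := by
  ext x i
  rw [leadScores, dif_pos (i.2.trans_le hp)]
  rfl

theorem measurePreserving_leadScores (h3 : M.MixingScores) (k : Fin 2) {p : ℕ}
    (hp : M.spikes k ≤ p) : MeasurePreserving (M.leadScores k p) (M.law k p) (M.leadLaw k) := by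
  have hm : Measurable fun (y : Fin p → ℝ) (i : Fin (M.spikes k)) => y (Fin.castLE hp i) := by
    fun_prop
  rw [leadScores_comp k hp]
  refine ⟨hm.comp (measurable_scores k p), ?_⟩
  rw [← Measure.map_map hm (measurable_scores k p), h3.scores_law, Measure.map_map hm
    (by fun_prop), leadLaw]
  rfl

theorem measurePreserving_pairScores (hM : M.Setting) (h3 : M.MixingScores) (k₀ : Fin 2) {p : ℕ}
    (hp : ∀ k, M.spikes k ≤ p) :
    MeasurePreserving (M.pairScores k₀ p) (M.pairLaw k₀ p) (M.limitLaw k₀) := by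
  have := fun k => hM.isProb k p
  have := isProbabilityMeasure_leadLaw h3
  have := isProbabilityMeasure_limitTrainLaw h3
  have := isProbabilityMeasure_trainLaw hM p
  have h4 : MeasurePreserving (sampleScores (M := M) (p := p)) (M.trainLaw p)
      M.limitTrainLaw :=
    measurePreserving_pi _ _ fun k => measurePreserving_pi _ _ fun _ =>
      measurePreserving_leadScores h3 k (hp k)
  exact h4.prod (measurePreserving_leadScores h3 k₀ (hp k₀))

/-- If every `n` failed there would be a counterexample for each `n`, with deviation below `1 / (n +
1)` and scores in `K`. Along an ultrafilter the scores converge in `K`, contradicting `hP`. The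
first argument of `P` lets the property itself weaken with `n`. -/
theorem exists_uniform {K : Set (M.LimitSample × (Fin (M.spikes k₀) → ℝ))} (hK : IsCompact K)
    (P : ℕ → (p : ℕ) → M.Sample p × E p → Prop)
    (hP : ∀ (𝒰 : Ultrafilter ℕ) (p : ℕ → ℕ) (q : (i : ℕ) → M.Sample (p i) × E (p i)),
      ∀ z ∈ K, (𝒰 : Filter ℕ) ≤ atTop → Tendsto p 𝒰 atTop → (∀ i, M.total ≤ p i) →
      Tendsto (fun i => M.dev k₀ τ ub (p i) (q i)) 𝒰 (𝓝 0) →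
      Tendsto (fun i => M.pairScores k₀ (p i) (q i)) 𝒰 (𝓝 z) →
      ∀ᶠ i in (𝒰 : Filter ℕ), P i (p i) (q i)) :
    ∃ n : ℕ, ∀ p, n + M.total ≤ p → ∀ q, M.dev k₀ τ ub p q < 1 / (n + 1) →
      M.pairScores k₀ p q ∈ K → P n p q := by
  by_contra! hc
  choose p hp q hq hqK hqP using hc
  let 𝒰 := Ultrafilter.of (atTop : Filter ℕ)
  have h𝒰 : (𝒰 : Filter ℕ) ≤ atTop := Ultrafilter.of_le _
  obtain ⟨z, hzK, hz⟩ := hK.ultrafilter_le_nhds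
    (𝒰.map fun i => M.pairScores k₀ (p i) (q i)) (by
      rw [le_principal_iff, Ultrafilter.coe_map]
      exact Filter.mem_map.2 (Filter.univ_mem' hqK))
  have hev := hP 𝒰 p q z hzK h𝒰
    (tendsto_atTop_mono (fun i => (Nat.le_add_right _ _).trans (hp i)) (tendsto_id.mono_left h𝒰))
    (fun i => (Nat.le_add_left _ _).trans (hp i))
    (squeeze_zero (fun i => Finset.sum_nonneg fun _ _ => abs_nonneg _) (fun i => (hq i).le)
      (tendsto_one_div_add_atTop_nhds_zero_nat.mono_left h𝒰)) hz
  obtain ⟨i, hi⟩ := hev.exists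
  exact hqP i hi

/-- Inner regularity gives a compact `K ⊆ G` missing mass less than `ε / 2`. The scores of a sample
have exactly the limiting law once `p` exceeds the spike numbers, so they leave `K` with probability
at most `ε / 2`; the noise deviation costs the other half. -/
theorem exists_eventually_pairLaw_le (hM : M.Setting) (h1 : M.MeanSeparation)
    (h2 : M.SpikedEigenvalues) (h3 : M.MixingScores) (hτ : ∀ k, M.tauSq k = τ)
    (hub : ∀ᶠ p in atTop, Orthonormal ℝ (ub p))
    {G : Set (M.LimitSample × (Fin (M.spikes k₀) → ℝ))} (hG : IsOpen G)
    (hG0 : M.limitLaw k₀ Gᶜ = 0)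
    (P : ℕ → (p : ℕ) → M.Sample p × E p → Prop)
    (hP : ∀ (𝒰 : Ultrafilter ℕ) (p : ℕ → ℕ) (q : (i : ℕ) → M.Sample (p i) × E (p i)),
      ∀ z ∈ G, (𝒰 : Filter ℕ) ≤ atTop → Tendsto p 𝒰 atTop → (∀ i, M.total ≤ p i) →
      Tendsto (fun i => M.dev k₀ τ ub (p i) (q i)) 𝒰 (𝓝 0) →
      Tendsto (fun i => M.pairScores k₀ (p i) (q i)) 𝒰 (𝓝 z) →
      ∀ᶠ i in (𝒰 : Filter ℕ), P i (p i) (q i)) {ε : ℝ≥0∞} (hε : ε ≠ 0) :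
    ∃ n, ∀ᶠ p in atTop, M.pairLaw k₀ p {q | ¬ P n p q} ≤ ε := by
  have := isProbabilityMeasure_limitLaw h3 k₀
  obtain ⟨K, hKG, hK, hKε⟩ := hG.measurableSet.exists_isCompact_sdiff_lt
    (measure_ne_top (M.limitLaw k₀) G) (ENNReal.half_pos hε).ne'
  obtain ⟨n, hn⟩ := exists_uniform hK P fun 𝒰 p q z hz => hP 𝒰 p q z (hKG hz)
  refine ⟨n, ?_⟩
  have hpos : (0 : ℝ) < 1 / (n + 1) := by positivity
  have hdev := dev_tendsto hM h1 h2 h3 k₀ hτ ub hub hpos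
  filter_upwards [eventually_ge_atTop (n + M.total),
    eventually_ge_atTop (M.spikes 0 + M.spikes 1),
    hdev.eventually_le_const (ENNReal.half_pos hε)] with p hp hp' hd
  have hKc : M.limitLaw k₀ Kᶜ ≤ ε / 2 := by
    calc M.limitLaw k₀ Kᶜ ≤ M.limitLaw k₀ (Gᶜ ∪ G \ K) :=
          measure_mono fun x hx => by
            by_cases hxG : x ∈ G
            · exact Or.inr ⟨hxG, hx⟩
            · exact Or.inl hxG
      _ ≤ M.limitLaw k₀ Gᶜ + M.limitLaw k₀ (G \ K) := measure_union_le _ _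
      _ ≤ ε / 2 := by rw [hG0, zero_add]; exact hKε.le
  rw [← (measurePreserving_pairScores hM h3 k₀ (p := p)
    (Fin.forall_fin_two.2 ⟨by omega, by omega⟩)).measure_preimage
    hK.measurableSet.compl.nullMeasurableSet] at hKc
  calc M.pairLaw k₀ p {q | ¬ P n p q}
      ≤ M.pairLaw k₀ p ({q | 1 / ((n : ℝ) + 1) ≤ M.dev k₀ τ ub p q} ∪
          M.pairScores k₀ p ⁻¹' Kᶜ) := measure_mono fun q hq => by
        by_contra hc
        simp only [Set.mem_union, not_or, Set.mem_ofPred_eq, not_le, Set.mem_preimage,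
          Set.mem_compl_iff, not_not] at hc
        exact hq (hn p hp q hc.1 hc.2)
    _ ≤ ε / 2 + ε / 2 := (measure_union_le _ _).trans (add_le_add hd hKc)
    _ = ε := ENNReal.add_halves ε

end Transfer

end TwoClassModel

/-! ### The signal set, the classification rates and their limits -/

namespace TwoClassModel

variable {M : TwoClassModel} {m : ℕ} {ub : (p : ℕ) → Fin m → E p}
  {R : (k : Fin 2) → Matrix (Fin m) (Fin (M.spikes k)) ℝ} {Mu : E m} {κ τ : ℝ}
  {lam : (p : ℕ) → M.Sample p → Fin p → ℝ}
  {u : (p : ℕ) → M.Sample p → OrthonormalBasis (Fin p) ℝ (E p)}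

theorem exists_basisLimit (h1 : M.MeanSeparation) {θ : Fin m → ℝ} {φ : ℝ}
    (hub : ∀ᶠ p in atTop, Orthonormal ℝ (ub p) ∧
      Submodule.span ℝ (Set.range (ub p)) = M.commonSpace p)
    (hθ : ∀ i, Tendsto (fun p => InnerProductGeometry.angle (ub p i) (M.meanDiff p)) atTop
      (𝓝 (θ i)))
    (hR : ∀ k i j, Tendsto (fun p => ⟪ub p i, M.leadVec k p j⟫) atTop (𝓝 (R k i j)))
    (hφ : Tendsto (fun p => angleToSubspace (M.meanDiff p) (M.commonSpace p)) atTop (𝓝 φ))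
    (hφ0 : φ ≠ 0) : ∃ Mu κ, 0 < κ ∧ M.BasisLimit ub R Mu κ := by
  obtain ⟨δ, hδ, hδlim⟩ := h1
  let Mu : E m := WithLp.toLp 2 fun r => δ * Real.cos (θ r)
  have hmean : ∀ r, Tendsto (fun p => ⟪ub p r, M.scaledDiff p⟫) atTop (𝓝 (Mu r)) := by
    intro r
    refine (hδlim.mul ((Real.continuous_cos.tendsto _).comp (hθ r))).congr' ?_
    filter_upwards [hub] with p hp
    rw [scaledDiff, real_inner_smul_right, ← InnerProductGeometry.cos_angle_mul_norm_mul_norm,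
      hp.1.1, one_mul, Function.comp]
    ring
  have hsq : ∀ p : ℕ, (‖M.meanDiff p‖ / Real.sqrt p) ^ 2 = ‖M.scaledDiff p‖ ^ 2 := by
    intro p
    rw [scaledDiff, norm_smul, norm_inv, Real.norm_of_nonneg (Real.sqrt_nonneg _), inv_mul_eq_div]
  have hcos := (Real.continuous_cos.tendsto _).comp hφ
  have hMu : ⟪Mu, Mu⟫ = (Real.cos φ * δ) ^ 2 := by
    have h3 : Tendsto (fun p => ∑ r, ⟪ub p r, M.scaledDiff p⟫ ^ 2) atTop (𝓝 (∑ r, Mu r ^ 2)) :=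
      tendsto_finsetSum _ fun r _ => (hmean r).pow 2
    rw [real_inner_self_eq_norm_sq, EuclideanSpace.norm_sq_eq]
    simp only [Real.norm_eq_abs, sq_abs]
    refine tendsto_nhds_unique h3 (((hcos.mul hδlim).pow 2).congr' ?_)
    filter_upwards [hub] with p hp
    rw [← norm_starProjection_sq hp.1, hp.2, Function.comp, cos_angleToSubspace, scaledDiff,
      map_smul, norm_smul, norm_inv, Real.norm_of_nonneg (Real.sqrt_nonneg _)]
    by_cases h0 : ‖M.meanDiff p‖ = 0
    · rw [norm_eq_zero.1 h0]; simp
    · field_simp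
  have hφmem : φ ∈ Set.Icc 0 Real.pi :=
    isClosed_Icc.mem_of_tendsto hφ (Eventually.of_forall fun p =>
      ⟨InnerProductGeometry.angle_nonneg _ _, InnerProductGeometry.angle_le_pi _ _⟩)
  have hcos0 : 0 ≤ Real.cos φ := ge_of_tendsto hcos (Eventually.of_forall fun p => by
    rw [Function.comp, cos_angleToSubspace]
    positivity)
  have hcos1 : Real.cos φ < 1 := by
    rw [← Real.cos_zero]
    exact Real.strictAntiOn_cos ⟨le_rfl, Real.pi_pos.le⟩ hφmem (hφmem.1.lt_of_ne' hφ0)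
  -- The projection onto the common space has limiting length `δ cos φ`, so `κ = δ² (1 - cos² φ)`.
  -- It is positive since `0 ≤ cos φ < 1`, where `φ ≠ 0` is used.
  refine ⟨Mu, δ ^ 2 - ⟪Mu, Mu⟫, ?_, ?_⟩
  · rw [hMu, mul_pow, sub_pos]
    exact mul_lt_of_lt_one_left (by positivity) (by nlinarith)
  · refine ⟨hub.mono fun _ h => h.1, hub.mono fun _ h => h.2, hR, hmean, ?_⟩
    rw [add_sub_cancel]
    simp only [real_inner_self_eq_norm_sq, ← hsq]
    exact hδlim.pow 2

variable (R) in
/-- The scores for which the limiting scatter matrix is invertible. -/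
def regularSet (k₀ : Fin 2) : Set (M.LimitSample × (Fin (M.spikes k₀) → ℝ)) :=
  {z | (M.limitPencil R 1 0 z.1).det ≠ 0}

theorem isOpen_regularSet (k₀ : Fin 2) : IsOpen (regularSet R k₀) :=
  isOpen_ne_fun ((continuous_iff_continuousAt.2 fun x =>
    (analyticAt_det_limitPencil 1 0 x).continuousAt).comp continuous_fst) continuous_const

theorem limitLaw_compl_regularSet (hM : M.Setting) (h2 : M.SpikedEigenvalues)
    (h3 : M.MixingScores) (hf : M.FullSupportScores)
    (hrank : (Matrix.fromCols (R 0) (R 1)).rank = m) (k₀ : Fin 2) :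
    M.limitLaw k₀ (regularSet R k₀)ᶜ = 0 := by
  obtain ⟨x, hx⟩ := exists_det_limitScatter_ne_zero (a := 1) hM h2 hrank one_ne_zero
  have h4 := analyticNull_limitLaw h3 hf k₀
    (fun z => (M.limitPencil R 1 0 z.1).det)
    (fun z => AnalyticAt.fun_comp (g := fun x => (M.limitPencil R 1 0 x).det)
      (analyticAt_det_limitPencil 1 0 z.1) analyticAt_fst) ⟨(x, 0), hx⟩
  convert h4 using 2
  ext z
  simp [regularSet]

theorem limitLaw_limitStat_eq_zero (hM : M.Setting) (h2 : M.SpikedEigenvalues)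
    (h3 : M.MixingScores) (hf : M.FullSupportScores) (hR : ∀ k, (R k).transpose * R k = 1)
    (hrank : (Matrix.fromCols (R 0) (R 1)).rank = m) (hκ : 0 < κ) (α : EReal) (k₀ : Fin 2) :
    M.limitLaw k₀ {z | M.limitStat R Mu κ (pencilCoeff α) (pencilShift τ α) k₀ z = 0} = 0 :=
  analyticNull_limitLaw h3 hf k₀ _ (fun z => analyticAt_limitStat _ _ _ _ _ z)
    (exists_limitStat_ne_zero hM h2 hR hrank Mu hκ.ne' (pencilCoeff_ne_zero_or τ α) k₀)

theorem le_spikes_of_rank_eq (hrank : (Matrix.fromCols (R 0) (R 1)).rank = m) :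
    m ≤ M.spikes 0 + M.spikes 1 := by
  have h := (Matrix.fromCols (R 0) (R 1)).rank_le_card_width
  simpa [hrank] using h

/-- The product formula for rectangles holds for arbitrary sets. This matters because the sample
eigenvectors are not assumed to depend measurably on the sample. -/
theorem trainLaw_eq_pairLaw (hM : M.Setting) (k₀ : Fin 2) (p : ℕ) (A : Set (M.Sample p)) :
    M.trainLaw p A = M.pairLaw k₀ p (Prod.fst ⁻¹' A) := by
  have := hM.isProb k₀ p
  have := isProbabilityMeasure_trainLaw hM p
  rw [← Set.prod_univ, pairLaw, Measure.prod_prod, measure_univ, mul_one]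

theorem signalIndex_eq (hM : M.Setting) (h1 : M.MeanSeparation) (h2 : M.SpikedEigenvalues)
    (h3 : M.MixingScores) (hf : M.FullSupportScores) (hβ : ∀ k, M.beta k = 1)
    (hτ : ∀ k, M.tauSq k = τ) (hb : M.BasisLimit ub R Mu κ)
    (hrank : (Matrix.fromCols (R 0) (R 1)).rank = m) (hu : M.IsSampleEigen lam u) :
    M.signalIndex u = {j | j < m} := by
  have hτ0 : 0 < τ := hτ 0 ▸ h2.tauSq_pos 0
  have hopen := isOpen_regularSet (R := R) 0
  have hnull := limitLaw_compl_regularSet hM h2 h3 hf hrank 0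
  ext j
  constructor
  · rintro ⟨hj, ε, hε, hlim⟩
    by_contra hjm
    refine hlim (ENNReal.tendsto_nhds_zero.2 fun η hη => ?_)
    obtain ⟨n, hn⟩ := exists_eventually_pairLaw_le hM h1 h2 h3 hτ hb.orth hopen hnull
      (fun _ p q => ¬ ∃ h : j < p,
        ε < Real.cos (angleToSubspace (u p q.1 ⟨j, h⟩) (M.commonSpace p)))
      (fun 𝒰 p q z hz _ hp hr hdev hsc => by
        obtain ⟨x, hx, -, hxm⟩ := cos_limit hM h2 hβ hb hp hdev hsc hτ0 hr hu hz hj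
        have hx0 : x = 0 := not_not.1 fun h => hjm (hxm.1 h)
        filter_upwards [hx.eventually_le_const (hx0 ▸ hε)] with i hi
        rintro ⟨h, hlt⟩
        exact absurd hlt (not_lt.2 hi)) hη.ne'
    filter_upwards [hn] with p hp
    rw [trainLaw_eq_pairLaw hM 0]
    refine (measure_mono fun q hq => ?_).trans hp
    exact not_not.2 hq
  · intro hjm
    have hjm' : j < m := hjm
    -- From `m ≤ spikes 0 + spikes 1` and `spikes k + 1 ≤ size k`: all `m` signal directions are
    -- among the first `n - 2`.
    have hj : j + 2 < M.total := by
      have := le_spikes_of_rank_eq hrank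
      have := hM.size_gt 0
      have := hM.size_gt 1
      rw [total]
      omega
    -- The limiting cosine is positive but depends on the scores, so no fixed threshold works a
    -- priori. The threshold `1 / (n + 1)` eventually drops below each limit, and the lemma returns
    -- one `n` that works with probability at least one half.
    obtain ⟨n, hn⟩ := exists_eventually_pairLaw_le hM h1 h2 h3 hτ hb.orth hopen hnull
      (fun n p q => ∀ h : j < p,
        1 / ((n : ℝ) + 1) < Real.cos (angleToSubspace (u p q.1 ⟨j, h⟩) (M.commonSpace p)))
      (fun 𝒰 p q z hz h𝒰 hp hr hdev hsc => by
        obtain ⟨x, hx, hx0, hxm⟩ := cos_limit hM h2 hβ hb hp hdev hsc hτ0 hr hu hz hj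
        filter_upwards [(tendsto_one_div_add_atTop_nhds_zero_nat.mono_left h𝒰).eventually_lt hx
          (hx0.lt_of_ne' (hxm.2 hjm'))] with i hi h
        exact hi) (ε := 2⁻¹) (by simp)
    refine ⟨hj, 1 / ((n : ℝ) + 1), by positivity, fun hlim => ?_⟩
    obtain ⟨p, hp, hlt, hjp⟩ := (hn.and ((hlim.eventually_lt_const
      (show (0 : ℝ≥0∞) < 2⁻¹ by simp)).and (eventually_gt_atTop j))).exists
    have := isProbabilityMeasure_pairLaw hM 0 p
    rw [trainLaw_eq_pairLaw hM 0] at hlt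
    -- If the cosine tended to `0` in probability, the whole space would be covered by two events of
    -- outer measure at most `1/2` and less than `1/2`.
    have h5 : M.pairLaw 0 p Set.univ < 1 := by
      refine lt_of_le_of_lt ((measure_mono fun q _ => ?_).trans (measure_union_le _ _))
        ((ENNReal.add_lt_add_of_le_of_lt ?_ hp hlt).trans_eq ENNReal.inv_two_add_inv_two)
      · by_cases hc : 1 / ((n : ℝ) + 1) <
          Real.cos (angleToSubspace (u p q.1 ⟨j, hjp⟩) (M.commonSpace p))
        · exact Or.inr ⟨hjp, hc⟩
        · exact Or.inl fun h => hc (h hjp)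
      · exact (hp.trans_lt (by simp)).ne
    rw [measure_univ] at h5
    exact lt_irrefl _ h5

/-- Up to the event of disagreement, whose outer measure tends to `0`, the rule is the sign of
`limitStat` at the scores, and that sign has exactly the limiting probability for all large `p`.
Monotonicity and subadditivity suffice, so the event of the rule need not be measurable. -/
theorem pairLaw_ridgeRule_tendsto (hM : M.Setting) (h1 : M.MeanSeparation)
    (h2 : M.SpikedEigenvalues) (h3 : M.MixingScores) (hf : M.FullSupportScores)
    (hβ : ∀ k, M.beta k = 1) (hτ : ∀ k, M.tauSq k = τ) (hb : M.BasisLimit ub R Mu κ)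
    (hκ : 0 < κ) (hR : ∀ k, (R k).transpose * R k = 1)
    (hrank : (Matrix.fromCols (R 0) (R 1)).rank = m) (hu : M.IsSampleEigen lam u) (k : Fin 2)
    (α : EReal) :
    Tendsto (fun p => (M.pairLaw k p).real {q | M.ridgeRule lam u α p q.1 q.2 = k}) atTop
      (𝓝 ((M.limitLaw k).real {z |
        0 < M.limitStat R Mu κ (pencilCoeff α) (pencilShift τ α) k z ↔ k = 0})) := by
  have hτ0 : 0 < τ := hτ 0 ▸ h2.tauSq_pos 0
  set S := M.limitStat R Mu κ (pencilCoeff α) (pencilShift τ α) k with hS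
  have hScont : Continuous S := continuous_iff_continuousAt.2 fun z =>
    (analyticAt_limitStat _ _ _ _ _ z).continuousAt
  set D : (p : ℕ) → Set (M.Sample p × E p) := fun p => {q | ¬ (M.ridgeRule lam u α p q.1 q.2 = 0 ↔
    0 < S (M.pairScores k p q))} with hD
  have hsig := signalIndex_eq hM h1 h2 h3 hf hβ hτ hb hrank hu
  have hlim : Tendsto (fun p => (M.pairLaw k p).real (D p)) atTop (𝓝 0) := by
    rw [← ENNReal.toReal_zero]
    refine (ENNReal.tendsto_toReal ENNReal.zero_ne_top).comp
      (ENNReal.tendsto_nhds_zero.2 fun η hη => ?_)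
    obtain ⟨n, hn⟩ := exists_eventually_pairLaw_le hM h1 h2 h3 hτ hb.orth (k₀ := k)
      ((isOpen_regularSet (R := R) k).inter (isOpen_ne_fun hScont continuous_const))
      (by
        rw [Set.compl_inter]
        refine measure_union_null (limitLaw_compl_regularSet hM h2 h3 hf hrank k) ?_
        convert limitLaw_limitStat_eq_zero (Mu := Mu) (τ := τ) hM h2 h3 hf hR hrank hκ α k using 2
        ext z
        simp [hS])
      (fun _ p q => (M.ridgeRule lam u α p q.1 q.2 = 0 ↔ 0 < S (M.pairScores k p q)))
      (fun 𝒰 p q z hz _ hp hr hdev hsc =>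
        ridgeRule_eventually hM h2 hβ hb hp hdev hsc hτ0 hr hu hz.1 hsig α hz.2) hη.ne'
    exact hn
  have hB : MeasurableSet {z | 0 < S z ↔ k = 0} := by
    by_cases hk : k = 0
    · simpa only [hk, iff_true] using measurableSet_lt measurable_const hScont.measurable
    · simpa only [hk, iff_false, not_lt] using measurableSet_le hScont.measurable measurable_const
  have hrule : ∀ r : Fin 2, r = k ↔ (r = 0 ↔ k = 0) := fun r => by omega
  rw [tendsto_iff_dist_tendsto_zero]
  refine squeeze_zero' (Eventually.of_forall fun _ => dist_nonneg) ?_ hlim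
  filter_upwards [eventually_ge_atTop (M.spikes 0 + M.spikes 1)] with p hp
  have := isProbabilityMeasure_pairLaw hM k p
  rw [← (measurePreserving_pairScores hM h3 k (p := p)
    (Fin.forall_fin_two.2 ⟨by omega, by omega⟩)).measureReal_preimage hB.nullMeasurableSet,
    Real.dist_eq, abs_le]
  constructor
  · rw [neg_le_sub_iff_le_add']
    refine (measureReal_mono fun q hq => ?_).trans (measureReal_union_le _ _)
    simp only [Set.mem_union, Set.mem_ofPred_eq, Set.mem_preimage, hD, hrule (M.ridgeRule ..)]
      at hq ⊢
    tauto
  · rw [sub_le_iff_le_add']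
    refine (measureReal_mono fun q hq => ?_).trans (measureReal_union_le _ _)
    simp only [Set.mem_union, Set.mem_ofPred_eq, Set.mem_preimage, hD, hrule (M.ridgeRule ..)]
      at hq ⊢
    tauto

/-- Fixing the class is a measurable embedding, which makes the formula valid for all sets and not
only measurable ones. -/
theorem jointLaw_apply (hM : M.Setting) (p : ℕ) (A : Set (M.Sample p × (Fin 2 × E p))) :
    M.jointLaw p A = ∑ k, ENNReal.ofReal (M.prior k) *
      M.pairLaw k p {q | (q.1, (k, q.2)) ∈ A} := by
  have := fun k => hM.isProb k p
  have := isProbabilityMeasure_trainLaw hM p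
  have h1 : ∀ k, (M.trainLaw p).prod ((Measure.dirac k).prod (M.law k p)) =
      (M.pairLaw k p).map (Prod.map id (Prod.mk k)) := by
    intro k
    rw [Measure.dirac_prod, pairLaw, ← Measure.map_prod_map _ _ measurable_id
      measurable_prodMk_left, Measure.map_id]
  have h2 : ∀ k : Fin 2, MeasurableEmbedding
      (Prod.map id (Prod.mk k) : M.Sample p × E p → M.Sample p × (Fin 2 × E p)) := fun k =>
    MeasurableEmbedding.id.prodMap (measurableEmbedding_prodMk_left k)
  rw [jointLaw, testLaw, Fin.sum_univ_two, Measure.prod_add, Measure.prod_smul_right,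
    Measure.prod_smul_right, h1, h1, Measure.add_apply, Measure.smul_apply, Measure.smul_apply,
    (h2 0).map_apply, (h2 1).map_apply, Fin.sum_univ_two]
  rfl

theorem classRate_eq (hM : M.Setting) (k : Fin 2) (α : EReal) (p : ℕ) :
    M.classRate lam u k α p =
      (M.pairLaw k p).real {q | M.ridgeRule lam u α p q.1 q.2 = k} := by
  have := fun k => isProbabilityMeasure_pairLaw hM k p
  have hmeas : MeasurableSet {q : M.Sample p × (Fin 2 × E p) | q.2.1 = k} :=
    measurableSet_eq_fun (measurable_fst.comp measurable_snd) measurable_const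
  have hpos : ENNReal.ofReal (M.prior k) ≠ 0 := by simpa using hM.prior_pos k
  have h1 : ∀ A : Set (M.Sample p × (Fin 2 × E p)),
      M.jointLaw p ({q | q.2.1 = k} ∩ A) = ENNReal.ofReal (M.prior k) *
        M.pairLaw k p {q | (q.1, (k, q.2)) ∈ A} := by
    intro A
    rw [jointLaw_apply hM, Finset.sum_eq_single k]
    · simp
    · intro k' _ hk'
      simp [hk']
    · simp
  have h2 := h1 Set.univ
  simp only [Set.inter_univ, Set.mem_univ, Set.ofPred_true, measure_univ, mul_one] at h2
  rw [classRate, measureReal_def, cond_apply hmeas, h1, h2, ← mul_assoc,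
    ENNReal.inv_mul_cancel hpos ENNReal.ofReal_ne_top, one_mul]
  rfl

theorem rate_eq (hM : M.Setting) (α : EReal) (p : ℕ) :
    M.rate lam u α p = ∑ k, M.prior k * M.classRate lam u k α p := by
  have := fun k => isProbabilityMeasure_pairLaw hM k p
  simp only [classRate_eq hM]
  rw [rate, measureReal_def, jointLaw_apply hM, ENNReal.toReal_sum
    fun k _ => ENNReal.mul_ne_top ENNReal.ofReal_ne_top (measure_ne_top _ _)]
  refine Finset.sum_congr rfl fun k _ => ?_
  rw [ENNReal.toReal_mul, ENNReal.toReal_ofReal (hM.prior_pos k).le]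
  rfl

/-- With zero shift the random term disappears and `limitStat` is the squared determinant times
`meanCoeff * κ`; off the null set where it vanishes its sign is that of `meanCoeff`, positive for
the first class and negative for the second. -/
theorem limitLaw_correct_eq_one (hM : M.Setting) (h2 : M.SpikedEigenvalues)
    (h3 : M.MixingScores) (hf : M.FullSupportScores) (hR : ∀ k, (R k).transpose * R k = 1)
    (hrank : (Matrix.fromCols (R 0) (R 1)).rank = m) (hκ : 0 < κ) {α : EReal}
    (hα : pencilShift τ α = 0) (k : Fin 2) :
    (M.limitLaw k).real {z |
      0 < M.limitStat R Mu κ (pencilCoeff α) (pencilShift τ α) k z ↔ k = 0} = 1 := by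
  have := isProbabilityMeasure_limitLaw h3 k
  have h0 := limitLaw_limitStat_eq_zero (Mu := Mu) (τ := τ) hM h2 h3 hf hR hrank hκ α k
  have ht : (0 : ℝ) < M.total := by exact_mod_cast total_pos hM
  have hs : ∀ k, (0 : ℝ) < M.size k := fun k => by exact_mod_cast size_pos hM k
  rw [measureReal_def, ENNReal.toReal_eq_one_iff]
  refine le_antisymm prob_le_one ?_
  rw [← measure_univ (μ := M.limitLaw k), ← add_zero (M.limitLaw k {z | _ ↔ _}), ← h0]
  refine (measure_mono fun z _ => ?_).trans (measure_union_le _ _)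
  by_cases hz : M.limitStat R Mu κ (pencilCoeff α) (pencilShift τ α) k z = 0
  · exact Or.inr hz
  refine Or.inl ?_
  rw [Set.mem_ofPred_eq]
  rw [limitStat, hα, zero_mul, add_zero, ← mul_assoc] at hz ⊢
  have hpos := (mul_self_nonneg _).lt_of_ne' (left_ne_zero_of_mul hz)
  rw [mul_pos_iff_of_pos_left hpos, mul_pos_iff_of_pos_right hκ, meanCoeff]
  split_ifs with hk
  · simpa [hk] using div_pos (hs 1) ht
  · simpa [hk] using (div_pos (hs 0) ht).le

/-- With nonzero shift a negative value is attained for the first class; by continuity it persists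
on an open set, which the limiting law charges. -/
theorem limitLaw_correct_lt_one (hM : M.Setting) (h2 : M.SpikedEigenvalues)
    (h3 : M.MixingScores) (hf : M.FullSupportScores) (hR : ∀ k, (R k).transpose * R k = 1)
    {α : EReal} (hα : pencilShift τ α ≠ 0) :
    (M.limitLaw 0).real {z |
      0 < M.limitStat R Mu κ (pencilCoeff α) (pencilShift τ α) 0 z ↔ (0 : Fin 2) = 0} < 1 := by
  have := isProbabilityMeasure_limitLaw h3 0
  have := isOpenPosMeasure_limitLaw h3 hf 0
  have hcont : Continuous (M.limitStat R Mu κ (pencilCoeff α) (pencilShift τ α) 0) :=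
    continuous_iff_continuousAt.2 fun z => (analyticAt_limitStat _ _ _ _ _ z).continuousAt
  obtain ⟨z, hz⟩ := exists_limitStat_eq hM h2 hR Mu κ (pencilCoeff α) _ hα 0 (-1)
  have hneg : (0 : ℝ) < (M.limitLaw 0).real
      {z | M.limitStat R Mu κ (pencilCoeff α) (pencilShift τ α) 0 z < 0} := by
    refine ENNReal.toReal_pos ((isOpen_lt hcont continuous_const).measure_pos _ ⟨z, ?_⟩).ne'
      (measure_ne_top _ _)
    rw [Set.mem_ofPred_eq, hz, mul_neg_one, mul_neg, neg_lt_zero, ← sq]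
    positivity
  refine lt_of_lt_of_le (lt_add_of_pos_right _ hneg) ?_
  rw [← measureReal_union _ (isOpen_lt hcont continuous_const).measurableSet]
  · exact measureReal_le_one
  · rw [Set.disjoint_left]
    intro z hz hz'
    exact lt_asymm (hz.2 rfl) hz'

end TwoClassModel

end

end HDLSS

theorem mainTheorem5 (M : HDLSS.TwoClassModel)
    (hM : M.Setting) (h1 : M.MeanSeparation) (h2 : M.SpikedEigenvalues) (h3 : M.MixingScores)
    (h4 : M.LeadingAngles) (h5 : M.CommonBasis)
    -- strong spikes and equal tail eigenvalues
    (hβ : ∀ k, M.beta k = 1) (τsq : ℝ) (hτ : ∀ k, M.tauSq k = τsq)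
    -- the limiting angle between the mean difference and the common leading eigenspace
    (φ : ℝ) (hφ : Tendsto (fun p => HDLSS.angleToSubspace (M.meanDiff p) (M.commonSpace p))
      atTop (𝓝 φ)) (hφ0 : φ ≠ 0)
    (hf : M.FullSupportScores)
    (lam : (p : ℕ) → M.Sample p → Fin p → ℝ)
    (u : (p : ℕ) → M.Sample p → OrthonormalBasis (Fin p) ℝ (HDLSS.E p))
    (hu : M.IsSampleEigen lam u) :
    ∃ (Pk : Fin 2 → EReal → ℝ) (P : EReal → ℝ),
      (∀ k α, Tendsto (M.classRate lam u k α) atTop (𝓝 (Pk k α))) ∧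
      (∀ α, Tendsto (M.rate lam u α) atTop (𝓝 (P α))) ∧
      (∀ α, P α = ∑ k, M.prior k * Pk k α) ∧
      P ((-τsq : ℝ) : EReal) = 1 ∧
      ∀ α : EReal, α ≠ ((-τsq : ℝ) : EReal) → P α < P ((-τsq : ℝ) : EReal) := by
  obtain ⟨m, ub, θ, R, hub, hθ, hRlim, hR, hrank⟩ := h5
  obtain ⟨Mu, κ, hκ, hb⟩ := HDLSS.TwoClassModel.exists_basisLimit h1 hub (fun i => (hθ i).2)
    hRlim hφ hφ0
  have hlim := fun k α => (HDLSS.TwoClassModel.pairLaw_ridgeRule_tendsto hM h1 h2 h3 hf hβ hτ hb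
    hκ hR hrank hu k α).congr fun p =>
      (HDLSS.TwoClassModel.classRate_eq (lam := lam) (u := u) hM k α p).symm
  have hone : ∑ k, M.prior k * 1 = 1 := by
    simpa [Fin.sum_univ_two] using hM.prior_sum
  have hbest := HDLSS.TwoClassModel.limitLaw_correct_eq_one (Mu := Mu) hM h2 h3 hf hR hrank hκ
    (HDLSS.pencilShift_eq_zero_iff (τ := τsq).2 rfl)
  refine ⟨_, fun α => ∑ k, M.prior k * _, hlim, fun α => ?_, fun α => rfl, ?_, fun α hα => ?_⟩
  · exact (tendsto_finsetSum _ fun k _ => (hlim k α).const_mul _).congr fun p =>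
      (HDLSS.TwoClassModel.rate_eq hM α p).symm
  · simp only [hbest, hone]
  · simp only [hbest, hone]
    rw [← hone]
    -- Errors in the first class alone give the strict inequality, as its prior is positive and the
    -- second class contributes at most its prior.
    refine Finset.sum_lt_sum (fun k _ => ?_) ⟨0, Finset.mem_univ _, ?_⟩
    · have := HDLSS.TwoClassModel.isProbabilityMeasure_limitLaw h3 k
      exact mul_le_mul_of_nonneg_left MeasureTheory.measureReal_le_one (hM.prior_pos k).le
    · exact mul_lt_mul_of_pos_left (HDLSS.TwoClassModel.limitLaw_correct_lt_one hM h2 h3 hf hR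
        fun h => hα (HDLSS.pencilShift_eq_zero_iff.1 h)) (hM.prior_pos 0)
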